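/- Let $k$ be a field and $A$ a Hopf algebra over $k$ with coproduct $\Delta a=a_{(1)}\otimes a_{(2)}$, counit $\epsilon$ and antipode $S$, and let $\mathcal R:A\otimes A\to k$ be a coquasitriangular structure on $A$: a convolution-invertible linear map with $$b_{(1)}a_{(1)}\mathcal R(a_{(2)}\otimes b_{(2)})=\mathcal R(a_{(1)}\otimes b_{(1)})a_{(2)}b_{(2)},$$ $$\mathcal R(ab\otimes c)=\mathcal R(a\otimes c_{(1)})\mathcal R(b\otimes c_{(2)}),\qquad \mathcal R(a\otimes bc)=\mathcal R(a_{(1)}\otimes c)\mathcal R(a_{(2)}\otimes b).$$ Let $\mathcal M^A$ be the category of right $A$-comodules $v\mapsto v_{(\bar 0)}\otimes v_{(\bar 1)}$, with tensor product coaction $v\otimes w\mapsto v_{(\bar 0)}\otimes w_{(\bar 0)}\otimes v_{(\bar 1)}w_{(\bar 1)}$ and braiding $\Psi(v\otimes w)=w_{(\bar 0)}\otimes v_{(\bar 0)}\,\mathcal R(v_{(\bar 1)}\otimes w_{(\bar 1)})$. Regard $A$ as an object of $\mathcal M^A$ by the adjoint coaction $a_{(\bar 0)}\otimes a_{(\bar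 1)}=a_{(2)}\otimes (Sa_{(1)})a_{(3)}$. Let $\mathcal Q(a\otimes b)=\mathcal R(b_{(1)}\otimes a_{(1)})\mathcal R(a_{(2)}\otimes b_{(2)})$ be the quantum Killing form. The transmutation $B(A)$ is the vector space $A$ with this coaction, the unit and coalgebra structure of $A$, the product $a\bullet b=a_{(\bar 0)}b_{(2)}\,\mathcal R(a_{(\bar 1)}\otimes Sb_{(1)})$ and the antipode $\underline S a=(Sa_{(1)})_{(\bar 0)}\,\mathcal R((Sa_{(1)})_{(\bar 1)}\otimes a_{(2)})$. A braided-Lie algebra in $\mathcal M^A$ is a coalgebra $(\mathcal L,\Delta,\epsilon)$ in $\mathcal M^A$ with a morphism $[\,,]:\mathcal L\otimes\mathcal L\to\mathcal L$ such that * (L1) $[\,,]({\rm id}\otimes[\,,])=[\,,]([\,,]\otimes[\,,])({\rm id}\otimes\Psi\otimes{\rm id})(\Delta\otimes{\rm id}\otimes{\rm id})$; * (L2) $\Psi\tilde\Psi=({\rm id}\otimes[\,,])(\Delta\otimes{\rm id})$, where $\tilde\Psi=([\,,]\otimes{\rm id})({\rm id}\otimes\Psi)(\Delta\otimes{\rm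 id})$; * (L3) $\Delta[\,,]=([\,,]\otimes[\,,])({\rm id}\otimes\Psi\otimes{\rm id})(\Delta\otimes\Delta)$ and $\epsilon[\,,]=\epsilon\otimes\epsilon$. Its braided enveloping algebra $U(\mathcal L)$ is the quotient of the tensor algebra of $\mathcal L$ by the relations $xy=\cdot\,\tilde\Psi(x\otimes y)$ for $x,y\in\mathcal L$. A Hopf algebra in $\mathcal M^A$ is called Ad-cocommutative if (L2) holds with its braided adjoint action $\underline{\rm Ad}=\cdot\,({\rm id}\otimes\cdot)({\rm id}\otimes\Psi)({\rm id}\otimes \underline S\otimes{\rm id})(\Delta\otimes{\rm id})$ in place of $[\,,]$. **Theorem.** $B(A)$ is a Hopf algebra in $\mathcal M^A$ and is Ad-cocommutative; its braided adjoint action is $$[a,b]:=\underline{\rm Ad}_a(b)=b_{(\bar 0)}\,\mathcal Q(a\otimes b_{(\bar 1)})\qquad(a,b\in A),$$ and this bracket makes $A$ a braided-Lie algebra in $\mathcal M^A$. By restriction (of coproduct, counit, coaction and bracket), every subcoalgebra $\mathcal L\subseteq A$ is a braided-Lie algebra in $\mathcal M^A$. Moreover, for every subcoalgebra $\mathcal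 L$, $U(\mathcal L)$ is a bialgebra in $\mathcal M^A$ whose coproduct, counit and coaction extend those of $\mathcal L$, and the inclusion $\mathcal L\subseteq A$ extends to a morphism $U(\mathcal L)\to B(A)$ of bialgebras in $\mathcal M^A$. Its image is the subalgebra of $A$ generated by $\mathcal L$, so that it is a surjection $U(\mathcal L)\twoheadrightarrow B(A)$ if and only if $\mathcal L$ generates $A$ as an algebra (in particular for $\mathcal L=A$). -/

import Mathlib

open scoped TensorProduct

noncomputable section

namespace BraidedLie

universe u v w

section Category

variable {k : Type u} [Field k] {A : Type v} [Ring A] [HopfAlgebra k A]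
variable {V : Type w} [AddCommMonoid V] [Module k V]
variable {W : Type*} [AddCommMonoid W] [Module k W]

/-- `R : A ⊗ A → k` is a coquasitriangular structure on the Hopf algebra `A`: it is invertible
for the convolution product and, in Sweedler notation,
* `b₁ a₁ R(a₂ ⊗ b₂) = R(a₁ ⊗ b₁) a₂ b₂`,
* `R(a b ⊗ c) = R(a ⊗ c₁) R(b ⊗ c₂)`,
* `R(a ⊗ b c) = R(a₁ ⊗ c) R(a₂ ⊗ b)`.
The coproduct of `A ⊗ A` is `a ⊗ b ↦ (a₁ ⊗ b₁) ⊗ (a₂ ⊗ b₂)`. -/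
structure IsCoquasitriangular (R : A ⊗[k] A →ₗ[k] k) : Prop where
  isUnit : IsUnit (WithConv.toConv R)
  quasi_comm :
    (TensorProduct.rid k A).toLinearMap ∘ₗ
        TensorProduct.map (LinearMap.mul' k A ∘ₗ (TensorProduct.comm k A A).toLinearMap) R ∘ₗ
        Coalgebra.comul (R := k) (A := A ⊗[k] A) =
      (TensorProduct.lid k A).toLinearMap ∘ₗ
        TensorProduct.map R (LinearMap.mul' k A) ∘ₗ
        Coalgebra.comul (R := k) (A := A ⊗[k] A)
  mul_left :
    R ∘ₗ TensorProduct.map (LinearMap.mul' k A) (LinearMap.id : A →ₗ[k] A) =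
      LinearMap.mul' k k ∘ₗ TensorProduct.map R R ∘ₗ
        (TensorProduct.tensorTensorTensorComm k A A A A).toLinearMap ∘ₗ
        TensorProduct.map (LinearMap.id : A ⊗[k] A →ₗ[k] A ⊗[k] A)
          (Coalgebra.comul (R := k) (A := A))
  mul_right :
    R ∘ₗ TensorProduct.map (LinearMap.id : A →ₗ[k] A) (LinearMap.mul' k A) =
      LinearMap.mul' k k ∘ₗ TensorProduct.map R R ∘ₗ
        (TensorProduct.tensorTensorTensorComm k A A A A).toLinearMap ∘ₗ
        TensorProduct.map (Coalgebra.comul (R := k) (A := A))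
          (TensorProduct.comm k A A).toLinearMap

/-! ### The braided category of right `A`-comodules

An object is a `k`-module `V` with a right coaction `ρ : V → V ⊗ A`, `v ↦ v₀ ⊗ v₁`. -/

/-- The axioms of a right coaction. -/
structure IsRightComodule (ρ : V →ₗ[k] V ⊗[k] A) : Prop where
  coassoc :
    (TensorProduct.assoc k V A A).toLinearMap ∘ₗ
        TensorProduct.map ρ (LinearMap.id : A →ₗ[k] A) ∘ₗ ρ =
      TensorProduct.map (LinearMap.id : V →ₗ[k] V) (Coalgebra.comul (R := k) (A := A)) ∘ₗ ρ
  counit :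
    (TensorProduct.rid k V).toLinearMap ∘ₗ
        TensorProduct.map (LinearMap.id : V →ₗ[k] V) (Coalgebra.counit (R := k) (A := A)) ∘ₗ ρ =
      LinearMap.id

/-- Morphisms of right comodules. -/
def IsComoduleHom (ρV : V →ₗ[k] V ⊗[k] A) (ρW : W →ₗ[k] W ⊗[k] A) (f : V →ₗ[k] W) : Prop :=
  ρW ∘ₗ f = TensorProduct.map f (LinearMap.id : A →ₗ[k] A) ∘ₗ ρV

/-- The tensor product coaction `v ⊗ w ↦ (v₀ ⊗ w₀) ⊗ v₁ w₁`. -/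
def tensorCoaction (ρV : V →ₗ[k] V ⊗[k] A) (ρW : W →ₗ[k] W ⊗[k] A) :
    V ⊗[k] W →ₗ[k] (V ⊗[k] W) ⊗[k] A :=
  TensorProduct.map (LinearMap.id : V ⊗[k] W →ₗ[k] V ⊗[k] W) (LinearMap.mul' k A) ∘ₗ
    (TensorProduct.tensorTensorTensorComm k V A W A).toLinearMap ∘ₗ TensorProduct.map ρV ρW

variable (k A) in
/-- The coaction `c ↦ c ⊗ 1` of the unit object `k`. -/
def unitCoaction : k →ₗ[k] k ⊗[k] A :=
  (TensorProduct.mk k k A).flip 1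

/-- The braiding `Ψ(v ⊗ w) = w₀ ⊗ v₀ R(v₁ ⊗ w₁)`. -/
def braiding (R : A ⊗[k] A →ₗ[k] k) (ρV : V →ₗ[k] V ⊗[k] A) (ρW : W →ₗ[k] W ⊗[k] A) :
    V ⊗[k] W →ₗ[k] W ⊗[k] V :=
  (TensorProduct.rid k (W ⊗[k] V)).toLinearMap ∘ₗ
    TensorProduct.map (TensorProduct.comm k V W).toLinearMap R ∘ₗ
    (TensorProduct.tensorTensorTensorComm k V A W A).toLinearMap ∘ₗ TensorProduct.map ρV ρW

/-- `id ⊗ f ⊗ id` on `V ⊗ V ⊗ V ⊗ V`, bracketed in pairs. -/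
def middle (f : V ⊗[k] V →ₗ[k] V ⊗[k] V) :
    (V ⊗[k] V) ⊗[k] (V ⊗[k] V) →ₗ[k] (V ⊗[k] V) ⊗[k] (V ⊗[k] V) :=
  (TensorProduct.assoc k V V (V ⊗[k] V)).symm.toLinearMap ∘ₗ
    TensorProduct.map (LinearMap.id : V →ₗ[k] V)
      ((TensorProduct.assoc k V V V).toLinearMap ∘ₗ
        TensorProduct.map f (LinearMap.id : V →ₗ[k] V) ∘ₗ
        (TensorProduct.assoc k V V V).symm.toLinearMap) ∘ₗ
    (TensorProduct.assoc k V V (V ⊗[k] V)).toLinearMap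

/-- `(V, Δ, ε)` is a coalgebra in the category of right `A`-comodules. -/
structure IsCoalgebraIn (ρ : V →ₗ[k] V ⊗[k] A)
    (Δ : V →ₗ[k] V ⊗[k] V) (ε : V →ₗ[k] k) : Prop where
  comodule : IsRightComodule ρ
  comul_hom : IsComoduleHom ρ (tensorCoaction ρ ρ) Δ
  counit_hom : IsComoduleHom ρ (unitCoaction k A) ε
  coassoc :
    (TensorProduct.assoc k V V V).toLinearMap ∘ₗ
        TensorProduct.map Δ (LinearMap.id : V →ₗ[k] V) ∘ₗ Δ =
      TensorProduct.map (LinearMap.id : V →ₗ[k] V) Δ ∘ₗ Δ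
  counit_left :
    (TensorProduct.lid k V).toLinearMap ∘ₗ
      TensorProduct.map ε (LinearMap.id : V →ₗ[k] V) ∘ₗ Δ = LinearMap.id
  counit_right :
    (TensorProduct.rid k V).toLinearMap ∘ₗ
      TensorProduct.map (LinearMap.id : V →ₗ[k] V) ε ∘ₗ Δ = LinearMap.id

/-- `(V, m, η)` is a (unital, associative) algebra in the category of right `A`-comodules. -/
structure IsAlgebraIn (ρ : V →ₗ[k] V ⊗[k] A)
    (m : V ⊗[k] V →ₗ[k] V) (η : k →ₗ[k] V) : Prop where
  comodule : IsRightComodule ρ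
  mul_hom : IsComoduleHom (tensorCoaction ρ ρ) ρ m
  unit_hom : IsComoduleHom (unitCoaction k A) ρ η
  assoc :
    m ∘ₗ TensorProduct.map m (LinearMap.id : V →ₗ[k] V) =
      m ∘ₗ TensorProduct.map (LinearMap.id : V →ₗ[k] V) m ∘ₗ
        (TensorProduct.assoc k V V V).toLinearMap
  unit_left :
    m ∘ₗ TensorProduct.map η (LinearMap.id : V →ₗ[k] V) = (TensorProduct.lid k V).toLinearMap
  unit_right :
    m ∘ₗ TensorProduct.map (LinearMap.id : V →ₗ[k] V) η = (TensorProduct.rid k V).toLinearMap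

/-- `(V, m, η, Δ, ε)` is a bialgebra in the braided category of right `A`-comodules: `Δ` and `ε`
are algebra maps, where `V ⊗ V` has the braided tensor product algebra structure. -/
structure IsBialgebraIn (R : A ⊗[k] A →ₗ[k] k) (ρ : V →ₗ[k] V ⊗[k] A)
    (m : V ⊗[k] V →ₗ[k] V) (η : k →ₗ[k] V)
    (Δ : V →ₗ[k] V ⊗[k] V) (ε : V →ₗ[k] k) : Prop where
  algebra : IsAlgebraIn ρ m η
  coalgebra : IsCoalgebraIn ρ Δ ε
  comul_mul :
    Δ ∘ₗ m = TensorProduct.map m m ∘ₗ middle (braiding R ρ ρ) ∘ₗ TensorProduct.map Δ Δ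
  comul_unit : Δ (η 1) = η 1 ⊗ₜ[k] η 1
  counit_mul : ε ∘ₗ m = LinearMap.mul' k k ∘ₗ TensorProduct.map ε ε
  counit_unit : ε (η 1) = 1

/-- `(V, m, η, Δ, ε, S)` is a Hopf algebra in the braided category of right `A`-comodules. -/
structure IsHopfAlgebraIn (R : A ⊗[k] A →ₗ[k] k) (ρ : V →ₗ[k] V ⊗[k] A)
    (m : V ⊗[k] V →ₗ[k] V) (η : k →ₗ[k] V)
    (Δ : V →ₗ[k] V ⊗[k] V) (ε : V →ₗ[k] k) (S : V →ₗ[k] V) : Prop where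
  bialgebra : IsBialgebraIn R ρ m η Δ ε
  antipode_hom : IsComoduleHom ρ ρ S
  antipode_left : m ∘ₗ TensorProduct.map S (LinearMap.id : V →ₗ[k] V) ∘ₗ Δ = η ∘ₗ ε
  antipode_right : m ∘ₗ TensorProduct.map (LinearMap.id : V →ₗ[k] V) S ∘ₗ Δ = η ∘ₗ ε

/-- Morphisms of bialgebras in the category of right `A`-comodules. -/
structure IsBialgebraHomIn
    (ρV : V →ₗ[k] V ⊗[k] A) (mV : V ⊗[k] V →ₗ[k] V) (ηV : k →ₗ[k] V)
    (ΔV : V →ₗ[k] V ⊗[k] V) (εV : V →ₗ[k] k)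
    (ρW : W →ₗ[k] W ⊗[k] A) (mW : W ⊗[k] W →ₗ[k] W) (ηW : k →ₗ[k] W)
    (ΔW : W →ₗ[k] W ⊗[k] W) (εW : W →ₗ[k] k) (f : V →ₗ[k] W) : Prop where
  hom : IsComoduleHom ρV ρW f
  map_mul : f ∘ₗ mV = mW ∘ₗ TensorProduct.map f f
  map_unit : f ∘ₗ ηV = ηW
  map_comul : ΔW ∘ₗ f = TensorProduct.map f f ∘ₗ ΔV
  map_counit : εW ∘ₗ f = εV

/-- The braided adjoint action of a Hopf algebra in the category on itself,
`Ad = m (id ⊗ m) (id ⊗ Ψ) (id ⊗ S ⊗ id) (Δ ⊗ id)`, that is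
`Ad_a(b) = a₁ b₀ (S a₂)₀ R((S a₂)₁ ⊗ b₁)`. -/
def braidedAd (R : A ⊗[k] A →ₗ[k] k) (ρ : V →ₗ[k] V ⊗[k] A)
    (m : V ⊗[k] V →ₗ[k] V) (Δ : V →ₗ[k] V ⊗[k] V) (S : V →ₗ[k] V) : V ⊗[k] V →ₗ[k] V :=
  m ∘ₗ TensorProduct.map (LinearMap.id : V →ₗ[k] V)
      (m ∘ₗ braiding R ρ ρ ∘ₗ TensorProduct.map S (LinearMap.id : V →ₗ[k] V)) ∘ₗ
    (TensorProduct.assoc k V V V).toLinearMap ∘ₗ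
    TensorProduct.map Δ (LinearMap.id : V →ₗ[k] V)

/-- The associated braiding `Ψ̃ = (br ⊗ id) (id ⊗ Ψ) (Δ ⊗ id)` of a bracket `br`. -/
def lieBraiding (R : A ⊗[k] A →ₗ[k] k) (ρ : V →ₗ[k] V ⊗[k] A)
    (Δ : V →ₗ[k] V ⊗[k] V) (br : V ⊗[k] V →ₗ[k] V) : V ⊗[k] V →ₗ[k] V ⊗[k] V :=
  TensorProduct.map br (LinearMap.id : V →ₗ[k] V) ∘ₗ
    (TensorProduct.assoc k V V V).symm.toLinearMap ∘ₗ
    TensorProduct.map (LinearMap.id : V →ₗ[k] V) (braiding R ρ ρ) ∘ₗ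
    (TensorProduct.assoc k V V V).toLinearMap ∘ₗ
    TensorProduct.map Δ (LinearMap.id : V →ₗ[k] V)

/-- Braided cocommutativity with respect to `br : V ⊗ V → V`:
`Ψ (br ⊗ id) (id ⊗ Ψ) (Δ ⊗ id) = (id ⊗ br) (Δ ⊗ id)`. -/
def IsCocommutativeWrt (R : A ⊗[k] A →ₗ[k] k) (ρ : V →ₗ[k] V ⊗[k] A)
    (Δ : V →ₗ[k] V ⊗[k] V) (br : V ⊗[k] V →ₗ[k] V) : Prop :=
  braiding R ρ ρ ∘ₗ lieBraiding R ρ Δ br =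
    TensorProduct.map (LinearMap.id : V →ₗ[k] V) br ∘ₗ
      (TensorProduct.assoc k V V V).toLinearMap ∘ₗ
      TensorProduct.map Δ (LinearMap.id : V →ₗ[k] V)

/-- A Hopf algebra in the category is Ad-cocommutative if it is braided cocommutative with respect
to its braided adjoint action. -/
def IsAdCocommutative (R : A ⊗[k] A →ₗ[k] k) (ρ : V →ₗ[k] V ⊗[k] A)
    (m : V ⊗[k] V →ₗ[k] V) (Δ : V →ₗ[k] V ⊗[k] V) (S : V →ₗ[k] V) : Prop :=
  IsCocommutativeWrt R ρ Δ (braidedAd R ρ m Δ S)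

/-- A (left) braided-Lie algebra in the braided category of right `A`-comodules: a coalgebra in the
category with a morphism `br : V ⊗ V → V` obeying
* the braided Jacobi identity
  `br (id ⊗ br) = br (br ⊗ br) (id ⊗ Ψ ⊗ id) (Δ ⊗ id ⊗ id)`,
* braided cocommutativity,
* `br` is a map of coalgebras, `V ⊗ V` having the braided tensor product coalgebra structure. -/
structure IsBraidedLieAlgebra (R : A ⊗[k] A →ₗ[k] k) (ρ : V →ₗ[k] V ⊗[k] A)
    (Δ : V →ₗ[k] V ⊗[k] V) (ε : V →ₗ[k] k) (br : V ⊗[k] V →ₗ[k] V) : Prop where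
  coalgebra : IsCoalgebraIn ρ Δ ε
  bracket_hom : IsComoduleHom (tensorCoaction ρ ρ) ρ br
  jacobi :
    br ∘ₗ TensorProduct.map (LinearMap.id : V →ₗ[k] V) br =
      br ∘ₗ TensorProduct.map br br ∘ₗ middle (braiding R ρ ρ) ∘ₗ
        TensorProduct.map Δ (LinearMap.id : V ⊗[k] V →ₗ[k] V ⊗[k] V)
  cocomm : IsCocommutativeWrt R ρ Δ br
  comul_bracket :
    Δ ∘ₗ br = TensorProduct.map br br ∘ₗ middle (braiding R ρ ρ) ∘ₗ TensorProduct.map Δ Δ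
  counit_bracket : ε ∘ₗ br = LinearMap.mul' k k ∘ₗ TensorProduct.map ε ε

end Category

section Enveloping

variable {k : Type u} [Field k] {V : Type w} [AddCommMonoid V] [Module k V]

/-- The relations `a b = · Ψ̃(a ⊗ b)` on the tensor algebra. -/
inductive EnvelopingRel (Ψt : V ⊗[k] V →ₗ[k] V ⊗[k] V) :
    TensorAlgebra k V → TensorAlgebra k V → Prop
  | rel (x : V ⊗[k] V) : EnvelopingRel Ψt
      (LinearMap.mul' k (TensorAlgebra k V)
        (TensorProduct.map (TensorAlgebra.ι k) (TensorAlgebra.ι k) x))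
      (LinearMap.mul' k (TensorAlgebra k V)
        (TensorProduct.map (TensorAlgebra.ι k) (TensorAlgebra.ι k) (Ψt x)))

/-- The algebra generated by `V` with the relations of commutativity with respect to `Ψ̃`. For `Ψ̃`
the associated braiding of a braided-Lie algebra it is the braided enveloping algebra. -/
abbrev Enveloping (Ψt : V ⊗[k] V →ₗ[k] V ⊗[k] V) : Type (max u w) :=
  RingQuot (EnvelopingRel Ψt)

/-- The canonical map of the generators into the enveloping algebra. -/
def Enveloping.ι (Ψt : V ⊗[k] V →ₗ[k] V ⊗[k] V) : V →ₗ[k] Enveloping Ψt :=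
  (RingQuot.mkAlgHom k (EnvelopingRel Ψt)).toLinearMap ∘ₗ TensorAlgebra.ι k

end Enveloping

section Transmutation

variable {k : Type u} [Field k] {A : Type v} [Ring A] [HopfAlgebra k A]

variable (k A) in
/-- The right adjoint coaction `Ad_R(a) = a₂ ⊗ (S a₁) a₃`. -/
def adR : A →ₗ[k] A ⊗[k] A :=
  TensorProduct.map (LinearMap.id : A →ₗ[k] A)
      (LinearMap.mul' k A ∘ₗ
        TensorProduct.map (HopfAlgebra.antipode k (A := A)) (LinearMap.id : A →ₗ[k] A)) ∘ₗ
    (TensorProduct.leftComm k A A A).toLinearMap ∘ₗ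
    TensorProduct.map (LinearMap.id : A →ₗ[k] A) (Coalgebra.comul (R := k) (A := A)) ∘ₗ
    Coalgebra.comul (R := k) (A := A)

/-- The quantum Killing form `Q(a ⊗ b) = R(b₁ ⊗ a₁) R(a₂ ⊗ b₂)`. -/
def quantumKilling (R : A ⊗[k] A →ₗ[k] k) : A ⊗[k] A →ₗ[k] k :=
  LinearMap.mul' k k ∘ₗ TensorProduct.map (R ∘ₗ (TensorProduct.comm k A A).toLinearMap) R ∘ₗ
    Coalgebra.comul (R := k) (A := A ⊗[k] A)

/-- The bracket `[a, b] = b₀ Q(a ⊗ b₁)`, where `b₀ ⊗ b₁ = Ad_R(b)`. -/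
def bracket (R : A ⊗[k] A →ₗ[k] k) : A ⊗[k] A →ₗ[k] A :=
  (TensorProduct.rid k A).toLinearMap ∘ₗ
    TensorProduct.map (LinearMap.id : A →ₗ[k] A) (quantumKilling R) ∘ₗ
    (TensorProduct.leftComm k A A A).toLinearMap ∘ₗ
    TensorProduct.map (LinearMap.id : A →ₗ[k] A) (adR k A)

/-- The product `a • b = a₀ b₂ R(a₁ ⊗ S b₁)` of the transmutation `B(A)`,
where `a₀ ⊗ a₁ = Ad_R(a)`. -/
def transMul (R : A ⊗[k] A →ₗ[k] k) : A ⊗[k] A →ₗ[k] A :=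
  (TensorProduct.rid k A).toLinearMap ∘ₗ
    TensorProduct.map (LinearMap.mul' k A)
      (R ∘ₗ TensorProduct.map (LinearMap.id : A →ₗ[k] A) (HopfAlgebra.antipode k (A := A))) ∘ₗ
    (TensorProduct.tensorTensorTensorComm k A A A A).toLinearMap ∘ₗ
    TensorProduct.map (adR k A)
      ((TensorProduct.comm k A A).toLinearMap ∘ₗ Coalgebra.comul (R := k) (A := A))

/-- The braided antipode `a ↦ (S a₁)₀ R((S a₁)₁ ⊗ a₂)` of the transmutation `B(A)`, where
`(S a₁)₀ ⊗ (S a₁)₁ = Ad_R(S a₁)`. -/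
def transAntipode (R : A ⊗[k] A →ₗ[k] k) : A →ₗ[k] A :=
  (TensorProduct.rid k A).toLinearMap ∘ₗ
    TensorProduct.map (LinearMap.id : A →ₗ[k] A) R ∘ₗ
    (TensorProduct.assoc k A A A).toLinearMap ∘ₗ
    TensorProduct.map (adR k A ∘ₗ HopfAlgebra.antipode k (A := A)) (LinearMap.id : A →ₗ[k] A) ∘ₗ
    Coalgebra.comul (R := k) (A := A)

/-- `L ⊆ A` is a subcoalgebra: `Δ(L) ⊆ L ⊗ L`. -/
def IsSubcoalgebra (L : Submodule k A) : Prop :=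
  L.map (Coalgebra.comul (R := k) (A := A)) ≤
    LinearMap.range (TensorProduct.map L.subtype L.subtype)

end Transmutation

end BraidedLie

end

/-! Sweedler computations are replaced by a calculus of commuting coactions. If `ρ` and `σ` are
commuting right coactions on `X`, a form `F` on `A ⊗ A` defines the operator `Rop F ρ σ`, x ↦ x₀₀
F(x₀₁ ⊗ x₁), whose first argument is the leg of `ρ`. The axioms of `R` become operator identities.
Convolution becomes composition (`Rop_conv`). Multiplicativity splits the operator of a product of
coactions (`Rop_mulCo_left`, `Rop_mulCo_right`). Quasi-commutativity says that `Rop R ρ σ`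
intertwines `mulCo ρ σ` with `mulCo σ ρ` (`isComoduleHom_Rop_mulCo`). Yang–Baxter follows from these
by naturality.

Notation for the comments below: lᵢ, rᵢ, adᵢ are `coL`, `coR`, `adR` on the i-th tensor factor,
juxtaposed coactions are multiplied by `mulCo`, R(ρ, σ) is `Rop R ρ σ`, R⁻¹(ρ, σ) is the operator of
the convolution inverse, and in a composite the right-hand operator acts first. The coactions l and
r commute and ad = l r (`adR_eq`). The product • is ordinary multiplication after R(ad₁, l₂). The
bracket is the counit of factor 1 after R(ad₂, r₁) R(r₁, ad₂). The Hopf algebra enters mainly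
through the way l and r pass through product, coproduct and antipode, above all through the fact
that r₁ l₂ is trivial on coproducts (`isComoduleHom_comul_triv`). Each identity for B(A) is then a
rearrangement of operators.

The bracket is the case `X = A` of an action `adAct` of A on every comodule. This action is natural
in comodule maps (`adAct_natural`) and compatible with tensor products (`adAct_tensor`). Naturality
along the bracket is the Jacobi identity (L1), and naturality along Δ and ε is (L3). The associated
braiding has the closed form Ψ̃ = R⁻¹(ad₁, l₂) ∘ flip ∘ R(r₁, ad₂) (`lieBraiding_bracket`). It
yields cocommutativity (L2), the identity • ∘ Ψ̃ = • (`transMul_lieBraiding`), and that Ψ̃ respects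
the braided coalgebra structure of A ⊗ A (`middle_comul_lieBraiding`). Convolving • ∘ Ψ̃ = • with
the braided antipode identifies the braided adjoint action with the bracket.

Over a field the square of an injective map is injective, so all these identities restrict to a
subcoalgebra L. Since Ψ̃ is a map of comodules and of coalgebras, the coaction, coproduct and counit
of L respect the relations of U(L), and • ∘ Ψ̃ = • lets the inclusion of L extend to U(L). For the
image, • differs from the ordinary product by R(ad₁, l₂), and this operator and its inverse both
preserve C ⊗ C for every subcoalgebra C. Hence C is closed under one product exactly when it is
closed under the other; this applies to the image and to the subalgebra generated by L. -/

noncomputable section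

namespace BraidedLie

/-! ### Commuting coactions and the operators of forms. -/

section Calculus

open TensorProduct LinearMap

variable {k : Type*} [Field k] {A : Type*} [Ring A] [HopfAlgebra k A]
variable {X : Type*} [AddCommMonoid X] [Module k X]
variable {Y : Type*} [AddCommMonoid Y] [Module k Y]
variable {Z : Type*} [AddCommMonoid Z] [Module k Z]
variable {W : Type*} [AddCommMonoid W] [Module k W]
variable {C : Type*} [AddCommMonoid C] [Module k C]

/-! Shortcut instances, which keep the search from trying the classes of ring homomorphisms. -/

instance addHomClassLinearMap : AddHomClass (X →ₗ[k] Y) X Y :=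
  AddMonoidHomClass.toAddHomClass
instance zeroHomClassLinearMap : ZeroHomClass (X →ₗ[k] Y) X Y :=
  AddMonoidHomClass.toZeroHomClass
instance addHomClassLinearEquiv : AddHomClass (X ≃ₗ[k] Y) X Y :=
  AddMonoidHomClass.toAddHomClass
instance zeroHomClassLinearEquiv : ZeroHomClass (X ≃ₗ[k] Y) X Y :=
  AddMonoidHomClass.toZeroHomClass

/-- Evaluation of the second leg of `X ⊗ C` on a functional. -/
def slice (φ : C →ₗ[k] k) : X ⊗[k] C →ₗ[k] X :=
  (TensorProduct.rid k X).toLinearMap ∘ₗ TensorProduct.map LinearMap.id φ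

@[simp] lemma slice_tmul (φ : C →ₗ[k] k) (x : X) (c : C) :
    slice φ (x ⊗ₜ[k] c) = φ c • x := by simp [slice]

lemma slice_map (φ : C →ₗ[k] k) (f : X →ₗ[k] Y) (t : X ⊗[k] C) :
    slice φ (TensorProduct.map f LinearMap.id t) = f (slice φ t) := by
  induction t using TensorProduct.induction_on with
  | zero => simp
  | tmul x c => simp
  | add x y hx hy => simp [hx, hy]

/-- The operator that a functional `φ` on `C` defines on a space with a map `δ : X → X ⊗ C`. -/
def act (δ : X →ₗ[k] X ⊗[k] C) (φ : C →ₗ[k] k) : X →ₗ[k] X := slice φ ∘ₗ δ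

/-- For a right coaction the order is not reversed: `ψ` evaluates the outer leg, so it acts first,
and `φ` evaluates the leg produced afterwards. -/
lemma act_mul [Coalgebra k C] {δ : X →ₗ[k] X ⊗[k] C}
    (hδ : (TensorProduct.assoc k X C C).toLinearMap ∘ₗ TensorProduct.map δ LinearMap.id ∘ₗ δ =
      TensorProduct.map LinearMap.id Coalgebra.comul ∘ₗ δ) (φ ψ : WithConv (C →ₗ[k] k)) :
    act δ (φ * ψ).ofConv = act δ φ.ofConv ∘ₗ act δ ψ.ofConv := by
  have h1 : (slice (φ * ψ).ofConv : X ⊗[k] C →ₗ[k] X) =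
      slice (LinearMap.mul' k k ∘ₗ TensorProduct.map φ.ofConv ψ.ofConv) ∘ₗ
        TensorProduct.map LinearMap.id Coalgebra.comul := by
    ext; simp
  have h2 : slice (X := X) (LinearMap.mul' k k ∘ₗ TensorProduct.map φ.ofConv ψ.ofConv) ∘ₗ
      (TensorProduct.assoc k X C C).toLinearMap =
      slice φ.ofConv ∘ₗ slice ψ.ofConv := by
    ext x c d; simp [mul_smul, smul_comm (φ.ofConv c)]
  have h3 : slice ψ.ofConv ∘ₗ TensorProduct.map δ LinearMap.id = δ ∘ₗ slice ψ.ofConv := by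
    ext x c; simp
  rw [act, h1, LinearMap.comp_assoc, ← hδ, ← LinearMap.comp_assoc, h2, LinearMap.comp_assoc,
    ← LinearMap.comp_assoc _ _ (slice ψ.ofConv), h3]
  rfl

/-- The coaction on the first factor of `X ⊗ Y`. -/
def lft (ρ : X →ₗ[k] X ⊗[k] A) : X ⊗[k] Y →ₗ[k] (X ⊗[k] Y) ⊗[k] A :=
  (TensorProduct.rightComm k X A Y).toLinearMap ∘ₗ TensorProduct.map ρ LinearMap.id

/-- The coaction on the second factor of `X ⊗ Y`. -/
def rgt (σ : Y →ₗ[k] Y ⊗[k] A) : X ⊗[k] Y →ₗ[k] (X ⊗[k] Y) ⊗[k] A :=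
  (TensorProduct.assoc k X Y A).symm.toLinearMap ∘ₗ TensorProduct.map LinearMap.id σ

/-- Two coactions on `X` commute. -/
def Comm (ρ σ : X →ₗ[k] X ⊗[k] A) : Prop := IsComoduleHom ρ (lft ρ) σ

lemma Comm.symm {ρ σ : X →ₗ[k] X ⊗[k] A} (h : Comm ρ σ) : Comm σ ρ := by
  have hh : (TensorProduct.rightComm k X A A).toLinearMap ∘ₗ
    (TensorProduct.rightComm k X A A).toLinearMap = LinearMap.id := by ext; simp
  rw [Comm, IsComoduleHom, lft, LinearMap.comp_assoc, ← h, lft, LinearMap.comp_assoc,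
    ← LinearMap.comp_assoc, hh, LinearMap.id_comp]

/-- The map `X → X ⊗ (A ⊗ A)` defined by two coactions. -/
def pair (ρ σ : X →ₗ[k] X ⊗[k] A) : X →ₗ[k] X ⊗[k] (A ⊗[k] A) :=
  (TensorProduct.assoc k X A A).toLinearMap ∘ₗ TensorProduct.map ρ LinearMap.id ∘ₗ σ

/-- The product of two coactions, `x ↦ x₀₀ ⊗ x₀₁ x₁`. -/
def mulCo (ρ σ : X →ₗ[k] X ⊗[k] A) : X →ₗ[k] X ⊗[k] A :=
  TensorProduct.map LinearMap.id (LinearMap.mul' k A) ∘ₗ pair ρ σ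

/-- The trivial coaction. -/
def triv : X →ₗ[k] X ⊗[k] A := (TensorProduct.mk k X A).flip 1

@[simp] lemma triv_apply (x : X) : (triv : X →ₗ[k] X ⊗[k] A) x = x ⊗ₜ 1 := rfl

/-- The operator `x ↦ x₀₀ F(x₀₁ ⊗ x₁)` that a form `F` defines on a space with two coactions. -/
def Rop (F : A ⊗[k] A →ₗ[k] k) (ρ σ : X →ₗ[k] X ⊗[k] A) : X →ₗ[k] X := act (pair ρ σ) F

lemma Comm.pair_eq {ρ σ : X →ₗ[k] X ⊗[k] A} (h : Comm ρ σ) :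
    pair ρ σ = TensorProduct.map LinearMap.id (TensorProduct.comm k A A).toLinearMap ∘ₗ
      pair σ ρ := by
  have h1 : (TensorProduct.assoc k X A A).toLinearMap =
    TensorProduct.map LinearMap.id (TensorProduct.comm k A A).toLinearMap ∘ₗ
      (TensorProduct.assoc k X A A).toLinearMap ∘ₗ
      (TensorProduct.rightComm k X A A).toLinearMap := by ext; simp
  have h2 := h
  rw [Comm, IsComoduleHom, lft, LinearMap.comp_assoc] at h2
  rw [pair, h1, LinearMap.comp_assoc, LinearMap.comp_assoc, h2]
  rfl

/-- Two commuting coactions make `X` a right comodule over the coalgebra `A ⊗ A`; this is what makes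
convolution of forms act by composition. Commutation sorts the four legs into two of `ρ` and two of
`σ`, where the two separate coassociativity laws apply. -/
lemma Comm.pair_coassoc {ρ σ : X →ₗ[k] X ⊗[k] A} (h : Comm ρ σ) (hρ : IsRightComodule ρ)
    (hσ : IsRightComodule σ) :
    (TensorProduct.assoc k X (A ⊗[k] A) (A ⊗[k] A)).toLinearMap ∘ₗ
      TensorProduct.map (pair ρ σ) LinearMap.id ∘ₗ pair ρ σ =
      TensorProduct.map LinearMap.id Coalgebra.comul ∘ₗ pair ρ σ := by
  have e1 : TensorProduct.map (pair ρ σ) (LinearMap.id : A →ₗ[k] A) ∘ₗ ρ =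
      TensorProduct.map ((TensorProduct.assoc k X A A).toLinearMap ∘ₗ
        TensorProduct.map ρ LinearMap.id) LinearMap.id ∘ₗ
      (TensorProduct.rightComm k X A A).toLinearMap ∘ₗ TensorProduct.map ρ LinearMap.id ∘ₗ σ := by
    have := h
    rw [Comm, IsComoduleHom, lft, LinearMap.comp_assoc] at this
    rw [this, ← LinearMap.comp_assoc, ← TensorProduct.map_comp]
    rfl
  have e2 : TensorProduct.map ρ (LinearMap.id : A →ₗ[k] A) ∘ₗ ρ =
      (TensorProduct.assoc k X A A).symm.toLinearMap ∘ₗ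
        TensorProduct.map LinearMap.id Coalgebra.comul ∘ₗ ρ := by
    rw [← hρ.coassoc, ← LinearMap.comp_assoc]; ext; simp
  have e3 : TensorProduct.map σ (LinearMap.id : A →ₗ[k] A) ∘ₗ σ =
      (TensorProduct.assoc k X A A).symm.toLinearMap ∘ₗ
        TensorProduct.map LinearMap.id Coalgebra.comul ∘ₗ σ := by
    rw [← hσ.coassoc, ← LinearMap.comp_assoc]; ext; simp
  -- `Θ` takes the legs in the order ρ, ρ, σ, σ to the order ρ, σ, ρ, σ produced by the coproduct of
  -- `A ⊗ A`.
  let Θ : (((X ⊗[k] A) ⊗[k] A) ⊗[k] A) ⊗[k] A →ₗ[k] X ⊗[k] ((A ⊗[k] A) ⊗[k] (A ⊗[k] A)) :=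
    TensorProduct.map LinearMap.id (TensorProduct.tensorTensorTensorComm k A A A A).toLinearMap ∘ₗ
    (TensorProduct.assoc k X (A ⊗[k] A) (A ⊗[k] A)).toLinearMap ∘ₗ
    TensorProduct.map (TensorProduct.assoc k X A A).toLinearMap LinearMap.id ∘ₗ
    (TensorProduct.assoc k ((X ⊗[k] A) ⊗[k] A) A A).toLinearMap
  have e4 : (TensorProduct.assoc k X (A ⊗[k] A) (A ⊗[k] A)).toLinearMap ∘ₗ
      TensorProduct.map (pair ρ σ) LinearMap.id ∘ₗ pair ρ σ =
      Θ ∘ₗ TensorProduct.map (TensorProduct.map (TensorProduct.map ρ LinearMap.id ∘ₗ ρ)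
        LinearMap.id) LinearMap.id ∘ₗ (TensorProduct.map σ LinearMap.id ∘ₗ σ) := by
    have f1 : TensorProduct.map (pair ρ σ) (LinearMap.id : A ⊗[k] A →ₗ[k] A ⊗[k] A) ∘ₗ pair ρ σ =
        (TensorProduct.assoc k _ A A).toLinearMap ∘ₗ
          TensorProduct.map (TensorProduct.map (pair ρ σ) LinearMap.id ∘ₗ ρ) LinearMap.id ∘ₗ σ := by
      have n1 : TensorProduct.map (pair ρ σ) (LinearMap.id : A ⊗[k] A →ₗ[k] A ⊗[k] A) ∘ₗ
          (TensorProduct.assoc k X A A).toLinearMap = (TensorProduct.assoc k _ A A).toLinearMap ∘ₗ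
          TensorProduct.map (TensorProduct.map (pair ρ σ) LinearMap.id) LinearMap.id := by
        ext; simp
      change _ ∘ₗ (TensorProduct.assoc k X A A).toLinearMap ∘ₗ _ = _
      rw [← LinearMap.comp_assoc, n1, LinearMap.comp_assoc, ← LinearMap.comp_assoc _ _ (TensorProduct.map _ _),
        ← TensorProduct.map_comp, LinearMap.id_comp]
    have n2 : TensorProduct.map ((TensorProduct.assoc k X A A).toLinearMap ∘ₗ
        TensorProduct.map ρ LinearMap.id) LinearMap.id ∘ₗ
        (TensorProduct.rightComm k X A A).toLinearMap ∘ₗ TensorProduct.map ρ LinearMap.id =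
        TensorProduct.map (TensorProduct.assoc k X A A).toLinearMap LinearMap.id ∘ₗ
        (TensorProduct.rightComm k _ A A).toLinearMap ∘ₗ
        TensorProduct.map (TensorProduct.map ρ LinearMap.id ∘ₗ ρ) LinearMap.id := by
      ext v b
      simp only [AlgebraTensorModule.curry_apply, curry_apply, LinearMap.coe_restrictScalars,
        LinearMap.comp_apply, TensorProduct.map_tmul, LinearMap.id_apply, LinearEquiv.coe_coe]
      generalize ρ v = t
      induction t using TensorProduct.induction_on with
      | zero => simp
      | tmul x c => simp
      | add x y hx hy => simp only [map_add, add_tmul, hx, hy]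
    rw [f1, e1]
    simp only [← LinearMap.comp_assoc] at n2 ⊢
    rw [n2]
    ext x
    simp only [LinearMap.comp_apply, LinearEquiv.coe_coe, Θ]
    generalize σ x = t
    induction t using TensorProduct.induction_on with
    | zero => simp
    | add x y hx hy => simp only [map_add, hx, hy]
    | tmul x c =>
      simp only [TensorProduct.map_tmul, LinearMap.comp_apply, LinearMap.id_apply]
      generalize σ x = t
      induction t using TensorProduct.induction_on with
      | zero => simp
      | add x y hx hy => simp only [map_add, add_tmul, hx, hy]
      | tmul x d =>
        simp only [TensorProduct.map_tmul, LinearMap.comp_apply, LinearMap.id_apply]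
        generalize TensorProduct.map ρ LinearMap.id (ρ x) = t
        induction t using TensorProduct.induction_on with
        | zero => simp
        | add x y hx hy => simp only [map_add, add_tmul, hx, hy]
        | tmul x e =>
          induction x using TensorProduct.induction_on with
          | zero => simp
          | add x y hx hy => simp only [map_add, add_tmul, hx, hy]
          | tmul x f => simp
  rw [e4, e2, e3]
  ext x
  simp only [LinearMap.comp_apply, LinearEquiv.coe_coe, Θ, pair]
  generalize σ x = t
  induction t using TensorProduct.induction_on with
  | zero => simp
  | add x y hx hy => simp only [map_add, hx, hy]
  | tmul x c =>
    simp only [TensorProduct.map_tmul, LinearMap.id_apply]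
    have e5 (t : X ⊗[k] A) (c : A) : TensorProduct.map LinearMap.id Coalgebra.comul
        (TensorProduct.assoc k X A A (t ⊗ₜ[k] c)) =
        TensorProduct.map LinearMap.id
          (TensorProduct.tensorTensorTensorComm k A A A A).toLinearMap
          (TensorProduct.assoc k X (A ⊗[k] A) (A ⊗[k] A)
            (TensorProduct.map LinearMap.id Coalgebra.comul t ⊗ₜ[k] Coalgebra.comul c)) := by
      induction t using TensorProduct.induction_on with
      | zero => simp
      | add x y hx hy => simp only [map_add, add_tmul, hx, hy]
      | tmul x a => simp [TensorProduct.comul_tmul, AlgebraTensorModule.tensorTensorTensorComm_eq]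
    rw [e5]
    generalize (Coalgebra.comul c : A ⊗[k] A) = s
    induction s using TensorProduct.induction_on with
    | zero => simp
    | add x y hx hy => simp only [map_add, tmul_add, hx, hy]
    | tmul d e => simp

/-! ### Comodule morphisms -/

lemma IsComoduleHom.apply {ρ : X →ₗ[k] X ⊗[k] A} {σ : Y →ₗ[k] Y ⊗[k] A} {f : X →ₗ[k] Y}
    (h : IsComoduleHom ρ σ f) (x : X) : σ (f x) = TensorProduct.map f LinearMap.id (ρ x) :=
  LinearMap.congr_fun h x

lemma IsComoduleHom.id (ρ : X →ₗ[k] X ⊗[k] A) : IsComoduleHom ρ ρ LinearMap.id := by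
  simp [IsComoduleHom]

lemma IsComoduleHom.comp {ρ : X →ₗ[k] X ⊗[k] A} {σ : Y →ₗ[k] Y ⊗[k] A} {τ : Z →ₗ[k] Z ⊗[k] A}
    {g : Y →ₗ[k] Z} {f : X →ₗ[k] Y} (hg : IsComoduleHom σ τ g) (hf : IsComoduleHom ρ σ f) :
    IsComoduleHom ρ τ (g ∘ₗ f) := by
  rw [IsComoduleHom, ← LinearMap.comp_assoc, hg, LinearMap.comp_assoc, hf, ← LinearMap.comp_assoc,
    ← TensorProduct.map_comp, LinearMap.id_comp]

lemma pair_natural {ρ σ : X →ₗ[k] X ⊗[k] A} {ρ' σ' : Y →ₗ[k] Y ⊗[k] A} {f : X →ₗ[k] Y}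
    (hρ : IsComoduleHom ρ ρ' f) (hσ : IsComoduleHom σ σ' f) :
    pair ρ' σ' ∘ₗ f = TensorProduct.map f LinearMap.id ∘ₗ pair ρ σ := by
  have h1 : TensorProduct.map ρ' LinearMap.id ∘ₗ TensorProduct.map f (LinearMap.id : A →ₗ[k] A) =
      TensorProduct.map (TensorProduct.map f LinearMap.id) LinearMap.id ∘ₗ
        TensorProduct.map ρ LinearMap.id := by
    rw [← TensorProduct.map_comp, hρ, ← TensorProduct.map_comp]
  have h2 : TensorProduct.map f LinearMap.id ∘ₗ (TensorProduct.assoc k X A A).toLinearMap =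
      (TensorProduct.assoc k Y A A).toLinearMap ∘ₗ
        TensorProduct.map (TensorProduct.map f LinearMap.id) LinearMap.id := by ext; simp
  rw [pair, LinearMap.comp_assoc, LinearMap.comp_assoc, hσ,
    ← LinearMap.comp_assoc _ _ (TensorProduct.map ρ' _), h1, pair,
    ← LinearMap.comp_assoc _ _ (TensorProduct.map f _), h2]
  rfl

lemma IsComoduleHom.mulCo {ρ σ : X →ₗ[k] X ⊗[k] A} {ρ' σ' : Y →ₗ[k] Y ⊗[k] A} {f : X →ₗ[k] Y}
    (hρ : IsComoduleHom ρ ρ' f) (hσ : IsComoduleHom σ σ' f) :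
    IsComoduleHom (mulCo ρ σ) (mulCo ρ' σ') f := by
  rw [IsComoduleHom, BraidedLie.mulCo, LinearMap.comp_assoc, pair_natural hρ hσ,
    BraidedLie.mulCo, ← LinearMap.comp_assoc, ← LinearMap.comp_assoc, ← TensorProduct.map_comp,
    ← TensorProduct.map_comp]
  simp

lemma slice_comp_map (φ : C →ₗ[k] k) (f : X →ₗ[k] Y) :
    slice φ ∘ₗ TensorProduct.map f LinearMap.id = f ∘ₗ slice φ := by
  ext; simp

/-- The main rewriting rule: an operator crosses any map that respects both of its coactions.
Structure maps are thereby moved out of the way until only operators on a tensor power remain. -/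
lemma Rop_natural (F : A ⊗[k] A →ₗ[k] k) {ρ σ : X →ₗ[k] X ⊗[k] A} {ρ' σ' : Y →ₗ[k] Y ⊗[k] A}
    {f : X →ₗ[k] Y} (hρ : IsComoduleHom ρ ρ' f) (hσ : IsComoduleHom σ σ' f) :
    Rop F ρ' σ' ∘ₗ f = f ∘ₗ Rop F ρ σ := by
  rw [Rop, act, LinearMap.comp_assoc, pair_natural hρ hσ, ← LinearMap.comp_assoc, slice_comp_map]
  rfl

lemma IsComoduleHom.map_lft {ρ : X →ₗ[k] X ⊗[k] A} {ρ' : Y →ₗ[k] Y ⊗[k] A} {f : X →ₗ[k] Y}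
    (hf : IsComoduleHom ρ ρ' f) (g : Z →ₗ[k] W) :
    IsComoduleHom (lft ρ) (lft ρ') (TensorProduct.map f g) := by
  have h : TensorProduct.map (TensorProduct.map f g) LinearMap.id ∘ₗ
      (TensorProduct.rightComm k X A Z).toLinearMap =
      (TensorProduct.rightComm k Y A W).toLinearMap ∘ₗ
      TensorProduct.map (TensorProduct.map f LinearMap.id) g := by ext; simp
  rw [IsComoduleHom, lft, LinearMap.comp_assoc, ← TensorProduct.map_comp, hf, lft,
    ← LinearMap.comp_assoc, h, LinearMap.comp_assoc, ← TensorProduct.map_comp, LinearMap.comp_id,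
    LinearMap.id_comp]

lemma IsComoduleHom.map_rgt {ρ : X →ₗ[k] X ⊗[k] A} {ρ' : Y →ₗ[k] Y ⊗[k] A} {f : X →ₗ[k] Y}
    (hf : IsComoduleHom ρ ρ' f) (g : Z →ₗ[k] W) :
    IsComoduleHom (rgt ρ) (rgt ρ') (TensorProduct.map g f) := by
  have h : TensorProduct.map (TensorProduct.map g f) LinearMap.id ∘ₗ
      (TensorProduct.assoc k Z X A).symm.toLinearMap =
      (TensorProduct.assoc k W Y A).symm.toLinearMap ∘ₗ
      TensorProduct.map g (TensorProduct.map f LinearMap.id) := by ext; simp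
  rw [IsComoduleHom, rgt, LinearMap.comp_assoc, ← TensorProduct.map_comp, hf, rgt,
    ← LinearMap.comp_assoc, h, LinearMap.comp_assoc, ← TensorProduct.map_comp, LinearMap.comp_id,
    LinearMap.id_comp]

lemma isComoduleHom_slice (φ : C →ₗ[k] k) (ρ : X →ₗ[k] X ⊗[k] A) :
    IsComoduleHom (lft ρ) ρ (slice φ) := by
  rw [IsComoduleHom]
  ext x c
  simp only [AlgebraTensorModule.curry_apply, curry_apply, LinearMap.coe_restrictScalars,
        LinearMap.comp_apply, TensorProduct.map_tmul, LinearMap.id_apply, LinearEquiv.coe_coe,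
        slice_tmul, lft, map_smul]
  generalize ρ x = t
  induction t using TensorProduct.induction_on with
  | zero => simp
  | add x y hx hy => simp only [map_add, add_tmul, hx, hy, smul_add]
  | tmul y a => simp [smul_tmul']

variable (X Y) in
lemma isComoduleHom_comm_lft (ρ : X →ₗ[k] X ⊗[k] A) :
    IsComoduleHom (lft ρ) (rgt ρ) (TensorProduct.comm k X Y).toLinearMap := by
  rw [IsComoduleHom]
  ext x c
  simp only [AlgebraTensorModule.curry_apply, curry_apply, LinearMap.coe_restrictScalars,
        LinearMap.comp_apply, TensorProduct.map_tmul, LinearMap.id_apply, LinearEquiv.coe_coe,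
        lft, rgt, TensorProduct.comm_tmul]
  generalize ρ x = t
  induction t using TensorProduct.induction_on with
  | zero => simp
  | add x y hx hy => simp only [map_add, add_tmul, tmul_add, hx, hy]
  | tmul y a => simp

variable (X Y) in
lemma isComoduleHom_comm_rgt (ρ : Y →ₗ[k] Y ⊗[k] A) :
    IsComoduleHom (rgt ρ) (lft ρ) (TensorProduct.comm k X Y).toLinearMap := by
  rw [IsComoduleHom]
  ext x c
  simp only [AlgebraTensorModule.curry_apply, curry_apply, LinearMap.coe_restrictScalars,
        LinearMap.comp_apply, TensorProduct.map_tmul, LinearMap.id_apply, LinearEquiv.coe_coe,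
        lft, rgt, TensorProduct.comm_tmul]
  generalize ρ c = t
  induction t using TensorProduct.induction_on with
  | zero => simp
  | add x y hx hy => simp only [map_add, add_tmul, tmul_add, hx, hy]
  | tmul y a => simp

lemma IsComoduleHom.symm {ρ : X →ₗ[k] X ⊗[k] A} {ρ' : Y →ₗ[k] Y ⊗[k] A} {f : X ≃ₗ[k] Y}
    (hf : IsComoduleHom ρ ρ' f.toLinearMap) : IsComoduleHom ρ' ρ f.symm.toLinearMap := by
  have h : f.symm.toLinearMap ∘ₗ f.toLinearMap = LinearMap.id := by ext; simp
  have h' : f.toLinearMap ∘ₗ f.symm.toLinearMap = LinearMap.id := by ext; simp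
  rw [IsComoduleHom]
  have := congr(TensorProduct.map f.symm.toLinearMap (LinearMap.id : A →ₗ[k] A) ∘ₗ $hf ∘ₗ
    f.symm.toLinearMap)
  rw [LinearMap.comp_assoc, h', LinearMap.comp_id, LinearMap.comp_assoc, ← LinearMap.comp_assoc,
    ← TensorProduct.map_comp, h, LinearMap.id_comp, TensorProduct.map_id, LinearMap.id_comp] at this
  exact this.symm

variable (X Y Z) in
lemma isComoduleHom_assoc₁ (ρ : X →ₗ[k] X ⊗[k] A) :
    IsComoduleHom (lft (lft ρ)) (lft ρ) (TensorProduct.assoc k X Y Z).toLinearMap := by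
  rw [IsComoduleHom]
  ext x y z
  simp only [AlgebraTensorModule.curry_apply, curry_apply, LinearMap.coe_restrictScalars,
        LinearMap.comp_apply, TensorProduct.map_tmul, LinearMap.id_apply, LinearEquiv.coe_coe,
        lft, TensorProduct.assoc_tmul]
  generalize ρ x = t
  induction t using TensorProduct.induction_on with
  | zero => simp
  | add x y hx hy => simp only [map_add, add_tmul, hx, hy]
  | tmul y a => simp

variable (X Y Z) in
lemma isComoduleHom_assoc₂ (ρ : Y →ₗ[k] Y ⊗[k] A) :
    IsComoduleHom (lft (rgt ρ)) (rgt (lft ρ)) (TensorProduct.assoc k X Y Z).toLinearMap := by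
  rw [IsComoduleHom]
  ext x y z
  simp only [AlgebraTensorModule.curry_apply, curry_apply, LinearMap.coe_restrictScalars,
        LinearMap.comp_apply, TensorProduct.map_tmul, LinearMap.id_apply, LinearEquiv.coe_coe,
        lft, rgt, TensorProduct.assoc_tmul]
  generalize ρ y = t
  induction t using TensorProduct.induction_on with
  | zero => simp
  | add x y hx hy => simp only [map_add, add_tmul, tmul_add, hx, hy]
  | tmul y a => simp

variable (X Y Z) in
lemma isComoduleHom_assoc₃ (ρ : Z →ₗ[k] Z ⊗[k] A) :
    IsComoduleHom (rgt ρ) (rgt (rgt ρ)) (TensorProduct.assoc k X Y Z).toLinearMap := by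
  rw [IsComoduleHom]
  ext x y z
  simp only [AlgebraTensorModule.curry_apply, curry_apply, LinearMap.coe_restrictScalars,
        LinearMap.comp_apply, TensorProduct.map_tmul, LinearMap.id_apply, LinearEquiv.coe_coe,
        rgt, TensorProduct.assoc_tmul]
  generalize ρ z = t
  induction t using TensorProduct.induction_on with
  | zero => simp
  | add x y hx hy => simp only [map_add, tmul_add, hx, hy]
  | tmul y a => simp

lemma lft_comp_mul {ρ : X →ₗ[k] X ⊗[k] A} (f : C →ₗ[k] Y) :
    IsComoduleHom (lft ρ) (lft ρ) (TensorProduct.map (LinearMap.id : X →ₗ[k] X) f) :=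
  (IsComoduleHom.id ρ).map_lft f

lemma isComoduleHom_pair {τ ρ σ : X →ₗ[k] X ⊗[k] A} (h₁ : Comm τ ρ) (h₂ : Comm τ σ) :
    IsComoduleHom τ (lft τ) (pair ρ σ) :=
  (isComoduleHom_assoc₁ X A A τ).comp ((h₁.map_lft LinearMap.id).comp h₂)

lemma isComoduleHom_Rop (F : A ⊗[k] A →ₗ[k] k) {τ ρ σ : X →ₗ[k] X ⊗[k] A} (h₁ : Comm τ ρ)
    (h₂ : Comm τ σ) : IsComoduleHom τ τ (Rop F ρ σ) :=
  (isComoduleHom_slice F τ).comp (isComoduleHom_pair h₁ h₂)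

lemma isComoduleHom_act (φ : A →ₗ[k] k) {τ ρ : X →ₗ[k] X ⊗[k] A} (h : Comm τ ρ) :
    IsComoduleHom τ τ (act ρ φ) :=
  (isComoduleHom_slice φ τ).comp h

lemma Comm.mulCo {τ ρ σ : X →ₗ[k] X ⊗[k] A} (h₁ : Comm τ ρ) (h₂ : Comm τ σ) :
    Comm τ (mulCo ρ σ) :=
  (lft_comp_mul _).comp (isComoduleHom_pair h₁ h₂)

/-- Operators defined by pairwise commuting coactions commute. -/
lemma Rop_comm (F G : A ⊗[k] A →ₗ[k] k) {ρ σ ρ' σ' : X →ₗ[k] X ⊗[k] A} (h₁ : Comm ρ ρ')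
    (h₂ : Comm ρ σ') (h₃ : Comm σ ρ') (h₄ : Comm σ σ') :
    Rop F ρ σ ∘ₗ Rop G ρ' σ' = Rop G ρ' σ' ∘ₗ Rop F ρ σ :=
  Rop_natural F (isComoduleHom_Rop G h₁ h₂) (isComoduleHom_Rop G h₃ h₄)

lemma comm_lft_rgt (ρ : X →ₗ[k] X ⊗[k] A) (σ : Y →ₗ[k] Y ⊗[k] A) :
    Comm (lft ρ) (rgt σ : X ⊗[k] Y →ₗ[k] _) :=
  (isComoduleHom_assoc₁ X Y A ρ).symm.comp ((IsComoduleHom.id ρ).map_lft σ)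

lemma Comm.lft {ρ σ : X →ₗ[k] X ⊗[k] A} (h : Comm ρ σ) :
    Comm (lft ρ : X ⊗[k] Y →ₗ[k] _) (lft σ) := by
  have h' : IsComoduleHom (BraidedLie.lft (BraidedLie.lft ρ))
    (BraidedLie.lft (BraidedLie.lft ρ)) (TensorProduct.rightComm k X A Y).toLinearMap := by
    rw [IsComoduleHom]
    ext x y z
    simp only [AlgebraTensorModule.curry_apply, curry_apply, LinearMap.coe_restrictScalars,
        LinearMap.comp_apply, TensorProduct.map_tmul, LinearMap.id_apply, LinearEquiv.coe_coe,
        BraidedLie.lft, TensorProduct.rightComm_tmul]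
    generalize ρ x = t
    induction t using TensorProduct.induction_on with
    | zero => simp
    | add x y hx hy => simp only [map_add, add_tmul, hx, hy]
    | tmul y a => simp
  exact h'.comp (h.map_lft LinearMap.id)

lemma Comm.rgt {ρ σ : Y →ₗ[k] Y ⊗[k] A} (h : Comm ρ σ) :
    Comm (rgt ρ : X ⊗[k] Y →ₗ[k] _) (rgt σ) :=
  (isComoduleHom_assoc₂ X Y A ρ).symm.comp (h.map_rgt LinearMap.id)

/-! ### Comodules -/

lemma IsRightComodule.symm_coassoc {ρ : X →ₗ[k] X ⊗[k] A} (hρ : IsRightComodule ρ) :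
    TensorProduct.map ρ (LinearMap.id : A →ₗ[k] A) ∘ₗ ρ =
      (TensorProduct.assoc k X A A).symm.toLinearMap ∘ₗ
        TensorProduct.map LinearMap.id Coalgebra.comul ∘ₗ ρ := by
  rw [← hρ.coassoc, ← LinearMap.comp_assoc]; ext; simp

lemma IsRightComodule.slice_counit {ρ : X →ₗ[k] X ⊗[k] A} (hρ : IsRightComodule ρ) (x : X) :
    slice (Coalgebra.counit (R := k) (A := A)) (ρ x) = x :=
  LinearMap.congr_fun hρ.counit x

lemma IsRightComodule.triv : IsRightComodule (triv : X →ₗ[k] X ⊗[k] A) where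
  coassoc := by ext; simp [Algebra.TensorProduct.one_def]
  counit := by ext; simp

lemma IsRightComodule.lft {ρ : X →ₗ[k] X ⊗[k] A} (hρ : IsRightComodule ρ) :
    IsRightComodule (lft ρ : X ⊗[k] Y →ₗ[k] _) where
  coassoc := by
    have h1 : (TensorProduct.assoc k (X ⊗[k] Y) A A).toLinearMap ∘ₗ
        TensorProduct.map (BraidedLie.lft ρ) LinearMap.id ∘ₗ BraidedLie.lft ρ =
        ((TensorProduct.assoc k (X ⊗[k] Y) A A).toLinearMap ∘ₗ TensorProduct.map
          (TensorProduct.rightComm k X A Y).toLinearMap LinearMap.id ∘ₗ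
          (TensorProduct.rightComm k (X ⊗[k] A) A Y).toLinearMap) ∘ₗ
        TensorProduct.map (TensorProduct.map ρ LinearMap.id ∘ₗ ρ) LinearMap.id := by
      ext x y
      simp only [AlgebraTensorModule.curry_apply, curry_apply, LinearMap.coe_restrictScalars,
        LinearMap.comp_apply, TensorProduct.map_tmul, LinearMap.id_apply, LinearEquiv.coe_coe,
        BraidedLie.lft]
      generalize ρ x = t
      induction t using TensorProduct.induction_on with
      | zero => simp
      | add x y hx hy => simp only [map_add, add_tmul, hx, hy]
      | tmul y a => simp
    rw [h1, hρ.symm_coassoc]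
    ext x y
    simp only [AlgebraTensorModule.curry_apply, curry_apply, LinearMap.coe_restrictScalars,
        LinearMap.comp_apply, TensorProduct.map_tmul, LinearMap.id_apply, LinearEquiv.coe_coe,
        BraidedLie.lft]
    generalize ρ x = t
    induction t using TensorProduct.induction_on with
    | zero => simp
    | add x y hx hy => simp only [map_add, add_tmul, hx, hy]
    | tmul z a =>
      simp only [TensorProduct.map_tmul, LinearMap.id_apply, rightComm_tmul]
      generalize (Coalgebra.comul a : A ⊗[k] A) = t
      induction t using TensorProduct.induction_on with
      | zero => simp
      | add x y hx hy => simp only [map_add, add_tmul, tmul_add, hx, hy]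
      | tmul b a => simp
  counit := by
    ext x y
    have := LinearMap.congr_fun hρ.counit x
    simp only [LinearMap.comp_apply, LinearMap.id_apply, LinearEquiv.coe_coe] at this
    simp only [AlgebraTensorModule.curry_apply, curry_apply, LinearMap.coe_restrictScalars,
        LinearMap.comp_apply, TensorProduct.map_tmul, LinearMap.id_apply, LinearEquiv.coe_coe,
        BraidedLie.lft]
    conv_rhs => rw [← this]
    generalize ρ x = t
    induction t using TensorProduct.induction_on with
    | zero => simp
    | add x y hx hy => simp only [map_add, add_tmul, hx, hy]
    | tmul z a => simp [smul_tmul']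

lemma IsRightComodule.of_equiv {ρ : X →ₗ[k] X ⊗[k] A} {σ : Y →ₗ[k] Y ⊗[k] A} (e : X ≃ₗ[k] Y)
    (he : IsComoduleHom ρ σ e.toLinearMap) (hρ : IsRightComodule ρ) : IsRightComodule σ where
  coassoc := by
    have h : σ = TensorProduct.map e.toLinearMap LinearMap.id ∘ₗ ρ ∘ₗ e.symm.toLinearMap := by
      rw [← LinearMap.comp_assoc, ← he]; ext; simp
    have h2 : TensorProduct.map σ (LinearMap.id : A →ₗ[k] A) ∘ₗ
        TensorProduct.map e.toLinearMap LinearMap.id =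
        TensorProduct.map (TensorProduct.map e.toLinearMap LinearMap.id) LinearMap.id ∘ₗ
        TensorProduct.map ρ LinearMap.id := by
      rw [← TensorProduct.map_comp, he, ← TensorProduct.map_comp]
    calc _ = (TensorProduct.assoc k Y A A).toLinearMap ∘ₗ (TensorProduct.map σ LinearMap.id ∘ₗ
        TensorProduct.map e.toLinearMap LinearMap.id) ∘ₗ ρ ∘ₗ e.symm.toLinearMap := by
          rw [LinearMap.comp_assoc, ← h]
      _ = TensorProduct.map e.toLinearMap LinearMap.id ∘ₗ ((TensorProduct.assoc k X A A).toLinearMap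
            ∘ₗ TensorProduct.map ρ LinearMap.id ∘ₗ ρ) ∘ₗ e.symm.toLinearMap := by
          rw [h2]
          simp only [← LinearMap.comp_assoc]
          congr 3
          ext; simp
      _ = _ := by
          rw [hρ.coassoc, h]
          simp only [← LinearMap.comp_assoc, ← TensorProduct.map_comp]
          simp
  counit := by
    have h : σ = TensorProduct.map e.toLinearMap LinearMap.id ∘ₗ ρ ∘ₗ e.symm.toLinearMap := by
      rw [← LinearMap.comp_assoc, ← he]; ext; simp
    ext y
    change slice (Coalgebra.counit (R := k) (A := A)) (σ y) = y
    rw [h, LinearMap.comp_apply, slice_map, LinearMap.comp_apply, hρ.slice_counit]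
    simp

lemma IsRightComodule.rgt {ρ : Y →ₗ[k] Y ⊗[k] A} (hρ : IsRightComodule ρ) :
    IsRightComodule (rgt ρ : X ⊗[k] Y →ₗ[k] _) :=
  hρ.lft.of_equiv (TensorProduct.comm k Y X) (isComoduleHom_comm_lft Y X ρ)

/-- The product coaction is the `A ⊗ A`-coaction of `Comm.pair_coassoc` pushed forward along
multiplication, which is a coalgebra map. -/
lemma IsRightComodule.mulCo {ρ σ : X →ₗ[k] X ⊗[k] A} (hρ : IsRightComodule ρ)
    (hσ : IsRightComodule σ) (h : Comm ρ σ) : IsRightComodule (mulCo ρ σ) where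
  coassoc := by
    have h1 : TensorProduct.map (LinearMap.id : X →ₗ[k] X) Coalgebra.comul ∘ₗ
        BraidedLie.mulCo ρ σ = TensorProduct.map LinearMap.id
          (TensorProduct.map (LinearMap.mul' k A) (LinearMap.mul' k A)) ∘ₗ
        (TensorProduct.map LinearMap.id Coalgebra.comul ∘ₗ pair ρ σ) := by
      rw [BraidedLie.mulCo, ← LinearMap.comp_assoc, ← LinearMap.comp_assoc,
        ← TensorProduct.map_comp, ← TensorProduct.map_comp]
      congr 2
      ext a b
      simp only [AlgebraTensorModule.curry_apply, curry_apply, LinearMap.coe_restrictScalars,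
        LinearMap.comp_apply, LinearMap.mul'_apply, Bialgebra.comul_mul, TensorProduct.comul_tmul]
      generalize (Coalgebra.comul a : A ⊗[k] A) = s
      generalize (Coalgebra.comul b : A ⊗[k] A) = t
      induction s using TensorProduct.induction_on with
      | zero => simp
      | add x y hx hy => simp only [map_add, add_tmul, add_mul, hx, hy]
      | tmul c d =>
        induction t using TensorProduct.induction_on with
        | zero => simp
        | add x y hx hy => simp only [map_add, tmul_add, mul_add, hx, hy]
        | tmul e f => simp
    rw [h1, ← h.pair_coassoc hρ hσ]
    ext x
    simp only [LinearMap.comp_apply, BraidedLie.mulCo, LinearEquiv.coe_coe]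
    generalize pair ρ σ x = t
    induction t using TensorProduct.induction_on with
    | zero => simp
    | add x y hx hy => simp only [map_add, hx, hy]
    | tmul x c =>
      simp only [TensorProduct.map_tmul, LinearMap.comp_apply, LinearMap.id_apply]
      generalize pair ρ σ x = t
      induction t using TensorProduct.induction_on with
      | zero => simp
      | add x y hx hy => simp only [map_add, add_tmul, hx, hy]
      | tmul x c => simp
  counit := by
    ext x
    change slice (Coalgebra.counit (R := k) (A := A)) (BraidedLie.mulCo ρ σ x) = x
    conv_rhs => rw [← hσ.slice_counit x]
    rw [BraidedLie.mulCo, pair]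
    simp only [LinearMap.comp_apply, LinearEquiv.coe_coe]
    generalize σ x = t
    induction t using TensorProduct.induction_on with
    | zero => simp
    | add x y hx hy => simp only [map_add, hx, hy]
    | tmul x c =>
      simp only [TensorProduct.map_tmul, LinearMap.id_apply, slice_tmul]
      conv_rhs => rw [← hρ.slice_counit x]
      generalize ρ x = t
      induction t using TensorProduct.induction_on with
      | zero => simp
      | add x y hx hy => simp only [map_add, add_tmul, smul_add, hx, hy]
      | tmul x d => simp [mul_smul, smul_comm (Coalgebra.counit (R := k) c)]

/-! ### The operators defined by a coquasitriangular structure -/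

lemma Rop_conv {ρ σ : X →ₗ[k] X ⊗[k] A} (h : Comm ρ σ) (hρ : IsRightComodule ρ)
    (hσ : IsRightComodule σ) (F G : WithConv (A ⊗[k] A →ₗ[k] k)) :
    Rop (F * G).ofConv ρ σ = Rop F.ofConv ρ σ ∘ₗ Rop G.ofConv ρ σ :=
  act_mul (h.pair_coassoc hρ hσ) F G

lemma Rop_one {ρ σ : X →ₗ[k] X ⊗[k] A} (hρ : IsRightComodule ρ) (hσ : IsRightComodule σ) :
    Rop (1 : WithConv (A ⊗[k] A →ₗ[k] k)).ofConv ρ σ = LinearMap.id := by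
  ext x
  conv_rhs => rw [LinearMap.id_apply, ← hσ.slice_counit x]
  rw [Rop, act, pair]
  simp only [LinearMap.comp_apply, LinearEquiv.coe_coe]
  generalize σ x = t
  induction t using TensorProduct.induction_on with
  | zero => simp
  | add x y hx hy => simp only [map_add, hx, hy]
  | tmul x c =>
    simp only [TensorProduct.map_tmul, LinearMap.id_apply, slice_tmul]
    conv_rhs => rw [← hρ.slice_counit x]
    generalize ρ x = t
    induction t using TensorProduct.induction_on with
    | zero => simp
    | add x y hx hy => simp only [map_add, add_tmul, smul_add, hx, hy]
    | tmul x d => simp [mul_smul, smul_comm (Coalgebra.counit (R := k) c), LinearMap.convOne_def]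

/-- The exchange relation: the operator of `R` intertwines the two products of a pair of commuting
coactions. -/
lemma isComoduleHom_Rop_mulCo {R : A ⊗[k] A →ₗ[k] k} (hR : IsCoquasitriangular R)
    {ρ σ : X →ₗ[k] X ⊗[k] A} (h : Comm ρ σ) (hρ : IsRightComodule ρ) (hσ : IsRightComodule σ) :
    IsComoduleHom (mulCo ρ σ) (mulCo σ ρ) (Rop R ρ σ) := by
  have h1 : mulCo σ ρ = TensorProduct.map LinearMap.id
      (LinearMap.mul' k A ∘ₗ (TensorProduct.comm k A A).toLinearMap) ∘ₗ pair ρ σ := by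
    rw [mulCo, h.symm.pair_eq, ← LinearMap.comp_assoc, ← TensorProduct.map_comp, LinearMap.id_comp]
  rw [IsComoduleHom, h1]
  -- Both sides apply `pair ρ σ` twice; its coassociativity turns the two evaluations into the two
  -- sides of `hR.quasi_comm`.
  calc _ = TensorProduct.map LinearMap.id ((TensorProduct.rid k A).toLinearMap ∘ₗ
        TensorProduct.map (LinearMap.mul' k A ∘ₗ (TensorProduct.comm k A A).toLinearMap) R) ∘ₗ
        ((TensorProduct.assoc k X (A ⊗[k] A) (A ⊗[k] A)).toLinearMap ∘ₗ
      TensorProduct.map (pair ρ σ) LinearMap.id ∘ₗ pair ρ σ) := by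
        ext x
        simp only [LinearMap.comp_apply, Rop, act, LinearEquiv.coe_coe]
        generalize pair ρ σ x = t
        induction t using TensorProduct.induction_on with
        | zero => simp
        | add x y hx hy => simp only [map_add, hx, hy]
        | tmul x c =>
          simp only [TensorProduct.map_tmul, LinearMap.id_apply, slice_tmul, map_smul]
          generalize pair ρ σ x = t
          induction t using TensorProduct.induction_on with
          | zero => simp
          | add x y hx hy => simp only [map_add, add_tmul, smul_add, hx, hy]
          | tmul x d => simp
    _ = TensorProduct.map LinearMap.id ((TensorProduct.lid k A).toLinearMap ∘ₗ
        TensorProduct.map R (LinearMap.mul' k A)) ∘ₗ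
        ((TensorProduct.assoc k X (A ⊗[k] A) (A ⊗[k] A)).toLinearMap ∘ₗ
      TensorProduct.map (pair ρ σ) LinearMap.id ∘ₗ pair ρ σ) := by
        rw [h.pair_coassoc hρ hσ, ← LinearMap.comp_assoc, ← LinearMap.comp_assoc,
          ← TensorProduct.map_comp, ← TensorProduct.map_comp, LinearMap.comp_assoc, hR.quasi_comm,
          LinearMap.comp_assoc]
    _ = _ := by
        ext x
        simp only [LinearMap.comp_apply, Rop, act, LinearEquiv.coe_coe, mulCo]
        generalize pair ρ σ x = t
        induction t using TensorProduct.induction_on with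
        | zero => simp
        | add x y hx hy => simp only [map_add, hx, hy]
        | tmul x c =>
          simp only [TensorProduct.map_tmul, LinearMap.id_apply, LinearMap.comp_apply]
          generalize pair ρ σ x = t
          induction t using TensorProduct.induction_on with
          | zero => simp
          | add x y hx hy => simp only [map_add, add_tmul, hx, hy]
          | tmul x d => simp [smul_tmul']

/-- Common core of the two multiplicativity rules. Read `E (w ⊗ a)` as the action of `a` on `w`: the
action commutes with `ρ`, and a product under `μ` acts by its second factor first. -/
lemma comp_map_pair {ρ σ : X →ₗ[k] X ⊗[k] A} (E : X ⊗[k] A →ₗ[k] X) (μ : A ⊗[k] A →ₗ[k] A)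
    (hE : ∀ a, IsComoduleHom ρ ρ (E ∘ₗ (TensorProduct.mk k X A).flip a))
    (hμ : ∀ w a b, E (w ⊗ₜ μ (b ⊗ₜ a)) = E (E (w ⊗ₜ a) ⊗ₜ b)) :
    E ∘ₗ TensorProduct.map LinearMap.id μ ∘ₗ pair ρ σ = (E ∘ₗ ρ) ∘ₗ E ∘ₗ σ := by
  ext x
  simp only [LinearMap.comp_apply, pair, LinearEquiv.coe_coe]
  generalize σ x = t
  induction t using TensorProduct.induction_on with
  | zero => simp
  | add x y hx hy => simp only [map_add, hx, hy]
  | tmul x c =>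
    have := (hE c).apply x
    simp only [LinearMap.comp_apply, flip_apply, mk_apply] at this
    rw [this]
    simp only [TensorProduct.map_tmul, LinearMap.id_apply]
    generalize ρ x = t
    induction t using TensorProduct.induction_on with
    | zero => simp
    | add x y hx hy => simp only [map_add, add_tmul, hx, hy]
    | tmul x d => simp [hμ]

lemma Rop_mulCo_left {R : A ⊗[k] A →ₗ[k] k} (hR : IsCoquasitriangular R)
    {ρ σ τ : X →ₗ[k] X ⊗[k] A} (h₁ : Comm ρ τ) (h₂ : Comm σ τ) (hτ : IsRightComodule τ) :
    Rop R (mulCo ρ σ) τ = Rop R ρ τ ∘ₗ Rop R σ τ := by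
  -- `E (x ⊗ a)` evaluates the functional R(a ⊗ ·) on the `τ`-leg of `x`.
  let E : X ⊗[k] A →ₗ[k] X := slice (R ∘ₗ (TensorProduct.comm k A A).toLinearMap) ∘ₗ
    (TensorProduct.assoc k X A A).toLinearMap ∘ₗ TensorProduct.map τ LinearMap.id
  have hE {π : X →ₗ[k] X ⊗[k] A} (h : Comm π τ) : Rop R π τ = E ∘ₗ π := by
    have e1 : slice R ∘ₗ TensorProduct.map (LinearMap.id : X →ₗ[k] X)
      (TensorProduct.comm k A A).toLinearMap =
      slice (R ∘ₗ (TensorProduct.comm k A A).toLinearMap) := by ext; simp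
    rw [Rop, act, h.pair_eq, ← LinearMap.comp_assoc, e1]; rfl
  have hE' (a : A) : E ∘ₗ (TensorProduct.mk k X A).flip a = act τ (TensorProduct.curry R a) := by
    ext x
    simp only [LinearMap.comp_apply, E, act, LinearEquiv.coe_coe, flip_apply, mk_apply,
      TensorProduct.map_tmul, LinearMap.id_apply]
    generalize τ x = t
    induction t using TensorProduct.induction_on with
    | zero => simp
    | add x y hx hy => simp only [map_add, add_tmul, hx, hy]
    | tmul x d => simp
  have hc : Comm τ (mulCo ρ σ) := h₁.symm.mulCo h₂.symm
  rw [hE hc.symm, hE h₁, hE h₂, mulCo]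
  refine comp_map_pair E _ (fun a => ?_) (fun w a b => ?_)
  · rw [hE']; exact isComoduleHom_act _ h₁
  · have e2 (w a) : E (w ⊗ₜ a) = act τ (TensorProduct.curry R a) w := LinearMap.congr_fun (hE' a) w
    have e3 : TensorProduct.curry R (b * a) = (WithConv.toConv (TensorProduct.curry R b) *
        WithConv.toConv (TensorProduct.curry R a)).ofConv := by
      ext c
      have := LinearMap.congr_fun hR.mul_left ((b ⊗ₜ a) ⊗ₜ c)
      simp only [LinearMap.comp_apply, TensorProduct.map_tmul, LinearMap.mul'_apply,
        LinearMap.id_apply, LinearEquiv.coe_coe] at this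
      rw [TensorProduct.curry_apply, this, LinearMap.convMul_apply]
      generalize (Coalgebra.comul c : A ⊗[k] A) = t
      induction t using TensorProduct.induction_on with
      | zero => simp
      | add x y hx hy => simp only [map_add, tmul_add, hx, hy]
      | tmul x d => simp
    rw [LinearMap.mul'_apply, e2, e2, e2, e3, act_mul hτ.coassoc]; rfl

lemma Rop_mulCo_right {R : A ⊗[k] A →ₗ[k] k} (hR : IsCoquasitriangular R)
    {ρ σ τ : X →ₗ[k] X ⊗[k] A} (h : Comm ρ σ) (h₂ : Comm σ τ)
    (hτ : IsRightComodule τ) :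
    Rop R τ (mulCo ρ σ) = Rop R τ σ ∘ₗ Rop R τ ρ := by
  let E : X ⊗[k] A →ₗ[k] X := slice R ∘ₗ
    (TensorProduct.assoc k X A A).toLinearMap ∘ₗ TensorProduct.map τ LinearMap.id
  have hE' (a : A) : E ∘ₗ (TensorProduct.mk k X A).flip a =
      act τ ((TensorProduct.curry R).flip a) := by
    ext x
    simp only [LinearMap.comp_apply, E, act, LinearEquiv.coe_coe, flip_apply, mk_apply,
      TensorProduct.map_tmul, LinearMap.id_apply]
    generalize τ x = t
    induction t using TensorProduct.induction_on with
    | zero => simp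
    | add x y hx hy => simp only [map_add, add_tmul, hx, hy]
    | tmul x d => simp
  -- In its second argument `R` reverses products, so the product coaction is rewritten with the two
  -- legs in the opposite order.
  have h1 : mulCo ρ σ = TensorProduct.map LinearMap.id
      (LinearMap.mul' k A ∘ₗ (TensorProduct.comm k A A).toLinearMap) ∘ₗ pair σ ρ := by
    rw [mulCo, h.pair_eq, ← LinearMap.comp_assoc, ← TensorProduct.map_comp, LinearMap.id_comp]
  change E ∘ₗ mulCo ρ σ = (E ∘ₗ σ) ∘ₗ E ∘ₗ ρ
  rw [h1]
  refine comp_map_pair E _ (fun a => ?_) (fun w a b => ?_)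
  · rw [hE']; exact isComoduleHom_act _ h₂
  · have e2 (w a) : E (w ⊗ₜ a) = act τ ((TensorProduct.curry R).flip a) w :=
      LinearMap.congr_fun (hE' a) w
    have e3 : (TensorProduct.curry R).flip (a * b) =
        (WithConv.toConv ((TensorProduct.curry R).flip b) *
        WithConv.toConv ((TensorProduct.curry R).flip a)).ofConv := by
      ext c
      have := LinearMap.congr_fun hR.mul_right (c ⊗ₜ (a ⊗ₜ b))
      simp only [LinearMap.comp_apply, TensorProduct.map_tmul, LinearMap.mul'_apply,
        LinearMap.id_apply, LinearEquiv.coe_coe, TensorProduct.comm_tmul] at this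
      rw [flip_apply, TensorProduct.curry_apply, this, LinearMap.convMul_apply]
      generalize (Coalgebra.comul c : A ⊗[k] A) = t
      induction t using TensorProduct.induction_on with
      | zero => simp
      | add x y hx hy => simp only [map_add, add_tmul, hx, hy]
      | tmul x d => simp
    simp only [LinearMap.comp_apply, LinearEquiv.coe_coe, TensorProduct.comm_tmul]
    rw [LinearMap.mul'_apply, e2, e2, e2, e3, act_mul hτ.coassoc]; rfl

/-- The Yang–Baxter equation. -/
lemma yang_baxter {R : A ⊗[k] A →ₗ[k] k} (hR : IsCoquasitriangular R)
    {ρ σ τ : X →ₗ[k] X ⊗[k] A} (h₁ : Comm ρ σ) (h₂ : Comm ρ τ) (h₃ : Comm σ τ)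
    (hρ : IsRightComodule ρ) (hσ : IsRightComodule σ) (hτ : IsRightComodule τ) :
    Rop R ρ σ ∘ₗ Rop R ρ τ ∘ₗ Rop R σ τ = Rop R σ τ ∘ₗ Rop R ρ τ ∘ₗ Rop R ρ σ := by
  -- Naturality of the operator against `τ` along `Rop R ρ σ`, which turns `mulCo ρ σ` into `mulCo σ
  -- ρ` and commutes with `τ`. Splitting both product coactions gives the equation.
  have := Rop_natural R (isComoduleHom_Rop_mulCo hR h₁ hρ hσ)
    (isComoduleHom_Rop R h₂.symm h₃.symm)
  rw [Rop_mulCo_left hR h₃ h₂ hτ, Rop_mulCo_left hR h₂ h₃ hτ] at this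
  rw [← this, LinearMap.comp_assoc]

/-- The inverse of a coquasitriangular structure for the convolution product. -/
def IsCoquasitriangular.inv {R : A ⊗[k] A →ₗ[k] k} (hR : IsCoquasitriangular R) :
    A ⊗[k] A →ₗ[k] k :=
  (↑(hR.isUnit.unit⁻¹) : WithConv (A ⊗[k] A →ₗ[k] k)).ofConv

lemma IsCoquasitriangular.conv_inv {R : A ⊗[k] A →ₗ[k] k} (hR : IsCoquasitriangular R) :
    WithConv.toConv R * WithConv.toConv hR.inv = 1 := hR.isUnit.mul_val_inv

lemma IsCoquasitriangular.inv_conv {R : A ⊗[k] A →ₗ[k] k} (hR : IsCoquasitriangular R) :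
    WithConv.toConv hR.inv * WithConv.toConv R = 1 := hR.isUnit.val_inv_mul

lemma Rop_comp_inv {R : A ⊗[k] A →ₗ[k] k} (hR : IsCoquasitriangular R)
    {ρ σ : X →ₗ[k] X ⊗[k] A} (h : Comm ρ σ) (hρ : IsRightComodule ρ) (hσ : IsRightComodule σ) :
    Rop R ρ σ ∘ₗ Rop hR.inv ρ σ = LinearMap.id := by
  rw [← Rop_one hρ hσ, ← hR.conv_inv, Rop_conv h hρ hσ]

lemma Rop_inv_comp {R : A ⊗[k] A →ₗ[k] k} (hR : IsCoquasitriangular R)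
    {ρ σ : X →ₗ[k] X ⊗[k] A} (h : Comm ρ σ) (hρ : IsRightComodule ρ) (hσ : IsRightComodule σ) :
    Rop hR.inv ρ σ ∘ₗ Rop R ρ σ = LinearMap.id := by
  rw [← Rop_one hρ hσ, ← hR.inv_conv, Rop_conv h hρ hσ]

/-- By `mul_left` the functional R(1 ⊗ ·) is idempotent for convolution. The inverse form evaluated
at 1 is a right inverse of it, so it is the unit. -/
lemma IsCoquasitriangular.one_left {R : A ⊗[k] A →ₗ[k] k} (hR : IsCoquasitriangular R)
    (a : A) : R (1 ⊗ₜ a) = Coalgebra.counit (R := k) a := by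
  have e1 (F G : WithConv (A ⊗[k] A →ₗ[k] k)) : TensorProduct.curry (F * G).ofConv 1 =
      (WithConv.toConv (TensorProduct.curry F.ofConv 1) *
        WithConv.toConv (TensorProduct.curry G.ofConv 1)).ofConv := by
    ext a
    rw [TensorProduct.curry_apply, LinearMap.convMul_apply, LinearMap.convMul_apply,
      TensorProduct.comul_tmul, Bialgebra.comul_one, Algebra.TensorProduct.one_def]
    generalize (Coalgebra.comul a : A ⊗[k] A) = t
    induction t using TensorProduct.induction_on with
    | zero => simp
    | add x y hx hy => simp only [map_add, tmul_add, hx, hy]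
    | tmul x d => simp
  have e2 : TensorProduct.curry (1 : WithConv (A ⊗[k] A →ₗ[k] k)).ofConv 1 =
      (1 : WithConv (A →ₗ[k] k)).ofConv := by
    ext a
    simp [LinearMap.convOne_def]
  have e3 : WithConv.toConv (TensorProduct.curry R 1) * WithConv.toConv (TensorProduct.curry R 1) =
      WithConv.toConv (TensorProduct.curry R 1) := by
    ext c
    have := LinearMap.congr_fun hR.mul_left ((1 ⊗ₜ 1) ⊗ₜ c)
    simp only [LinearMap.comp_apply, TensorProduct.map_tmul, LinearMap.mul'_apply,
      LinearMap.id_apply, LinearEquiv.coe_coe, mul_one] at this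
    rw [LinearMap.convMul_apply]
    refine Eq.trans ?_ this.symm
    generalize (Coalgebra.comul c : A ⊗[k] A) = t
    induction t using TensorProduct.induction_on with
    | zero => simp
    | add x y hx hy => simp only [map_add, tmul_add, hx, hy]
    | tmul x d => simp
  have e4 := e1 (WithConv.toConv R) (WithConv.toConv hR.inv)
  rw [hR.conv_inv, e2] at e4
  have e5 : WithConv.toConv (TensorProduct.curry R 1) = 1 := by
    have e4' := WithConv.ofConv_injective e4
    calc _ = WithConv.toConv (TensorProduct.curry R 1) * 1 := (mul_one _).symm
      _ = 1 := by rw [e4', ← mul_assoc]; simp only [e3]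
  have := LinearMap.congr_fun (congr_arg WithConv.ofConv e5) a
  simpa [LinearMap.convOne_def] using this

/-- The argument of `one_left` in the second variable, with `mul_right`. -/
lemma IsCoquasitriangular.one_right {R : A ⊗[k] A →ₗ[k] k} (hR : IsCoquasitriangular R)
    (a : A) : R (a ⊗ₜ 1) = Coalgebra.counit (R := k) a := by
  have e1 (F G : WithConv (A ⊗[k] A →ₗ[k] k)) : (TensorProduct.curry (F * G).ofConv).flip 1 =
      (WithConv.toConv ((TensorProduct.curry F.ofConv).flip 1) *
        WithConv.toConv ((TensorProduct.curry G.ofConv).flip 1)).ofConv := by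
    ext a
    rw [flip_apply, TensorProduct.curry_apply, LinearMap.convMul_apply, LinearMap.convMul_apply,
      TensorProduct.comul_tmul, Bialgebra.comul_one, Algebra.TensorProduct.one_def]
    generalize (Coalgebra.comul a : A ⊗[k] A) = t
    induction t using TensorProduct.induction_on with
    | zero => simp
    | add x y hx hy => simp only [map_add, add_tmul, hx, hy]
    | tmul x d => simp
  have e2 : (TensorProduct.curry (1 : WithConv (A ⊗[k] A →ₗ[k] k)).ofConv).flip 1 =
      (1 : WithConv (A →ₗ[k] k)).ofConv := by
    ext a
    simp [LinearMap.convOne_def]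
  have e3 : WithConv.toConv ((TensorProduct.curry R).flip 1) *
      WithConv.toConv ((TensorProduct.curry R).flip 1) =
      WithConv.toConv ((TensorProduct.curry R).flip 1) := by
    ext c
    have := LinearMap.congr_fun hR.mul_right (c ⊗ₜ (1 ⊗ₜ 1))
    simp only [LinearMap.comp_apply, TensorProduct.map_tmul, LinearMap.mul'_apply,
      LinearMap.id_apply, LinearEquiv.coe_coe, mul_one, TensorProduct.comm_tmul] at this
    rw [LinearMap.convMul_apply]
    refine Eq.trans ?_ this.symm
    generalize (Coalgebra.comul c : A ⊗[k] A) = t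
    induction t using TensorProduct.induction_on with
    | zero => simp
    | add x y hx hy => simp only [map_add, add_tmul, hx, hy]
    | tmul x d => simp
  have e4 := e1 (WithConv.toConv R) (WithConv.toConv hR.inv)
  rw [hR.conv_inv, e2] at e4
  have e5 : WithConv.toConv ((TensorProduct.curry R).flip 1) = 1 := by
    have e4' := WithConv.ofConv_injective e4
    calc _ = WithConv.toConv ((TensorProduct.curry R).flip 1) * 1 := (mul_one _).symm
      _ = 1 := by rw [e4', ← mul_assoc]; simp only [e3]
  have := LinearMap.congr_fun (congr_arg WithConv.ofConv e5) a
  simpa [LinearMap.convOne_def] using this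

lemma Rop_triv_left {R : A ⊗[k] A →ₗ[k] k} (hR : IsCoquasitriangular R)
    {σ : X →ₗ[k] X ⊗[k] A} (hσ : IsRightComodule σ) : Rop R triv σ = LinearMap.id := by
  ext x
  conv_rhs => rw [LinearMap.id_apply, ← hσ.slice_counit x]
  rw [Rop, act, pair]
  simp only [LinearMap.comp_apply, LinearEquiv.coe_coe]
  generalize σ x = t
  induction t using TensorProduct.induction_on with
  | zero => simp
  | add x y hx hy => simp only [map_add, hx, hy]
  | tmul x c => simp [hR.one_left]

lemma Rop_triv_right {R : A ⊗[k] A →ₗ[k] k} (hR : IsCoquasitriangular R)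
    {ρ : X →ₗ[k] X ⊗[k] A} (hρ : IsRightComodule ρ) : Rop R ρ triv = LinearMap.id := by
  ext x
  conv_rhs => rw [LinearMap.id_apply, ← hρ.slice_counit x]
  rw [Rop, act, pair]
  simp only [LinearMap.comp_apply, LinearEquiv.coe_coe, triv_apply, TensorProduct.map_tmul]
  generalize ρ x = t
  induction t using TensorProduct.induction_on with
  | zero => simp
  | add x y hx hy => simp only [map_add, add_tmul, hx, hy]
  | tmul x c => simp [hR.one_right]

lemma Rop_lft (F : A ⊗[k] A →ₗ[k] k) (ρ σ : X →ₗ[k] X ⊗[k] A) :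
    Rop F (lft ρ) (lft σ) = TensorProduct.map (Rop F ρ σ) (LinearMap.id : Y →ₗ[k] Y) := by
  ext x y
  simp only [AlgebraTensorModule.curry_apply, curry_apply, LinearMap.coe_restrictScalars,
    LinearMap.comp_apply, TensorProduct.map_tmul, LinearMap.id_apply, Rop, act, pair, lft,
    LinearEquiv.coe_coe]
  generalize σ x = t
  induction t using TensorProduct.induction_on with
  | zero => simp
  | add x y hx hy => simp only [map_add, add_tmul, hx, hy]
  | tmul x c =>
    simp only [TensorProduct.map_tmul, rightComm_tmul, LinearMap.comp_apply, LinearMap.id_apply,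
      LinearEquiv.coe_coe]
    generalize ρ x = t
    induction t using TensorProduct.induction_on with
    | zero => simp
    | add x y hx hy => simp only [map_add, add_tmul, hx, hy]
    | tmul x c => simp [smul_tmul']

lemma Rop_rgt (F : A ⊗[k] A →ₗ[k] k) (ρ σ : Y →ₗ[k] Y ⊗[k] A) :
    Rop F (rgt ρ) (rgt σ) = TensorProduct.map (LinearMap.id : X →ₗ[k] X) (Rop F ρ σ) := by
  have h := Rop_natural F (isComoduleHom_comm_lft Y X ρ) (isComoduleHom_comm_lft Y X σ)
  rw [Rop_lft] at h
  have e : (TensorProduct.comm k Y X).toLinearMap ∘ₗ (TensorProduct.comm k X Y).toLinearMap =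
    LinearMap.id := by ext; simp
  have := congr($h ∘ₗ (TensorProduct.comm k X Y).toLinearMap)
  rw [LinearMap.comp_assoc, e, LinearMap.comp_id] at this
  rw [this]
  ext; simp

/-! ### The two coactions of a Hopf algebra on itself -/

/-- Uniqueness of inverses in the convolution algebra of maps A → A ⊗ A. Since Δ is the convolution
product of the two inclusions, the flipped S ⊗ S is a left inverse of it, while Δ ∘ S is a right
inverse. -/
lemma comul_antipode (a : A) : Coalgebra.comul (R := k) (HopfAlgebra.antipode k a) =
    TensorProduct.map (HopfAlgebra.antipode k) (HopfAlgebra.antipode k)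
      (TensorProduct.comm k A A (Coalgebra.comul a)) := by
  let i₁ : A →ₐ[k] A ⊗[k] A := Algebra.TensorProduct.includeLeft
  let i₂ : A →ₐ[k] A ⊗[k] A := Algebra.TensorProduct.includeRight
  let S : A →ₗ[k] A := HopfAlgebra.antipode k
  have h (i : A →ₐ[k] A ⊗[k] A) : WithConv.toConv (i.toLinearMap ∘ₗ S) *
      WithConv.toConv (i.toLinearMap) = 1 := by
    have := LinearMap.algHom_comp_convMul_distrib i (WithConv.toConv S)
      (WithConv.toConv LinearMap.id)
    rw [LinearMap.antipode_mul_id] at this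
    apply WithConv.ofConv_injective
    refine Eq.trans this.symm ?_
    ext a
    simp [LinearMap.convOne_def]
  have h12 : WithConv.toConv i₁.toLinearMap * WithConv.toConv i₂.toLinearMap =
      WithConv.toConv (Coalgebra.comul (R := k) (A := A)) := by
    ext a
    rw [LinearMap.convMul_apply]
    change _ = Coalgebra.comul a
    generalize (Coalgebra.comul a : A ⊗[k] A) = t
    induction t using TensorProduct.induction_on with
    | zero => simp
    | add x y hx hy => simp only [map_add, hx, hy]
    | tmul x d => simp [i₁, i₂]
  have hS : WithConv.toConv (i₂.toLinearMap ∘ₗ S) * WithConv.toConv (i₁.toLinearMap ∘ₗ S) =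
      WithConv.toConv (TensorProduct.map S S ∘ₗ (TensorProduct.comm k A A).toLinearMap ∘ₗ
        Coalgebra.comul) := by
    ext a
    rw [LinearMap.convMul_apply]
    change _ = (TensorProduct.map S S ∘ₗ (TensorProduct.comm k A A).toLinearMap)
      (Coalgebra.comul a)
    generalize (Coalgebra.comul a : A ⊗[k] A) = t
    induction t using TensorProduct.induction_on with
    | zero => simp
    | add x y hx hy => simp only [map_add, hx, hy]
    | tmul x d => simp [i₁, i₂]
  have hl : WithConv.toConv (TensorProduct.map S S ∘ₗ (TensorProduct.comm k A A).toLinearMap ∘ₗ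
        Coalgebra.comul) * WithConv.toConv (Coalgebra.comul (R := k) (A := A)) = 1 := by
    rw [← hS, ← h12, mul_assoc, ← mul_assoc (WithConv.toConv (i₁.toLinearMap ∘ₗ S)), h, one_mul, h]
  have := left_inv_eq_right_inv hl LinearMap.comul_right_inv
  exact (LinearMap.congr_fun (congr_arg WithConv.ofConv this) a).symm

variable (k A) in
/-- The right coaction `a ↦ a₂ ⊗ S a₁`. -/
def coL : A →ₗ[k] A ⊗[k] A :=
  TensorProduct.map LinearMap.id (HopfAlgebra.antipode k) ∘ₗ
    (TensorProduct.comm k A A).toLinearMap ∘ₗ Coalgebra.comul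

variable (k A) in
/-- The right coaction `a ↦ a₁ ⊗ a₂`. -/
abbrev coR : A →ₗ[k] A ⊗[k] A := Coalgebra.comul

lemma isRightComodule_coR : IsRightComodule (coR k A) where
  coassoc := Coalgebra.coassoc
  counit := by
    ext a
    have := Coalgebra.lTensor_counit_comul (R := k) a
    simp only [LinearMap.lTensor] at this
    simp [this]

lemma coR_coassoc :
    TensorProduct.map (coR k A) LinearMap.id ∘ₗ coR k A =
      (TensorProduct.assoc k A A A).symm.toLinearMap ∘ₗ
        TensorProduct.map LinearMap.id (coR k A) ∘ₗ coR k A :=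
  isRightComodule_coR.symm_coassoc

/-- Coassociativity under a map of the iterated coproduct. -/
lemma comul_ext (f : A ⊗[k] A →ₗ[k] Z) (g : A ⊗[k] A →ₗ[k] Z)
    (Θ : A ⊗[k] (A ⊗[k] A) →ₗ[k] Z)
    (hf : f = Θ ∘ₗ (TensorProduct.assoc k A A A).toLinearMap ∘ₗ
      TensorProduct.map (coR k A) LinearMap.id)
    (hg : g = Θ ∘ₗ TensorProduct.map LinearMap.id (coR k A)) : f ∘ₗ coR k A = g ∘ₗ coR k A := by
  rw [hf, hg, LinearMap.comp_assoc, LinearMap.comp_assoc, LinearMap.comp_assoc,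
    isRightComodule_coR.coassoc]

lemma isComoduleHom_coR_rgt : IsComoduleHom (coR k A) (rgt (coR k A)) (coR k A) := by
  rw [IsComoduleHom, rgt, LinearMap.comp_assoc, ← coR_coassoc]

/-- The two coactions split off opposite ends of the iterated coproduct. -/
lemma comm_coL_coR : Comm (coL k A) (coR k A) := by
  rw [Comm, IsComoduleHom]
  have : TensorProduct.map (coR k A) LinearMap.id ∘ₗ coL k A =
    ((TensorProduct.map (coR k A) LinearMap.id ∘ₗ
      TensorProduct.map LinearMap.id (HopfAlgebra.antipode k) ∘ₗ
    (TensorProduct.comm k A A).toLinearMap)) ∘ₗ coR k A := rfl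
  rw [this]
  refine comul_ext _ _ ((TensorProduct.comm k A (A ⊗[k] A)).toLinearMap ∘ₗ
    TensorProduct.map (HopfAlgebra.antipode k) LinearMap.id) ?_ ?_
  · ext a b
    simp only [AlgebraTensorModule.curry_apply, curry_apply, LinearMap.coe_restrictScalars,
      LinearMap.comp_apply, TensorProduct.map_tmul, LinearMap.id_apply, coL, lft,
      LinearEquiv.coe_coe]
    generalize (coR k A) a = t
    induction t using TensorProduct.induction_on with
    | zero => simp
    | add x y hx hy => simp only [map_add, add_tmul, hx, hy]
    | tmul x d => simp
  · ext a b
    simp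

/-- The antipode reverses coproducts, which turns the left regular coaction into a right one. -/
lemma isRightComodule_coL : IsRightComodule (coL k A) where
  coassoc := by
    let S : A →ₗ[k] A := HopfAlgebra.antipode k
    have h1 : (TensorProduct.assoc k A A A).toLinearMap ∘ₗ
        TensorProduct.map (coL k A) LinearMap.id ∘ₗ coL k A =
        ((TensorProduct.assoc k A A A).toLinearMap ∘ₗ
        TensorProduct.map (coL k A) LinearMap.id ∘ₗ TensorProduct.map LinearMap.id S ∘ₗ
          (TensorProduct.comm k A A).toLinearMap) ∘ₗ coR k A := rfl
    have h2 : TensorProduct.map LinearMap.id (coR k A) ∘ₗ coL k A =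
        (TensorProduct.map LinearMap.id (coR k A) ∘ₗ TensorProduct.map LinearMap.id S ∘ₗ
          (TensorProduct.comm k A A).toLinearMap) ∘ₗ coR k A := rfl
    rw [h1, h2]
    symm
    refine comul_ext _ _ (TensorProduct.map LinearMap.id (TensorProduct.map S S) ∘ₗ
      (TensorProduct.assoc k A A A).toLinearMap ∘ₗ
      (TensorProduct.comm k A (A ⊗[k] A)).toLinearMap ∘ₗ
      TensorProduct.map LinearMap.id (TensorProduct.comm k A A).toLinearMap) ?_ ?_
    · ext a b
      simp only [AlgebraTensorModule.curry_apply, curry_apply, LinearMap.coe_restrictScalars,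
        LinearMap.comp_apply, TensorProduct.map_tmul, LinearMap.id_apply,
        LinearEquiv.coe_coe, TensorProduct.comm_tmul, S, coR, comul_antipode]
      generalize (Coalgebra.comul a : A ⊗[k] A) = t
      induction t using TensorProduct.induction_on with
      | zero => simp
      | add x y hx hy => simp only [map_add, add_tmul, tmul_add, hx, hy]
      | tmul x d => simp
    · ext a b
      simp only [AlgebraTensorModule.curry_apply, curry_apply, LinearMap.coe_restrictScalars,
        LinearMap.comp_apply, TensorProduct.map_tmul, LinearMap.id_apply,
        LinearEquiv.coe_coe, TensorProduct.comm_tmul, S, coR, coL]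
      generalize (Coalgebra.comul b : A ⊗[k] A) = t
      induction t using TensorProduct.induction_on with
      | zero => simp
      | add x y hx hy => simp only [map_add, add_tmul, hx, hy]
      | tmul x d => simp
  counit := by
    ext a
    have := Coalgebra.rTensor_counit_comul (R := k) a
    simp only [LinearMap.rTensor] at this
    change _ = a
    conv_rhs => rw [← one_smul k a, ← TensorProduct.lid_tmul, ← this]
    simp only [LinearMap.comp_apply, coL, LinearEquiv.coe_coe]
    generalize (Coalgebra.comul a : A ⊗[k] A) = t
    induction t using TensorProduct.induction_on with
    | zero => simp
    | add x y hx hy => simp only [map_add, hx, hy]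
    | tmul x d => simp

/-- This splitting lets later cancellations act on one half of the adjoint coaction only. -/
lemma adR_eq : adR k A = mulCo (coL k A) (coR k A) := by
  have h1 : adR k A = (TensorProduct.map (LinearMap.id : A →ₗ[k] A)
      (LinearMap.mul' k A ∘ₗ
        TensorProduct.map (HopfAlgebra.antipode k (A := A)) (LinearMap.id : A →ₗ[k] A)) ∘ₗ
    (TensorProduct.leftComm k A A A).toLinearMap ∘ₗ
    TensorProduct.map (LinearMap.id : A →ₗ[k] A) (Coalgebra.comul (R := k) (A := A))) ∘ₗ
      coR k A := rfl
  have h2 : mulCo (coL k A) (coR k A) = (TensorProduct.map LinearMap.id (LinearMap.mul' k A) ∘ₗ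
    (TensorProduct.assoc k A A A).toLinearMap ∘ₗ TensorProduct.map (coL k A) LinearMap.id) ∘ₗ
      coR k A := rfl
  rw [h1, h2]
  symm
  refine comul_ext _ _ (TensorProduct.map (LinearMap.id : A →ₗ[k] A)
      (LinearMap.mul' k A ∘ₗ
        TensorProduct.map (HopfAlgebra.antipode k (A := A)) (LinearMap.id : A →ₗ[k] A)) ∘ₗ
    (TensorProduct.leftComm k A A A).toLinearMap) ?_ rfl
  ext a b
  simp only [AlgebraTensorModule.curry_apply, curry_apply, LinearMap.coe_restrictScalars,
    LinearMap.comp_apply, TensorProduct.map_tmul, LinearMap.id_apply,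
    LinearEquiv.coe_coe, coR, coL]
  generalize (Coalgebra.comul a : A ⊗[k] A) = t
  induction t using TensorProduct.induction_on with
  | zero => simp
  | add x y hx hy => simp only [map_add, add_tmul, hx, hy]
  | tmul x d => simp

lemma isRightComodule_adR : IsRightComodule (adR k A) := by
  rw [adR_eq]; exact isRightComodule_coL.mulCo isRightComodule_coR comm_coL_coR

/-- The product is a morphism for the right coactions. -/
lemma isComoduleHom_mul_coR :
    IsComoduleHom (mulCo (lft (coR k A)) (rgt (coR k A))) (coR k A) (LinearMap.mul' k A) := by
  rw [IsComoduleHom]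
  ext a b
  simp only [AlgebraTensorModule.curry_apply, curry_apply, LinearMap.coe_restrictScalars,
    LinearMap.comp_apply, LinearMap.mul'_apply, coR, Bialgebra.comul_mul, mulCo, pair, rgt,
    TensorProduct.map_tmul, LinearEquiv.coe_coe, LinearMap.id_apply, lft]
  generalize (Coalgebra.comul b : A ⊗[k] A) = t
  induction t using TensorProduct.induction_on with
  | zero => simp
  | add x y hx hy => simp only [map_add, mul_add, tmul_add, hx, hy]
  | tmul x d =>
    simp only [TensorProduct.map_tmul, LinearEquiv.coe_coe, LinearMap.id_apply,
      LinearMap.comp_apply, TensorProduct.assoc_symm_tmul]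
    generalize (Coalgebra.comul a : A ⊗[k] A) = t
    induction t using TensorProduct.induction_on with
    | zero => simp
    | add x y hx hy => simp only [map_add, add_mul, add_tmul, hx, hy]
    | tmul x d => simp

/-- The product is a morphism for the left coactions, turned into right ones. -/
lemma isComoduleHom_mul_coL :
    IsComoduleHom (mulCo (rgt (coL k A)) (lft (coL k A))) (coL k A) (LinearMap.mul' k A) := by
  rw [IsComoduleHom]
  ext a b
  simp only [AlgebraTensorModule.curry_apply, curry_apply, LinearMap.coe_restrictScalars,
    LinearMap.comp_apply, LinearMap.mul'_apply, coL, Bialgebra.comul_mul, mulCo, pair, rgt,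
    TensorProduct.map_tmul, LinearEquiv.coe_coe, LinearMap.id_apply, lft]
  generalize (Coalgebra.comul a : A ⊗[k] A) = t
  induction t using TensorProduct.induction_on with
  | zero => simp
  | add x y hx hy => simp only [map_add, add_mul, add_tmul, hx, hy]
  | tmul x d =>
    simp only [TensorProduct.map_tmul, LinearEquiv.coe_coe, LinearMap.id_apply,
      LinearMap.comp_apply, TensorProduct.comm_tmul, rightComm_tmul]
    generalize (Coalgebra.comul b : A ⊗[k] A) = t
    induction t using TensorProduct.induction_on with
    | zero => simp
    | add x y hx hy => simp only [map_add, mul_add, add_tmul, tmul_add, hx, hy]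
    | tmul x d => simp [HopfAlgebra.antipode_mul_antidistrib]

/-- Cancellation of the two inner factors of the iterated coproduct. -/
lemma comul_cancel (f : A →ₗ[k] Y) (κ : A ⊗[k] A →ₗ[k] A)
    (hκ : κ ∘ₗ coR k A = Algebra.linearMap k A ∘ₗ Coalgebra.counit) :
    (TensorProduct.map (TensorProduct.map f LinearMap.id) κ ∘ₗ
      (TensorProduct.tensorTensorTensorComm k A A A A).toLinearMap ∘ₗ
      TensorProduct.map LinearMap.id (TensorProduct.comm k A A).toLinearMap ∘ₗ
      TensorProduct.map (coR k A) (coR k A)) ∘ₗ coR k A =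
    (triv ∘ₗ TensorProduct.map f LinearMap.id) ∘ₗ coR k A := by
  let Θ : A ⊗[k] (A ⊗[k] A) →ₗ[k] (Y ⊗[k] A) ⊗[k] A :=
    TensorProduct.map (TensorProduct.map f LinearMap.id) κ ∘ₗ
      (TensorProduct.tensorTensorTensorComm k A A A A).toLinearMap ∘ₗ
      TensorProduct.map LinearMap.id ((TensorProduct.comm k A A).toLinearMap ∘ₗ coR k A) ∘ₗ
      (TensorProduct.assoc k A A A).symm.toLinearMap
  refine comul_ext _ _ Θ ?_ ?_
  · ext a b
    simp [Θ]
  · ext a b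
    simp only [AlgebraTensorModule.curry_apply, curry_apply, LinearMap.coe_restrictScalars,
      LinearMap.comp_apply, TensorProduct.map_tmul, LinearMap.id_apply, triv_apply]
    let Θ' : A ⊗[k] (A ⊗[k] A) →ₗ[k] (Y ⊗[k] A) ⊗[k] A :=
      TensorProduct.map (TensorProduct.mk k Y A (f a)) κ ∘ₗ
        (TensorProduct.comm k (A ⊗[k] A) A).toLinearMap ∘ₗ
        (TensorProduct.assoc k A A A).symm.toLinearMap
    -- Coassociativity a second time, inside the last three factors, so that `κ` is applied to a
    -- genuine coproduct and `hκ` turns it into a counit.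
    have h := comul_ext (Θ' ∘ₗ (TensorProduct.assoc k A A A).toLinearMap ∘ₗ
      TensorProduct.map (coR k A) LinearMap.id) (Θ ∘ₗ TensorProduct.mk k A (A ⊗[k] A) a) Θ' rfl ?_
    · have h' := LinearMap.congr_fun h b
      simp only [LinearMap.comp_apply, TensorProduct.mk_apply] at h'
      rw [← h']
      have hb := Coalgebra.rTensor_counit_comul (R := k) b
      simp only [LinearMap.rTensor] at hb
      have hb' : (f a ⊗ₜ[k] b) ⊗ₜ[k] (1 : A) = (TensorProduct.mk k _ A).flip 1
        (TensorProduct.mk k Y A (f a) (TensorProduct.lid k A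
          (TensorProduct.map Coalgebra.counit LinearMap.id (coR k A b)))) := by
        rw [hb]; simp
      rw [hb']
      generalize coR k A b = t
      induction t using TensorProduct.induction_on with
      | zero => simp
      | add x y hx hy => simp only [map_add, hx, hy]
      | tmul x d =>
        have := LinearMap.congr_fun hκ x
        simp only [LinearMap.comp_apply] at this
        simp [Θ', this, Algebra.algebraMap_eq_smul_one, smul_tmul']
    · ext c d
      simp only [AlgebraTensorModule.curry_apply, curry_apply, LinearMap.coe_restrictScalars,
        LinearMap.comp_apply, TensorProduct.mk_apply, Θ, Θ', LinearEquiv.coe_coe,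
        TensorProduct.assoc_symm_tmul, TensorProduct.map_tmul, LinearMap.id_apply]
      generalize coR k A d = t
      induction t using TensorProduct.induction_on with
      | zero => simp
      | add x y hx hy => simp only [map_add, tmul_add, hx, hy]
      | tmul x d => simp

/-- The inner coactions cancel on the image of the coproduct. -/
lemma isComoduleHom_comul_triv :
    IsComoduleHom triv (mulCo (lft (coR k A)) (rgt (coL k A))) (coR k A) := by
  -- The two legs are a₂ and S a₃, whose product collapses to a counit.
  have h := comul_cancel (k := k) (A := A) (LinearMap.id)
    (LinearMap.mul' k A ∘ₗ TensorProduct.map LinearMap.id (HopfAlgebra.antipode k)) (by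
      ext a; exact HopfAlgebra.mul_antipode_lTensor_comul_apply a)
  rw [IsComoduleHom]
  refine Eq.trans ?_ (h.trans ?_)
  · congr 1
    ext a b
    simp only [AlgebraTensorModule.curry_apply, curry_apply, LinearMap.coe_restrictScalars,
      LinearMap.comp_apply, coR, coL, mulCo, pair, rgt,
      TensorProduct.map_tmul, LinearEquiv.coe_coe, LinearMap.id_apply, lft]
    generalize (Coalgebra.comul b : A ⊗[k] A) = t
    induction t using TensorProduct.induction_on with
    | zero => simp
    | add x y hx hy => simp only [map_add, tmul_add, hx, hy]
    | tmul x d =>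
      simp only [TensorProduct.map_tmul, LinearEquiv.coe_coe, LinearMap.id_apply,
        LinearMap.comp_apply, TensorProduct.comm_tmul, TensorProduct.assoc_symm_tmul]
      generalize (Coalgebra.comul a : A ⊗[k] A) = t
      induction t using TensorProduct.induction_on with
      | zero => simp
      | add x y hx hy => simp only [map_add, add_tmul, hx, hy]
      | tmul x d => simp
  · ext a; simp

lemma isComoduleHom_antipode : IsComoduleHom (coL k A) (coR k A) (HopfAlgebra.antipode k) := by
  rw [IsComoduleHom]
  ext a
  simp only [LinearMap.comp_apply, coR, coL, comul_antipode, LinearEquiv.coe_coe,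
    TensorProduct.map_map]
  congr 1

/-- The coactions on the left cancel on the elements `S a₁ ⊗ a₂`. -/
lemma isComoduleHom_antipode_comul_triv :
    IsComoduleHom triv (mulCo (rgt (coL k A)) (lft (coL k A)))
      (TensorProduct.map (HopfAlgebra.antipode k) LinearMap.id ∘ₗ coR k A) := by
  let S : A →ₗ[k] A := HopfAlgebra.antipode k
  -- The legs are S a₃ and S S a₂; their product S a₃ · S S a₂ = S(S a₂ · a₃) collapses.
  have h := comul_cancel (k := k) (A := A) S
    (LinearMap.mul' k A ∘ₗ (TensorProduct.comm k A A).toLinearMap ∘ₗ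
      TensorProduct.map (S ∘ₗ S) S) (by
      ext a
      have h1 := HopfAlgebra.mul_antipode_rTensor_comul_apply (R := k) a
      have h2 := congr(S $h1)
      simp only [LinearMap.rTensor] at h2
      rw [Algebra.algebraMap_eq_smul_one, map_smul, HopfAlgebra.antipode_one,
        ← Algebra.algebraMap_eq_smul_one] at h2
      refine Eq.trans ?_ h2
      simp only [LinearMap.comp_apply, coR]
      generalize (Coalgebra.comul a : A ⊗[k] A) = t
      induction t using TensorProduct.induction_on with
      | zero => simp
      | add x y hx hy => simp only [map_add, hx, hy]
      | tmul x d => simp [S, HopfAlgebra.antipode_mul_antidistrib])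
  rw [IsComoduleHom, ← LinearMap.comp_assoc]
  refine Eq.trans ?_ (h.trans ?_)
  · congr 1
    ext a b
    simp only [AlgebraTensorModule.curry_apply, curry_apply, LinearMap.coe_restrictScalars,
      LinearMap.comp_apply, coR, coL, mulCo, pair, rgt,
      TensorProduct.map_tmul, LinearEquiv.coe_coe, LinearMap.id_apply, lft, comul_antipode]
    generalize (Coalgebra.comul a : A ⊗[k] A) = t
    induction t using TensorProduct.induction_on with
    | zero => simp
    | add x y hx hy => simp only [map_add, add_tmul, hx, hy]
    | tmul x d =>
      simp only [TensorProduct.map_tmul, LinearEquiv.coe_coe, LinearMap.id_apply,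
        LinearMap.comp_apply, TensorProduct.comm_tmul, rightComm_tmul]
      generalize (Coalgebra.comul b : A ⊗[k] A) = t
      induction t using TensorProduct.induction_on with
      | zero => simp
      | add x y hx hy => simp only [map_add, add_tmul, tmul_add, hx, hy]
      | tmul x d => simp [S]
  · ext a; simp [S]

lemma isComoduleHom_counit_adR :
    IsComoduleHom (adR k A) (triv : k →ₗ[k] k ⊗[k] A) Coalgebra.counit := by
  rw [IsComoduleHom, adR_eq]
  ext a
  have h1 := HopfAlgebra.mul_antipode_rTensor_comul_apply (R := k) a
  have h2 : (Coalgebra.counit (R := k) a ⊗ₜ[k] (1 : A) : k ⊗[k] A) =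
      (1 : k) ⊗ₜ[k] algebraMap k A (Coalgebra.counit a) := by
    rw [Algebra.algebraMap_eq_smul_one, tmul_smul, smul_tmul']; simp
  simp only [LinearMap.comp_apply, triv_apply, h2, ← h1, mulCo, pair, LinearMap.rTensor,
    LinearEquiv.coe_coe]
  generalize (Coalgebra.comul a : A ⊗[k] A) = t
  induction t using TensorProduct.induction_on with
  | zero => simp
  | add x y hx hy => simp only [map_add, tmul_add, hx, hy]
  | tmul x y =>
    have h3 : TensorProduct.map Coalgebra.counit LinearMap.id (coL k A x) =
        (1 : k) ⊗ₜ[k] HopfAlgebra.antipode k x := by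
      have := Coalgebra.lTensor_counit_comul (R := k) x
      simp only [LinearMap.lTensor] at this
      rw [← TensorProduct.comm_tmul, ← LinearMap.id_apply (R := k) (1 : k),
        ← TensorProduct.map_tmul, ← this]
      simp only [coL, LinearMap.comp_apply, LinearEquiv.coe_coe]
      generalize (Coalgebra.comul x : A ⊗[k] A) = t
      induction t using TensorProduct.induction_on with
      | zero => simp
      | add x y hx hy => simp only [map_add, hx, hy]
      | tmul x y => simp
    simp only [TensorProduct.map_tmul, LinearMap.id_apply, LinearMap.mul'_apply]
    have h4 : TensorProduct.map LinearMap.id (LinearMap.mul' k A)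
        (TensorProduct.assoc k k A A (TensorProduct.map Coalgebra.counit LinearMap.id (coL k A x)
          ⊗ₜ[k] y)) = (1 : k) ⊗ₜ[k] (HopfAlgebra.antipode k x * y) := by
      rw [h3]; simp
    rw [← h4]
    generalize coL k A x = t
    induction t using TensorProduct.induction_on with
    | zero => simp
    | add x y hx hy => simp only [map_add, add_tmul, hx, hy]
    | tmul x y => simp

lemma isComoduleHom_lid (ε : X →ₗ[k] k) (σ : Y →ₗ[k] Y ⊗[k] A) :
    IsComoduleHom (rgt σ) σ ((TensorProduct.lid k Y).toLinearMap ∘ₗ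
      TensorProduct.map ε LinearMap.id) := by
  rw [IsComoduleHom]
  ext x y
  simp only [AlgebraTensorModule.curry_apply, curry_apply, LinearMap.coe_restrictScalars,
    LinearMap.comp_apply, TensorProduct.map_tmul, LinearMap.id_apply, rgt,
    LinearEquiv.coe_coe, TensorProduct.lid_tmul, map_smul]
  generalize σ y = t
  induction t using TensorProduct.induction_on with
  | zero => simp
  | add x y hx hy => simp only [map_add, tmul_add, smul_add, hx, hy]
  | tmul x y => simp [smul_tmul']

lemma coL_one : coL k A 1 = 1 ⊗ₜ 1 := by
  simp [coL, Algebra.TensorProduct.one_def, HopfAlgebra.antipode_one]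

lemma adR_one : adR k A 1 = 1 ⊗ₜ 1 := by
  rw [adR_eq]; simp [mulCo, pair, coL_one, Algebra.TensorProduct.one_def]

/-- R(S ⊗ id) is the convolution inverse of `R`, by multiplicativity in the first argument, and R(S
⊗ S) inverts R(S ⊗ id), by multiplicativity in the second. Inverses are unique. -/
lemma IsCoquasitriangular.antipode_antipode {R : A ⊗[k] A →ₗ[k] k} (hR : IsCoquasitriangular R) :
    R ∘ₗ TensorProduct.map (HopfAlgebra.antipode k) (HopfAlgebra.antipode k) = R := by
  let S : A →ₗ[k] A := HopfAlgebra.antipode k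
  have h1 : WithConv.toConv (R ∘ₗ TensorProduct.map S LinearMap.id) * WithConv.toConv R = 1 := by
    ext a b
    have e (t : A ⊗[k] A) : R ((LinearMap.mul' k A (TensorProduct.map S LinearMap.id t)) ⊗ₜ b) =
      LinearMap.mul' k k (TensorProduct.map (R ∘ₗ TensorProduct.map S LinearMap.id) R
        (TensorProduct.tensorTensorTensorComm k A A A A (t ⊗ₜ Coalgebra.comul b))) := by
      induction t using TensorProduct.induction_on with
      | zero => simp
      | add x y hx hy => simp only [map_add, add_tmul, hx, hy]
      | tmul x y =>
        have := LinearMap.congr_fun hR.mul_left ((S x ⊗ₜ y) ⊗ₜ b)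
        simp only [LinearMap.comp_apply, TensorProduct.map_tmul, LinearMap.id_apply,
          LinearEquiv.coe_coe] at this ⊢
        rw [this]
        generalize (Coalgebra.comul b : A ⊗[k] A) = t
        induction t using TensorProduct.induction_on with
        | zero => simp
        | add x y hx hy => simp only [map_add, tmul_add, hx, hy]
        | tmul x y => simp
    have := e (Coalgebra.comul a)
    rw [show LinearMap.mul' k A (TensorProduct.map S LinearMap.id (Coalgebra.comul a)) = _ from
      HopfAlgebra.mul_antipode_rTensor_comul_apply (R := k) a] at this
    simp only [AlgebraTensorModule.curry_apply, curry_apply, LinearMap.coe_restrictScalars,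
      LinearMap.convMul_apply, TensorProduct.comul_tmul]
    refine Eq.trans this.symm ?_
    rw [Algebra.algebraMap_eq_smul_one, ← smul_tmul', map_smul, hR.one_left]
    simp [LinearMap.convOne_def, mul_comm]
  have h2 : WithConv.toConv (R ∘ₗ TensorProduct.map S LinearMap.id) *
      WithConv.toConv (R ∘ₗ TensorProduct.map S S) = 1 := by
    ext a b
    have e (t : A ⊗[k] A) : R (S a ⊗ₜ (LinearMap.mul' k A (TensorProduct.map LinearMap.id S t))) =
      LinearMap.mul' k k (TensorProduct.map (R ∘ₗ TensorProduct.map S LinearMap.id)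
        (R ∘ₗ TensorProduct.map S S)
        (TensorProduct.tensorTensorTensorComm k A A A A (Coalgebra.comul a ⊗ₜ t))) := by
      induction t using TensorProduct.induction_on with
      | zero => simp
      | add x y hx hy => simp only [map_add, tmul_add, hx, hy]
      | tmul x y =>
        have := LinearMap.congr_fun hR.mul_right (S a ⊗ₜ (x ⊗ₜ S y))
        simp only [LinearMap.comp_apply, TensorProduct.map_tmul, LinearMap.id_apply,
          LinearEquiv.coe_coe, TensorProduct.comm_tmul] at this ⊢
        rw [this]
        simp only [S, comul_antipode]
        generalize (Coalgebra.comul a : A ⊗[k] A) = t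
        induction t using TensorProduct.induction_on with
        | zero => simp
        | add x y hx hy => simp only [map_add, add_tmul, hx, hy]
        | tmul x y => simp [mul_comm]
    have := e (Coalgebra.comul b)
    rw [show LinearMap.mul' k A (TensorProduct.map LinearMap.id S (Coalgebra.comul b)) = _ from
      HopfAlgebra.mul_antipode_lTensor_comul_apply (R := k) b] at this
    simp only [AlgebraTensorModule.curry_apply, curry_apply, LinearMap.coe_restrictScalars,
      LinearMap.convMul_apply, TensorProduct.comul_tmul]
    refine Eq.trans this.symm ?_
    simp [Algebra.algebraMap_eq_smul_one, hR.one_right, LinearMap.convOne_def, S,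
      mul_comm]
  have h3 := left_inv_eq_right_inv (a := WithConv.toConv (R ∘ₗ TensorProduct.map S LinearMap.id))
    (b := WithConv.toConv R) (c := WithConv.toConv (R ∘ₗ TensorProduct.map S S)) (by
      -- Invertibility of `R` makes the one-sided inverse `h1` two-sided.
      obtain ⟨u, hu⟩ := hR.isUnit
      rw [← hu] at h1 ⊢
      have : WithConv.toConv (R ∘ₗ TensorProduct.map S LinearMap.id) = ↑u⁻¹ :=
        Units.eq_inv_of_mul_eq_one_right h1
      rw [this]; simp) h2
  exact (congr_arg WithConv.ofConv h3).symm

/-- Quasi-commutativity in terms of the two coactions of `A`. -/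
lemma IsCoquasitriangular.mul_comm_Rop {R : A ⊗[k] A →ₗ[k] k} (hR : IsCoquasitriangular R) :
    LinearMap.mul' k A ∘ₗ (TensorProduct.comm k A A).toLinearMap ∘ₗ
      Rop R (lft (coR k A)) (rgt (coR k A)) =
    LinearMap.mul' k A ∘ₗ Rop R (lft (coL k A)) (rgt (coL k A)) := by
  refine (Eq.trans ?_ hR.quasi_comm).trans ?_
  · ext a b
    simp only [AlgebraTensorModule.curry_apply, curry_apply, LinearMap.coe_restrictScalars,
      LinearMap.comp_apply, TensorProduct.map_tmul, LinearMap.id_apply, Rop, act, pair, lft, rgt,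
      LinearEquiv.coe_coe, coR, TensorProduct.comul_tmul]
    generalize (Coalgebra.comul b : A ⊗[k] A) = t
    induction t using TensorProduct.induction_on with
    | zero => simp
    | add x y hx hy => simp only [map_add, tmul_add, hx, hy]
    | tmul x y =>
      simp only [TensorProduct.assoc_symm_tmul, TensorProduct.map_tmul, LinearMap.comp_apply,
        LinearEquiv.coe_coe, LinearMap.id_apply]
      generalize (Coalgebra.comul a : A ⊗[k] A) = t
      induction t using TensorProduct.induction_on with
      | zero => simp
      | add x y hx hy => simp only [map_add, add_tmul, hx, hy]
      | tmul x y => simp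
  ext a b
  -- Both legs of `coL` carry an antipode, and `R` does not see the pair of them.
  have e2 (x y) : R (HopfAlgebra.antipode k x ⊗ₜ HopfAlgebra.antipode k y) = R (x ⊗ₜ y) :=
    LinearMap.congr_fun hR.antipode_antipode (x ⊗ₜ y)
  simp only [AlgebraTensorModule.curry_apply, curry_apply, LinearMap.coe_restrictScalars,
    LinearMap.comp_apply, TensorProduct.map_tmul, LinearMap.id_apply, Rop, act, pair, lft, rgt,
    LinearEquiv.coe_coe, coL, TensorProduct.comul_tmul]
  generalize (Coalgebra.comul b : A ⊗[k] A) = t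
  induction t using TensorProduct.induction_on with
  | zero => simp
  | add x y hx hy => simp only [map_add, tmul_add, hx, hy]
  | tmul x y =>
    simp only [TensorProduct.assoc_symm_tmul, TensorProduct.map_tmul, LinearMap.comp_apply,
      LinearEquiv.coe_coe, LinearMap.id_apply, TensorProduct.comm_tmul]
    generalize (Coalgebra.comul a : A ⊗[k] A) = t
    induction t using TensorProduct.induction_on with
    | zero => simp
    | add x y hx hy => simp only [map_add, add_tmul, hx, hy]
    | tmul x y => simp [e2]

/-! ### The structure maps as operators -/

lemma tensorCoaction_eq (ρ : X →ₗ[k] X ⊗[k] A) (σ : Y →ₗ[k] Y ⊗[k] A) :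
    tensorCoaction ρ σ = mulCo (lft ρ) (rgt σ) := by
  ext x y
  simp only [AlgebraTensorModule.curry_apply, curry_apply, LinearMap.coe_restrictScalars,
    LinearMap.comp_apply, TensorProduct.map_tmul, LinearMap.id_apply, mulCo, pair, lft, rgt,
    LinearEquiv.coe_coe, tensorCoaction]
  generalize σ y = t
  induction t using TensorProduct.induction_on with
  | zero => simp
  | add x y hx hy => simp only [map_add, tmul_add, hx, hy]
  | tmul y b =>
    simp only [TensorProduct.assoc_symm_tmul, TensorProduct.map_tmul, LinearMap.comp_apply,
      LinearEquiv.coe_coe, LinearMap.id_apply]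
    generalize ρ x = t
    induction t using TensorProduct.induction_on with
    | zero => simp
    | add x y hx hy => simp only [map_add, add_tmul, hx, hy]
    | tmul x y => simp

lemma braiding_eq (F : A ⊗[k] A →ₗ[k] k) (ρ : X →ₗ[k] X ⊗[k] A) (σ : Y →ₗ[k] Y ⊗[k] A) :
    braiding F ρ σ = (TensorProduct.comm k X Y).toLinearMap ∘ₗ Rop F (lft ρ) (rgt σ) := by
  ext x y
  simp only [AlgebraTensorModule.curry_apply, curry_apply, LinearMap.coe_restrictScalars,
    LinearMap.comp_apply, TensorProduct.map_tmul, LinearMap.id_apply, pair, lft, rgt,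
    LinearEquiv.coe_coe, braiding, Rop, act]
  generalize σ y = t
  induction t using TensorProduct.induction_on with
  | zero => simp
  | add x y hx hy => simp only [map_add, tmul_add, hx, hy]
  | tmul y b =>
    simp only [TensorProduct.assoc_symm_tmul, TensorProduct.map_tmul, LinearMap.comp_apply,
      LinearEquiv.coe_coe, LinearMap.id_apply]
    generalize ρ x = t
    induction t using TensorProduct.induction_on with
    | zero => simp
    | add x y hx hy => simp only [map_add, add_tmul, hx, hy]
    | tmul x y => simp

lemma transMul_eq (R : A ⊗[k] A →ₗ[k] k) :
    transMul R = LinearMap.mul' k A ∘ₗ Rop R (lft (adR k A)) (rgt (coL k A)) := by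
  ext x y
  simp only [AlgebraTensorModule.curry_apply, curry_apply, LinearMap.coe_restrictScalars,
    LinearMap.comp_apply, TensorProduct.map_tmul, LinearMap.id_apply, pair, lft, rgt,
    LinearEquiv.coe_coe, transMul, Rop, act, coL]
  generalize (Coalgebra.comul y : A ⊗[k] A) = t
  induction t using TensorProduct.induction_on with
  | zero => simp
  | add x y hx hy => simp only [map_add, tmul_add, hx, hy]
  | tmul y b =>
    simp only [TensorProduct.assoc_symm_tmul, TensorProduct.map_tmul, LinearMap.comp_apply,
      LinearEquiv.coe_coe, LinearMap.id_apply, TensorProduct.comm_tmul]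
    generalize adR k A x = t
    induction t using TensorProduct.induction_on with
    | zero => simp
    | add x y hx hy => simp only [map_add, add_tmul, hx, hy]
    | tmul x y => simp

variable (k A X) in
/-- The map `A ⊗ X → X`, `a ⊗ x ↦ ε(a) x`. -/
def counitL : A ⊗[k] X →ₗ[k] X :=
  (TensorProduct.lid k X).toLinearMap ∘ₗ TensorProduct.map Coalgebra.counit LinearMap.id

variable (k A X) in
/-- The map `X ⊗ A → X`, `x ⊗ a ↦ ε(a) x`. -/
def counitR : X ⊗[k] A →ₗ[k] X :=
  (TensorProduct.rid k X).toLinearMap ∘ₗ TensorProduct.map LinearMap.id Coalgebra.counit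

lemma Rop_swap (F : A ⊗[k] A →ₗ[k] k) {ρ σ : X →ₗ[k] X ⊗[k] A} (h : Comm ρ σ) :
    Rop F σ ρ = Rop (F ∘ₗ (TensorProduct.comm k A A).toLinearMap) ρ σ := by
  have e1 : slice F ∘ₗ TensorProduct.map (LinearMap.id : X →ₗ[k] X)
      (TensorProduct.comm k A A).toLinearMap =
      slice (F ∘ₗ (TensorProduct.comm k A A).toLinearMap) := by ext; simp
  rw [Rop, act, h.symm.pair_eq, ← LinearMap.comp_assoc, e1]; rfl

/-- The quantum Killing form is the convolution product of the flipped `R` with `R`, so its operator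
is a composite of two. -/
lemma bracket_eq (R : A ⊗[k] A →ₗ[k] k) :
    bracket R = counitL k A A ∘ₗ Rop R (rgt (adR k A)) (lft (coR k A)) ∘ₗ
      Rop R (lft (coR k A)) (rgt (adR k A)) := by
  have h1 := Rop_conv (comm_lft_rgt (coR k A) (adR k A)) isRightComodule_coR.lft
    isRightComodule_adR.rgt (WithConv.toConv (R ∘ₗ (TensorProduct.comm k A A).toLinearMap))
    (WithConv.toConv R)
  rw [Rop_swap R (comm_lft_rgt (coR k A) (adR k A))]
  refine Eq.trans ?_ congr(counitL k A A ∘ₗ $h1)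
  change _ = counitL k A A ∘ₗ Rop (quantumKilling R) _ _
  ext x y
  simp only [AlgebraTensorModule.curry_apply, curry_apply, LinearMap.coe_restrictScalars,
    LinearMap.comp_apply, TensorProduct.map_tmul, LinearMap.id_apply, pair, lft, rgt,
    LinearEquiv.coe_coe, bracket, Rop, act, counitL]
  generalize adR k A y = t
  induction t using TensorProduct.induction_on with
  | zero => simp
  | add x y hx hy => simp only [map_add, tmul_add, hx, hy]
  | tmul y b =>
    simp only [TensorProduct.assoc_symm_tmul, TensorProduct.map_tmul, LinearMap.comp_apply,
      LinearEquiv.coe_coe, LinearMap.id_apply, leftComm_tmul]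
    have := Coalgebra.rTensor_counit_comul (R := k) x
    simp only [LinearMap.rTensor] at this
    -- The operators keep a copy of the first factor, which the counit discards at the end; hence x
    -- is written as ε(x₁) x₂.
    have hx : x = TensorProduct.lid k A
      (TensorProduct.map Coalgebra.counit LinearMap.id (coR k A x)) := by rw [this]; simp
    conv_lhs => rw [hx]
    generalize coR k A x = t
    induction t using TensorProduct.induction_on with
    | zero => simp
    | add x y hx hy => simp only [map_add, add_tmul, tmul_add, hx, hy]
    | tmul x z => simp [← smul_tmul', smul_smul, mul_comm]

lemma transAntipode_eq (R : A ⊗[k] A →ₗ[k] k) :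
    transAntipode R = counitR k A A ∘ₗ Rop R (lft (adR k A)) (rgt (coR k A)) ∘ₗ
      TensorProduct.map (HopfAlgebra.antipode k) LinearMap.id ∘ₗ coR k A := by
  rw [transAntipode]
  simp only [← LinearMap.comp_assoc]
  congr 1
  ext x y
  simp only [AlgebraTensorModule.curry_apply, curry_apply, LinearMap.coe_restrictScalars,
    LinearMap.comp_apply, TensorProduct.map_tmul, LinearMap.id_apply, pair, lft, rgt,
    LinearEquiv.coe_coe, Rop, act, counitR]
  generalize HopfAlgebra.antipode k x = x
  have := Coalgebra.rTensor_counit_comul (R := k) y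
  simp only [LinearMap.rTensor] at this
  have hy : y = TensorProduct.lid k A
    (TensorProduct.map Coalgebra.counit LinearMap.id (coR k A y)) := by rw [this]; simp
  conv_lhs => rw [hy]
  generalize coR k A y = t
  induction t using TensorProduct.induction_on with
  | zero => simp
  | add x y hx hy => simp only [map_add, tmul_add, hx, hy]
  | tmul y b =>
    simp only [TensorProduct.assoc_symm_tmul, TensorProduct.map_tmul, LinearMap.comp_apply,
      LinearEquiv.coe_coe, LinearMap.id_apply]
    generalize adR k A x = t
    induction t using TensorProduct.induction_on with
    | zero => simp
    | add x y hx hy => simp only [map_add, add_tmul, hx, hy]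
    | tmul x z => simp [smul_smul, mul_comm]

/-! ### Inference of the side conditions -/

/-- `ρ` is a right coaction. -/
class IsCoaction (ρ : X →ₗ[k] X ⊗[k] A) : Prop where
  out : IsRightComodule ρ

/-- `ρ` and `σ` commute. -/
class Commutes (ρ σ : X →ₗ[k] X ⊗[k] A) : Prop where
  out : Comm ρ σ

instance : IsCoaction (triv : X →ₗ[k] X ⊗[k] A) := ⟨.triv⟩
instance : IsCoaction (coR k A) := ⟨isRightComodule_coR⟩
instance : IsCoaction (coL k A) := ⟨isRightComodule_coL⟩
instance : IsCoaction (adR k A) := ⟨isRightComodule_adR⟩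
instance (ρ : X →ₗ[k] X ⊗[k] A) [h : IsCoaction ρ] : IsCoaction (lft ρ : X ⊗[k] Y →ₗ[k] _) :=
  ⟨h.out.lft⟩
instance (ρ : Y →ₗ[k] Y ⊗[k] A) [h : IsCoaction ρ] : IsCoaction (rgt ρ : X ⊗[k] Y →ₗ[k] _) :=
  ⟨h.out.rgt⟩
instance (ρ σ : X →ₗ[k] X ⊗[k] A) [h₁ : IsCoaction ρ] [h₂ : IsCoaction σ] [h : Commutes ρ σ] :
    IsCoaction (mulCo ρ σ) := ⟨h₁.out.mulCo h₂.out h.out⟩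

instance : Commutes (coL k A) (coR k A) := ⟨comm_coL_coR⟩
instance : Commutes (coR k A) (coL k A) := ⟨comm_coL_coR.symm⟩
instance (ρ : X →ₗ[k] X ⊗[k] A) (σ : Y →ₗ[k] Y ⊗[k] A) : Commutes (lft ρ) (rgt σ) :=
  ⟨comm_lft_rgt ρ σ⟩
instance (ρ : X →ₗ[k] X ⊗[k] A) (σ : Y →ₗ[k] Y ⊗[k] A) : Commutes (rgt σ) (lft ρ) :=
  ⟨(comm_lft_rgt ρ σ).symm⟩
instance (ρ σ : X →ₗ[k] X ⊗[k] A) [h : Commutes ρ σ] :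
    Commutes (lft ρ : X ⊗[k] Y →ₗ[k] _) (lft σ) := ⟨h.out.lft⟩
instance (ρ σ : Y →ₗ[k] Y ⊗[k] A) [h : Commutes ρ σ] :
    Commutes (rgt ρ : X ⊗[k] Y →ₗ[k] _) (rgt σ) := ⟨h.out.rgt⟩
instance (ρ σ τ : X →ₗ[k] X ⊗[k] A) [h₁ : Commutes τ ρ] [h₂ : Commutes τ σ] :
    Commutes τ (mulCo ρ σ) := ⟨h₁.out.mulCo h₂.out⟩
instance (ρ σ τ : X →ₗ[k] X ⊗[k] A) [h₁ : Commutes ρ τ] [h₂ : Commutes σ τ] :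
    Commutes (mulCo ρ σ) τ := ⟨(h₁.out.symm.mulCo h₂.out.symm).symm⟩

/-! ### Operator identities at an element. -/

section Pointwise

lemma Rop_natural_apply (F : A ⊗[k] A →ₗ[k] k) {ρ σ : X →ₗ[k] X ⊗[k] A}
    {ρ' σ' : Y →ₗ[k] Y ⊗[k] A} {f : X →ₗ[k] Y} (hρ : IsComoduleHom ρ ρ' f)
    (hσ : IsComoduleHom σ σ' f) (x : X) :
    Rop F ρ' σ' (f x) = f (Rop F ρ σ x) := LinearMap.congr_fun (Rop_natural F hρ hσ) x

lemma Rop_comm_apply (F G : A ⊗[k] A →ₗ[k] k) (ρ σ ρ' σ' : X →ₗ[k] X ⊗[k] A)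
    [h₁ : Commutes ρ ρ'] [h₂ : Commutes ρ σ'] [h₃ : Commutes σ ρ'] [h₄ : Commutes σ σ'] (x : X) :
    Rop F ρ σ (Rop G ρ' σ' x) = Rop G ρ' σ' (Rop F ρ σ x) :=
  LinearMap.congr_fun (Rop_comm F G h₁.out h₂.out h₃.out h₄.out) x

variable {R : A ⊗[k] A →ₗ[k] k}

lemma yang_baxter_apply (hR : IsCoquasitriangular R) (ρ σ τ : X →ₗ[k] X ⊗[k] A)
    [h₁ : Commutes ρ σ] [h₂ : Commutes ρ τ] [h₃ : Commutes σ τ]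
    [h₄ : IsCoaction ρ] [h₅ : IsCoaction σ] [h₆ : IsCoaction τ] (x : X) :
    Rop R ρ σ (Rop R ρ τ (Rop R σ τ x)) = Rop R σ τ (Rop R ρ τ (Rop R ρ σ x)) :=
  LinearMap.congr_fun (yang_baxter hR h₁.out h₂.out h₃.out h₄.out h₅.out h₆.out) x

lemma Rop_mulCo_left_apply (hR : IsCoquasitriangular R) (ρ σ τ : X →ₗ[k] X ⊗[k] A)
    [h₁ : Commutes ρ τ] [h₂ : Commutes σ τ] [h₃ : IsCoaction τ] (x : X) :
    Rop R (mulCo ρ σ) τ x = Rop R ρ τ (Rop R σ τ x) :=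
  LinearMap.congr_fun (Rop_mulCo_left hR h₁.out h₂.out h₃.out) x

lemma Rop_mulCo_right_apply (hR : IsCoquasitriangular R) (ρ σ τ : X →ₗ[k] X ⊗[k] A)
    [h₁ : Commutes ρ σ] [h₂ : Commutes σ τ] [h₃ : IsCoaction τ] (x : X) :
    Rop R τ (mulCo ρ σ) x = Rop R τ σ (Rop R τ ρ x) :=
  LinearMap.congr_fun (Rop_mulCo_right hR h₁.out h₂.out h₃.out) x

lemma Rop_triv_left_apply (hR : IsCoquasitriangular R) (σ : X →ₗ[k] X ⊗[k] A)
    [h : IsCoaction σ] (x : X) : Rop R triv σ x = x :=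
  LinearMap.congr_fun (Rop_triv_left hR h.out) x

lemma Rop_triv_right_apply (hR : IsCoquasitriangular R) (ρ : X →ₗ[k] X ⊗[k] A)
    [h : IsCoaction ρ] (x : X) : Rop R ρ triv x = x :=
  LinearMap.congr_fun (Rop_triv_right hR h.out) x

lemma Rop_comp_inv_apply (hR : IsCoquasitriangular R) (ρ σ : X →ₗ[k] X ⊗[k] A)
    [h : Commutes ρ σ] [h₁ : IsCoaction ρ] [h₂ : IsCoaction σ] (x : X) :
    Rop R ρ σ (Rop hR.inv ρ σ x) = x :=
  LinearMap.congr_fun (Rop_comp_inv hR h.out h₁.out h₂.out) x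

lemma Rop_inv_comp_apply (hR : IsCoquasitriangular R) (ρ σ : X →ₗ[k] X ⊗[k] A)
    [h : Commutes ρ σ] [h₁ : IsCoaction ρ] [h₂ : IsCoaction σ] (x : X) :
    Rop hR.inv ρ σ (Rop R ρ σ x) = x :=
  LinearMap.congr_fun (Rop_inv_comp hR h.out h₁.out h₂.out) x

lemma map_Rop_left (F : A ⊗[k] A →ₗ[k] k) (ρ σ : X →ₗ[k] X ⊗[k] A) (f : X →ₗ[k] Z)
    (g : Y →ₗ[k] W) (x : X ⊗[k] Y) :
    TensorProduct.map (f ∘ₗ Rop F ρ σ) g x =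
      TensorProduct.map f g (Rop F (lft ρ) (lft σ) x) := by
  rw [Rop_lft, ← LinearMap.comp_apply, ← TensorProduct.map_comp, LinearMap.comp_id]

lemma map_Rop_right (F : A ⊗[k] A →ₗ[k] k) (ρ σ : Y →ₗ[k] Y ⊗[k] A) (f : X →ₗ[k] Z)
    (g : Y →ₗ[k] W) (x : X ⊗[k] Y) :
    TensorProduct.map f (g ∘ₗ Rop F ρ σ) x =
      TensorProduct.map f g (Rop F (rgt ρ) (rgt σ) x) := by
  rw [Rop_rgt, ← LinearMap.comp_apply, ← TensorProduct.map_comp, LinearMap.comp_id]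

end Pointwise

/-! ### Coactions under insertion, multiplication and regrouping of tensor factors. -/

lemma isComoduleHom_mk_lft (ρ : X →ₗ[k] X ⊗[k] A) (y : Y) :
    IsComoduleHom ρ (lft ρ) ((TensorProduct.mk k X Y).flip y) := by
  rw [IsComoduleHom]
  ext x
  simp only [LinearMap.comp_apply, lft, flip_apply, mk_apply, TensorProduct.map_tmul,
    LinearMap.id_apply, LinearEquiv.coe_coe]
  generalize ρ x = t
  induction t using TensorProduct.induction_on with
  | zero => simp
  | add x y hx hy => simp only [map_add, add_tmul, hx, hy]
  | tmul x z => simp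

lemma isComoduleHom_mk_rgt (ρ : Y →ₗ[k] Y ⊗[k] A) (x : X) :
    IsComoduleHom ρ (rgt ρ) (TensorProduct.mk k X Y x) := by
  rw [IsComoduleHom]
  ext y
  simp only [LinearMap.comp_apply, rgt, mk_apply, TensorProduct.map_tmul,
    LinearMap.id_apply, LinearEquiv.coe_coe]
  generalize ρ y = t
  induction t using TensorProduct.induction_on with
  | zero => simp
  | add x y hx hy => simp only [map_add, tmul_add, hx, hy]
  | tmul x z => simp

lemma lft_mulCo (ρ σ : X →ₗ[k] X ⊗[k] A) :
    (lft (mulCo ρ σ) : X ⊗[k] Y →ₗ[k] _) = mulCo (lft ρ) (lft σ) := by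
  ext x y
  have h1 := ((isComoduleHom_mk_lft ρ y).mulCo (isComoduleHom_mk_lft σ y)).apply x
  have h2 := (isComoduleHom_mk_lft (mulCo ρ σ) y).apply x
  exact h2.trans h1.symm

lemma rgt_mulCo (ρ σ : Y →ₗ[k] Y ⊗[k] A) :
    (rgt (mulCo ρ σ) : X ⊗[k] Y →ₗ[k] _) = mulCo (rgt ρ) (rgt σ) := by
  ext x y
  have h1 := ((isComoduleHom_mk_rgt ρ x).mulCo (isComoduleHom_mk_rgt σ x)).apply y
  have h2 := (isComoduleHom_mk_rgt (mulCo ρ σ) x).apply y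
  exact h2.trans h1.symm

lemma mulCo_assoc (ρ σ τ : X →ₗ[k] X ⊗[k] A) :
    mulCo (mulCo ρ σ) τ = mulCo ρ (mulCo σ τ) := by
  ext x
  simp only [mulCo, pair, LinearMap.comp_apply, LinearEquiv.coe_coe]
  generalize τ x = t
  induction t using TensorProduct.induction_on with
  | zero => simp
  | add x y hx hy => simp only [map_add, hx, hy]
  | tmul x a =>
    simp only [TensorProduct.map_tmul, LinearMap.comp_apply, LinearEquiv.coe_coe,
      LinearMap.id_apply]
    generalize σ x = t
    induction t using TensorProduct.induction_on with
    | zero => simp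
    | add x y hx hy => simp only [map_add, add_tmul, hx, hy]
    | tmul x b =>
      simp only [TensorProduct.map_tmul, LinearMap.id_apply, TensorProduct.assoc_tmul]
      generalize ρ x = t
      induction t using TensorProduct.induction_on with
      | zero => simp
      | add x y hx hy => simp only [map_add, add_tmul, hx, hy]
      | tmul x c => simp [mul_assoc]

lemma triv_mulCo (ρ : X →ₗ[k] X ⊗[k] A) : mulCo triv ρ = ρ := by
  ext x
  simp only [mulCo, pair, LinearMap.comp_apply, LinearEquiv.coe_coe]
  generalize ρ x = t
  induction t using TensorProduct.induction_on with
  | zero => simp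
  | add x y hx hy => simp only [map_add, hx, hy]
  | tmul x a => simp

variable (X Y Z W) in
lemma isComoduleHom_ttt₁ (ρ : X →ₗ[k] X ⊗[k] A) : IsComoduleHom (lft (lft ρ)) (lft (lft ρ))
    (TensorProduct.tensorTensorTensorComm k X Y Z W).toLinearMap := by
  rw [IsComoduleHom]
  ext x y z w
  simp only [AlgebraTensorModule.curry_apply, curry_apply, LinearMap.coe_restrictScalars,
    LinearMap.comp_apply, TensorProduct.map_tmul, LinearMap.id_apply, LinearEquiv.coe_coe,
    lft, TensorProduct.tensorTensorTensorComm_tmul]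
  generalize ρ x = t
  induction t using TensorProduct.induction_on with
  | zero => simp
  | add x y hx hy => simp only [map_add, add_tmul, hx, hy]
  | tmul y a => simp

variable (X Y Z W) in
lemma isComoduleHom_ttt₂ (ρ : Y →ₗ[k] Y ⊗[k] A) : IsComoduleHom (lft (rgt ρ)) (rgt (lft ρ))
    (TensorProduct.tensorTensorTensorComm k X Y Z W).toLinearMap := by
  rw [IsComoduleHom]
  ext x y z w
  simp only [AlgebraTensorModule.curry_apply, curry_apply, LinearMap.coe_restrictScalars,
    LinearMap.comp_apply, TensorProduct.map_tmul, LinearMap.id_apply, LinearEquiv.coe_coe,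
    lft, rgt, TensorProduct.tensorTensorTensorComm_tmul]
  generalize ρ y = t
  induction t using TensorProduct.induction_on with
  | zero => simp
  | add x y hx hy => simp only [map_add, add_tmul, tmul_add, hx, hy]
  | tmul y a => simp

variable (X Y Z W) in
lemma isComoduleHom_ttt₃ (ρ : Z →ₗ[k] Z ⊗[k] A) : IsComoduleHom (rgt (lft ρ)) (lft (rgt ρ))
    (TensorProduct.tensorTensorTensorComm k X Y Z W).toLinearMap := by
  rw [IsComoduleHom]
  ext x y z w
  simp only [AlgebraTensorModule.curry_apply, curry_apply, LinearMap.coe_restrictScalars,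
    LinearMap.comp_apply, TensorProduct.map_tmul, LinearMap.id_apply, LinearEquiv.coe_coe,
    lft, rgt, TensorProduct.tensorTensorTensorComm_tmul]
  generalize ρ z = t
  induction t using TensorProduct.induction_on with
  | zero => simp
  | add x y hx hy => simp only [map_add, add_tmul, tmul_add, hx, hy]
  | tmul y a => simp

variable (X Y Z W) in
lemma isComoduleHom_ttt₄ (ρ : W →ₗ[k] W ⊗[k] A) : IsComoduleHom (rgt (rgt ρ)) (rgt (rgt ρ))
    (TensorProduct.tensorTensorTensorComm k X Y Z W).toLinearMap := by
  rw [IsComoduleHom]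
  ext x y z w
  simp only [AlgebraTensorModule.curry_apply, curry_apply, LinearMap.coe_restrictScalars,
    LinearMap.comp_apply, TensorProduct.map_tmul, LinearMap.id_apply, LinearEquiv.coe_coe,
    rgt, TensorProduct.tensorTensorTensorComm_tmul]
  generalize ρ w = t
  induction t using TensorProduct.induction_on with
  | zero => simp
  | add x y hx hy => simp only [map_add, tmul_add, hx, hy]
  | tmul y a => simp

lemma Rop_conj (F : A ⊗[k] A →ₗ[k] k) {ρ σ : X →ₗ[k] X ⊗[k] A} {ρ' σ' : Y →ₗ[k] Y ⊗[k] A}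
    (e : X ≃ₗ[k] Y) (hρ : IsComoduleHom ρ ρ' e.toLinearMap)
    (hσ : IsComoduleHom σ σ' e.toLinearMap) :
    e.toLinearMap ∘ₗ Rop F ρ σ ∘ₗ e.symm.toLinearMap = Rop F ρ' σ' := by
  rw [← LinearMap.comp_assoc, ← Rop_natural F hρ hσ, LinearMap.comp_assoc]
  ext; simp

/-- The braiding is a flip after an operator, so id ⊗ Ψ ⊗ id is R(ρ₂, ρ₃) followed by the
interchange of the middle factors. In this form it can be moved by naturality like any other
operator. -/
lemma middle_braiding (F : A ⊗[k] A →ₗ[k] k) (ρ : X →ₗ[k] X ⊗[k] A) :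
    middle (braiding F ρ ρ) = (TensorProduct.tensorTensorTensorComm k X X X X).toLinearMap ∘ₗ
      Rop F (lft (rgt ρ)) (rgt (lft ρ)) := by
  have h1 : middle (braiding F ρ ρ) = middle (TensorProduct.comm k X X).toLinearMap ∘ₗ
      middle (Rop F (lft ρ) (rgt ρ)) := by
    ext x y z w
    simp [middle, braiding_eq]
  have h2 : middle (TensorProduct.comm k X X).toLinearMap =
      (TensorProduct.tensorTensorTensorComm k X X X X).toLinearMap := by
    ext; simp [middle]
  have h3 : middle (Rop F (lft ρ) (rgt ρ)) = Rop F (lft (rgt ρ)) (rgt (lft ρ)) := by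
    rw [middle, ← Rop_lft, Rop_conj F _ (isComoduleHom_assoc₁ X X X ρ)
      (isComoduleHom_assoc₂ X X X ρ), ← Rop_rgt]
    exact Rop_conj F (TensorProduct.assoc k X X (X ⊗[k] X)).symm
      (isComoduleHom_assoc₂ X X (X ⊗[k] X) ρ).symm
      (isComoduleHom_assoc₃ X X (X ⊗[k] X) (lft ρ)).symm
  rw [h1, h2, h3]

/-! ### The transmutation as an algebra and a coalgebra -/

variable {R : A ⊗[k] A →ₗ[k] k}

/-- The legs of a product occur in the order l₂ l₁ r₁ r₂, with inner pair ad₁. The factor l₂ stands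
on the wrong side of ad₁ for the tensor product coaction. -/
lemma isComoduleHom_mul_adR :
    IsComoduleHom (mulCo (rgt (coL k A)) (mulCo (lft (adR k A)) (rgt (coR k A)))) (adR k A)
      (LinearMap.mul' k A) := by
  have h := (isComoduleHom_mul_coL (k := k) (A := A)).mulCo isComoduleHom_mul_coR
  rw [← adR_eq, mulCo_assoc, ← mulCo_assoc (lft (coL k A)), ← lft_mulCo, ← adR_eq] at h
  exact h

/-- The twist R(ad₁, l₂) turns ad₁ l₂ r₂ into l₂ ad₁ r₂, the order that the ordinary product
requires; this is the reason for the twist. -/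
lemma isComoduleHom_transMul (hR : IsCoquasitriangular R) :
    IsComoduleHom (mulCo (lft (adR k A)) (rgt (adR k A))) (adR k A) (transMul R) := by
  rw [transMul_eq]
  refine isComoduleHom_mul_adR.comp ?_
  have h1 := isComoduleHom_Rop_mulCo hR (comm_lft_rgt (adR k A) (coL k A))
    isRightComodule_adR.lft isRightComodule_coL.rgt
  have h2 : IsComoduleHom (rgt (coR k A)) (rgt (coR k A))
      (Rop R (lft (adR k A)) (rgt (coL k A))) :=
    isComoduleHom_Rop R (Commutes.out) (Commutes.out)
  have h3 := h1.mulCo h2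
  rw [mulCo_assoc, mulCo_assoc, ← rgt_mulCo, ← adR_eq] at h3
  exact h3

/-- Past the products, the two sides carry R(l₂, l₃) R(ad₁, l₃) R(r₂, l₃) R(ad₁, l₂) and R(ad₁, l₂)
R(ad₁, l₃) R(l₂, l₃) R(r₂, l₃). They agree by Yang–Baxter for ad₁, l₂, l₃ and because R(r₂, l₃)
commutes with R(ad₁, l₂). -/
lemma transMul_assoc (hR : IsCoquasitriangular R) :
    transMul R ∘ₗ TensorProduct.map (transMul R) (LinearMap.id : A →ₗ[k] A) =
      transMul R ∘ₗ TensorProduct.map (LinearMap.id : A →ₗ[k] A) (transMul R) ∘ₗ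
        (TensorProduct.assoc k A A A).toLinearMap := by
  refine LinearMap.ext fun x => ?_
  have hm (y : (A ⊗[k] A) ⊗[k] A) : LinearMap.mul' k A (TensorProduct.map LinearMap.id
      (LinearMap.mul' k A) (TensorProduct.assoc k A A A y)) =
      LinearMap.mul' k A (TensorProduct.map (LinearMap.mul' k A) LinearMap.id y) := by
    refine LinearMap.congr_fun (?_ : LinearMap.mul' k A ∘ₗ TensorProduct.map LinearMap.id
      (LinearMap.mul' k A) ∘ₗ (TensorProduct.assoc k A A A).toLinearMap =
      LinearMap.mul' k A ∘ₗ TensorProduct.map (LinearMap.mul' k A) LinearMap.id) y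
    ext; simp [mul_assoc]
  simp only [transMul_eq, LinearMap.comp_apply, LinearEquiv.coe_coe]
  rw [map_Rop_left, map_Rop_right,
    Rop_natural_apply R (isComoduleHom_mul_adR.map_lft LinearMap.id)
      ((IsComoduleHom.id (coL k A)).map_rgt _),
    Rop_natural_apply R ((IsComoduleHom.id (adR k A)).map_lft _)
      (isComoduleHom_mul_coL.map_rgt LinearMap.id)]
  rw [rgt_mulCo, lft_mulCo, lft_mulCo, Rop_mulCo_left_apply hR, Rop_mulCo_left_apply hR,
    Rop_mulCo_right_apply hR]
  have n (y) := Rop_natural_apply R (isComoduleHom_assoc₁ A A A (adR k A))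
    (isComoduleHom_assoc₂ A A A (coL k A)) y
  have n2 (y) := Rop_natural_apply R (isComoduleHom_assoc₁ A A A (adR k A))
    (isComoduleHom_assoc₃ A A A (coL k A)) y
  have n3 (y) := Rop_natural_apply R (isComoduleHom_assoc₂ A A A (adR k A))
    (isComoduleHom_assoc₃ A A A (coL k A)) y
  simp only [LinearEquiv.coe_coe] at n n2 n3
  rw [n3, n2, n, hm]
  congr 2
  have e : (lft (rgt (adR k A)) : (A ⊗[k] A) ⊗[k] A →ₗ[k] _) =
      mulCo (lft (rgt (coL k A))) (lft (rgt (coR k A))) := by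
    rw [adR_eq, rgt_mulCo, lft_mulCo]
  rw [e, Rop_mulCo_left_apply hR, yang_baxter_apply hR,
    Rop_comm_apply R R (lft (rgt (coR k A))) (rgt (coL k A))]

lemma isComoduleHom_unit : IsComoduleHom (unitCoaction k A) (adR k A) (Algebra.linearMap k A) := by
  rw [IsComoduleHom]
  ext
  simp [adR_one, unitCoaction]

lemma transMul_one_left (hR : IsCoquasitriangular R) (a : A) : transMul R (1 ⊗ₜ a) = a := by
  have h : Rop R (lft (adR k A)) (rgt (coL k A)) ∘ₗ TensorProduct.mk k A A 1 =
      TensorProduct.mk k A A 1 ∘ₗ Rop R triv (coL k A) := by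
    refine Rop_natural R ?_ (isComoduleHom_mk_rgt _ _)
    rw [IsComoduleHom]
    ext b
    simp [lft, adR_one]
  have h' := LinearMap.congr_fun h a
  simp only [LinearMap.comp_apply, Rop_triv_left_apply hR, TensorProduct.mk_apply] at h'
  rw [transMul_eq, LinearMap.comp_apply, h']
  simp

lemma transMul_one_right (hR : IsCoquasitriangular R) (a : A) : transMul R (a ⊗ₜ 1) = a := by
  have h : Rop R (lft (adR k A)) (rgt (coL k A)) ∘ₗ (TensorProduct.mk k A A).flip 1 =
      (TensorProduct.mk k A A).flip 1 ∘ₗ Rop R (adR k A) triv := by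
    refine Rop_natural R (isComoduleHom_mk_lft _ _) ?_
    rw [IsComoduleHom]
    ext b
    simp [rgt, coL_one]
  have h' := LinearMap.congr_fun h a
  simp only [LinearMap.comp_apply, Rop_triv_right_apply hR, flip_apply,
    TensorProduct.mk_apply] at h'
  rw [transMul_eq, LinearMap.comp_apply, h']
  simp

lemma isAlgebraIn_trans (hR : IsCoquasitriangular R) :
    IsAlgebraIn (adR k A) (transMul R) (Algebra.linearMap k A) where
  comodule := isRightComodule_adR
  mul_hom := by rw [tensorCoaction_eq]; exact isComoduleHom_transMul hR
  unit_hom := isComoduleHom_unit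
  assoc := transMul_assoc hR
  unit_left := by ext a; simp [transMul_one_left hR]
  unit_right := by ext a; simp [transMul_one_right hR]

/-- The coproduct carries l to l₁ and r to r₂. Inserting the trivial inner product r₁ l₂ completes
them to ad₁ ad₂. -/
lemma isComoduleHom_comul_adR :
    IsComoduleHom (adR k A) (mulCo (lft (adR k A)) (rgt (adR k A))) (coR k A) := by
  have h1 : IsComoduleHom (coL k A) (lft (coL k A)) (coR k A) := comm_coL_coR
  have h := h1.mulCo (isComoduleHom_comul_triv.mulCo isComoduleHom_coR_rgt)
  rw [triv_mulCo, ← adR_eq, mulCo_assoc, ← rgt_mulCo, ← adR_eq, ← mulCo_assoc, ← lft_mulCo,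
    ← adR_eq] at h
  exact h

lemma isCoalgebraIn_trans : IsCoalgebraIn (adR k A) (Coalgebra.comul (R := k) (A := A))
    Coalgebra.counit where
  comodule := isRightComodule_adR
  comul_hom := by rw [tensorCoaction_eq]; exact isComoduleHom_comul_adR
  counit_hom := isComoduleHom_counit_adR
  coassoc := Coalgebra.coassoc
  counit_left := by
    ext a
    have := Coalgebra.rTensor_counit_comul (R := k) a
    simp only [LinearMap.rTensor] at this
    simp [this]
  counit_right := isRightComodule_coR.counit

lemma isComoduleHom_coL_comul : IsComoduleHom (coL k A) (lft (coL k A)) (coR k A) := comm_coL_coR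

lemma lft_triv : lft (triv : X →ₗ[k] X ⊗[k] A) = (triv : X ⊗[k] Y →ₗ[k] _) := by
  ext; simp [lft]

lemma rgt_triv : rgt (triv : Y →ₗ[k] Y ⊗[k] A) = (triv : X ⊗[k] Y →ₗ[k] _) := by
  ext; simp [rgt]

/-- The composite is R(τ, r l) for the inner coactions of a coproduct, and their product r l is
trivial there. -/
lemma Rop_comul_cancel_right (hR : IsCoquasitriangular R) (τ : X →ₗ[k] X ⊗[k] A) [IsCoaction τ]
    (x : X ⊗[k] A) :
    Rop R (lft τ) (rgt (rgt (coL k A))) (Rop R (lft τ) (rgt (lft (coR k A)))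
      (TensorProduct.map LinearMap.id (coR k A) x)) =
    TensorProduct.map LinearMap.id (coR k A) x := by
  rw [← Rop_mulCo_right_apply hR, ← rgt_mulCo,
    Rop_natural_apply R ((IsComoduleHom.id τ).map_lft (coR k A))
      (isComoduleHom_comul_triv.map_rgt LinearMap.id), rgt_triv, Rop_triv_right_apply hR]

lemma Rop_comul_cancel_left (hR : IsCoquasitriangular R) (τ : Y →ₗ[k] Y ⊗[k] A) [IsCoaction τ]
    (x : A ⊗[k] Y) :
    Rop R (lft (lft (coR k A))) (rgt τ) (Rop R (lft (rgt (coL k A))) (rgt τ)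
      (TensorProduct.map (coR k A) LinearMap.id x)) =
    TensorProduct.map (coR k A) LinearMap.id x := by
  rw [← Rop_mulCo_left_apply hR, ← lft_mulCo,
    Rop_natural_apply R (isComoduleHom_comul_triv.map_lft LinearMap.id)
      ((IsComoduleHom.id τ).map_rgt (coR k A)), lft_triv, Rop_triv_left_apply hR]

/-- Number the factors of Δa ⊗ Δb from 1 to 4. The left side carries R(ad₁, l₃) R(ad₂, l₃), the
right side R(ad₁, l₃) R(ad₂, l₄) R(ad₂, ad₃). Since R(ad₂, ad₃) = R(ad₂, r₃) R(ad₂, l₃), the surplus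
R(ad₂, l₄) R(ad₂, r₃) cancels on Δb. -/
lemma comul_transMul (hR : IsCoquasitriangular R) :
    Coalgebra.comul ∘ₗ transMul R = TensorProduct.map (transMul R) (transMul R) ∘ₗ
      middle (braiding R (adR k A) (adR k A)) ∘ₗ
        TensorProduct.map Coalgebra.comul Coalgebra.comul := by
  refine LinearMap.ext fun x => ?_
  have hm (y : A ⊗[k] A) : Coalgebra.comul (R := k) (LinearMap.mul' k A y) =
      TensorProduct.map (LinearMap.mul' k A) (LinearMap.mul' k A)
        (TensorProduct.tensorTensorTensorComm k A A A A
          (TensorProduct.map (coR k A) (coR k A) y)) := by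
    induction y using TensorProduct.induction_on with
    | zero => simp
    | add x y hx hy => simp only [map_add, hx, hy]
    | tmul x y =>
      simp only [LinearMap.mul'_apply, Bialgebra.comul_mul, TensorProduct.map_tmul, coR]
      generalize (Coalgebra.comul x : A ⊗[k] A) = s
      generalize (Coalgebra.comul y : A ⊗[k] A) = t
      induction s using TensorProduct.induction_on with
      | zero => simp
      | add x y hx hy => simp only [map_add, add_tmul, add_mul, hx, hy]
      | tmul c d =>
        induction t using TensorProduct.induction_on with
        | zero => simp
        | add x y hx hy => simp only [map_add, tmul_add, mul_add, hx, hy]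
        | tmul e f => simp
  rw [middle_braiding, transMul_eq]
  simp only [LinearMap.comp_apply, LinearEquiv.coe_coe, hm]
  rw [map_Rop_left, map_Rop_right]
  rw [← Rop_natural_apply R (isComoduleHom_comul_adR.map_lft (coR k A))
    (isComoduleHom_coL_comul.map_rgt (coR k A))]
  have n1 (y) := Rop_natural_apply R (isComoduleHom_ttt₁ A A A A (adR k A))
    (isComoduleHom_ttt₃ A A A A (coL k A)) y
  have n2 (y) := Rop_natural_apply R (isComoduleHom_ttt₂ A A A A (adR k A))
    (isComoduleHom_ttt₄ A A A A (coL k A)) y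
  simp only [LinearEquiv.coe_coe] at n1 n2
  rw [n1, n2]
  congr 2
  have e : (rgt (lft (adR k A)) : (A ⊗[k] A) ⊗[k] (A ⊗[k] A) →ₗ[k] _) =
      mulCo (rgt (lft (coL k A))) (rgt (lft (coR k A))) := by
    rw [adR_eq, lft_mulCo, rgt_mulCo]
  have hx : TensorProduct.map (coR k A) (coR k A) x = TensorProduct.map LinearMap.id (coR k A)
      (TensorProduct.map (coR k A) LinearMap.id x) := by
    rw [← LinearMap.comp_apply, ← TensorProduct.map_comp]; simp
  rw [lft_mulCo, Rop_mulCo_left_apply hR, Rop_comm_apply R R (lft (rgt (adR k A)))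
    (rgt (rgt (coL k A))), e, Rop_mulCo_right_apply hR, hx,
    Rop_natural_apply R ((IsComoduleHom.id (rgt (adR k A))).map_lft (coR k A))
      (isComoduleHom_coL_comul.map_rgt LinearMap.id), Rop_comul_cancel_right hR]

lemma counit_transMul (hR : IsCoquasitriangular R) :
    Coalgebra.counit ∘ₗ transMul R =
      LinearMap.mul' k k ∘ₗ TensorProduct.map (Coalgebra.counit (R := k) (A := A))
        Coalgebra.counit := by
  have h1 : Coalgebra.counit ∘ₗ LinearMap.mul' k A = LinearMap.mul' k k ∘ₗ TensorProduct.map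
      (Coalgebra.counit (R := k) (A := A)) Coalgebra.counit := by ext; simp
  have h2 : TensorProduct.map (Coalgebra.counit (R := k) (A := A)) (LinearMap.id : A →ₗ[k] A) ∘ₗ
      Rop R (lft (adR k A)) (rgt (coL k A)) =
      TensorProduct.map Coalgebra.counit (LinearMap.id : A →ₗ[k] A) := by
    rw [← Rop_natural R (isComoduleHom_counit_adR.map_lft (LinearMap.id : A →ₗ[k] A))
      ((IsComoduleHom.id (coL k A)).map_rgt (Coalgebra.counit (R := k) (A := A))), lft_triv,
      Rop_triv_left hR isRightComodule_coL.rgt, LinearMap.id_comp]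
  have h3 : LinearMap.mul' k k ∘ₗ TensorProduct.map
      (Coalgebra.counit (R := k) (A := A)) Coalgebra.counit =
      (LinearMap.mul' k k ∘ₗ TensorProduct.map (LinearMap.id : k →ₗ[k] k)
        (Coalgebra.counit (R := k) (A := A))) ∘ₗ
      TensorProduct.map (Coalgebra.counit (R := k) (A := A)) (LinearMap.id : A →ₗ[k] A) := by
    ext; simp
  rw [transMul_eq, ← LinearMap.comp_assoc, h1, h3, LinearMap.comp_assoc, h2]

lemma isBialgebraIn_trans (hR : IsCoquasitriangular R) :
    IsBialgebraIn R (adR k A) (transMul R) (Algebra.linearMap k A)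
      Coalgebra.comul Coalgebra.counit where
  algebra := isAlgebraIn_trans hR
  coalgebra := isCoalgebraIn_trans
  comul_mul := comul_transMul hR
  comul_unit := by simp [Algebra.TensorProduct.one_def]
  counit_mul := counit_transMul hR
  counit_unit := by simp

/-! ### The braided antipode -/

lemma isComoduleHom_counitR (ρ : X →ₗ[k] X ⊗[k] A) : IsComoduleHom (lft ρ) ρ (counitR k A X) :=
  isComoduleHom_slice _ ρ

lemma isComoduleHom_counitL (ρ : X →ₗ[k] X ⊗[k] A) : IsComoduleHom (rgt ρ) ρ (counitL k A X) :=
  isComoduleHom_lid _ ρ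

lemma isComoduleHom_counitR_triv :
    IsComoduleHom (rgt (adR k A)) (triv : X →ₗ[k] X ⊗[k] A) (counitR k A X) := by
  have h := (isComoduleHom_counit_adR (k := k) (A := A)).map_rgt (LinearMap.id : X →ₗ[k] X)
  rw [rgt_triv] at h
  refine IsComoduleHom.comp (σ := (triv : X ⊗[k] k →ₗ[k] (X ⊗[k] k) ⊗[k] A)) ?_ h
  rw [IsComoduleHom]
  ext; simp

lemma isComoduleHom_counitL_triv :
    IsComoduleHom (lft (adR k A)) (triv : X →ₗ[k] X ⊗[k] A) (counitL k A X) := by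
  have h := (isComoduleHom_counit_adR (k := k) (A := A)).map_lft (LinearMap.id : X →ₗ[k] X)
  rw [lft_triv] at h
  refine IsComoduleHom.comp (σ := (triv : k ⊗[k] X →ₗ[k] (k ⊗[k] X) ⊗[k] A)) ?_ h
  rw [IsComoduleHom]
  ext; simp

variable (k A) in
/-- The map `a ↦ S a₁ ⊗ a₂`. -/
def antipodeComul : A →ₗ[k] A ⊗[k] A :=
  TensorProduct.map (HopfAlgebra.antipode k) LinearMap.id ∘ₗ coR k A

lemma transAntipode_eq' : transAntipode R = counitR k A A ∘ₗ
    Rop R (lft (adR k A)) (rgt (coR k A)) ∘ₗ antipodeComul k A := transAntipode_eq R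

lemma isComoduleHom_antipodeComul_coL :
    IsComoduleHom (coL k A) (lft (coR k A)) (antipodeComul k A) :=
  (isComoduleHom_antipode.map_lft LinearMap.id).comp isComoduleHom_coL_comul

lemma isComoduleHom_antipodeComul_coR :
    IsComoduleHom (coR k A) (rgt (coR k A)) (antipodeComul k A) :=
  ((IsComoduleHom.id _).map_rgt _).comp isComoduleHom_coR_rgt

lemma isComoduleHom_antipodeComul_triv :
    IsComoduleHom triv (mulCo (rgt (coL k A)) (lft (coL k A))) (antipodeComul k A) :=
  isComoduleHom_antipode_comul_triv

/-- On S a₁ ⊗ a₂ the trivial product l₂ l₁ completes the legs r₁ r₂ of ad to l₂ ad₁ r₂. The operator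
R(ad₁, r₂) reorders this to l₂ r₂ ad₁ = ad₂ ad₁, and the counit of factor 2 leaves ad₁. -/
lemma isComoduleHom_transAntipode (hR : IsCoquasitriangular R) :
    IsComoduleHom (adR k A) (adR k A) (transAntipode R) := by
  have h1 : IsComoduleHom (mulCo (rgt (adR k A)) (lft (adR k A))) (adR k A) (counitR k A A) := by
    have := isComoduleHom_counitR_triv.mulCo (isComoduleHom_counitR (adR k A))
    rwa [triv_mulCo] at this
  have h2 : IsComoduleHom (mulCo (rgt (coL k A)) (mulCo (lft (adR k A)) (rgt (coR k A))))
      (mulCo (rgt (adR k A)) (lft (adR k A))) (Rop R (lft (adR k A)) (rgt (coR k A))) := by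
    have h : IsComoduleHom (rgt (coL k A)) (rgt (coL k A))
        (Rop R (lft (adR k A)) (rgt (coR k A))) := isComoduleHom_Rop R Commutes.out Commutes.out
    have := h.mulCo (isComoduleHom_Rop_mulCo hR (comm_lft_rgt (adR k A) (coR k A))
      isRightComodule_adR.lft isRightComodule_coR.rgt)
    rwa [← mulCo_assoc _ _ (lft (adR k A)), ← rgt_mulCo, ← adR_eq] at this
  have h3 : IsComoduleHom (adR k A)
      (mulCo (rgt (coL k A)) (mulCo (lft (adR k A)) (rgt (coR k A)))) (antipodeComul k A) := by
    have := isComoduleHom_antipodeComul_triv.mulCo (isComoduleHom_antipodeComul_coL.mulCo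
      (isComoduleHom_antipodeComul_coR (k := k) (A := A)))
    rwa [triv_mulCo, ← adR_eq, mulCo_assoc, ← mulCo_assoc (lft (coL k A)), ← lft_mulCo,
      ← adR_eq] at this
  rw [transAntipode_eq']
  exact h1.comp (h2.comp h3)

lemma mul_antipodeComul (a : A) : LinearMap.mul' k A (antipodeComul k A a) =
    algebraMap k A (Coalgebra.counit a) :=
  HopfAlgebra.mul_antipode_rTensor_comul_apply a

lemma counitR_comul (a : A) : counitR k A A (coR k A a) = a :=
  isRightComodule_coR.slice_counit a

lemma counitL_comul (a : A) : counitL k A A (coR k A a) = a :=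
  LinearMap.congr_fun isCoalgebraIn_trans.counit_left a

/-- On S a₁ ⊗ a₂ ⊗ a₃ the operator R(ad₁, r₂) of the antipode and R(ad₁, l₃) of the product cancel,
because factors 2 and 3 form a coproduct. What remains is S a₁ · a₂. -/
lemma transMul_transAntipode_left (hR : IsCoquasitriangular R) :
    transMul R ∘ₗ TensorProduct.map (transAntipode R) (LinearMap.id : A →ₗ[k] A) ∘ₗ
      Coalgebra.comul = Algebra.linearMap k A ∘ₗ Coalgebra.counit := by
  ext a
  have e1 : TensorProduct.map (transAntipode R) (LinearMap.id : A →ₗ[k] A) (coR k A a) =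
      TensorProduct.map (counitR k A A) LinearMap.id (Rop R (lft (lft (adR k A)))
        (lft (rgt (coR k A))) (TensorProduct.map (antipodeComul k A) LinearMap.id (coR k A a))) := by
    rw [transAntipode_eq', Rop_lft]
    simp [TensorProduct.map_map]
  have e2 : TensorProduct.map (antipodeComul k A) LinearMap.id (coR k A a) =
      (TensorProduct.assoc k A A A).symm
        (TensorProduct.map LinearMap.id (coR k A) (antipodeComul k A a)) := by
    have h := LinearMap.congr_fun (coR_coassoc (k := k) (A := A)) a
    have h' : TensorProduct.map (antipodeComul k A) LinearMap.id (coR k A a) =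
        TensorProduct.map (TensorProduct.map (HopfAlgebra.antipode k) LinearMap.id) LinearMap.id
          (TensorProduct.map (coR k A) LinearMap.id (coR k A a)) := by
      simp [TensorProduct.map_map, antipodeComul]
    rw [LinearMap.comp_apply] at h
    rw [h', h]
    simp only [antipodeComul, LinearMap.comp_apply, LinearEquiv.coe_coe]
    generalize coR k A a = t
    induction t using TensorProduct.induction_on with
    | zero => simp
    | add x y hx hy => simp only [map_add, hx, hy]
    | tmul x b =>
      simp only [TensorProduct.map_tmul, LinearMap.id_apply]
      generalize coR k A b = t
      induction t using TensorProduct.induction_on with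
      | zero => simp
      | add x y hx hy => simp only [map_add, tmul_add, hx, hy]
      | tmul x b => simp
  have n1 (y) := Rop_natural_apply R (isComoduleHom_assoc₁ A A A (adR k A)).symm
    (isComoduleHom_assoc₂ A A A (coR k A)).symm y
  have n2 (y) := Rop_natural_apply R (isComoduleHom_assoc₁ A A A (adR k A)).symm
    (isComoduleHom_assoc₃ A A A (coL k A)).symm y
  simp only [LinearEquiv.coe_coe] at n1 n2
  change transMul R (TensorProduct.map (transAntipode R) (LinearMap.id : A →ₗ[k] A) (coR k A a)) = _
  rw [e1, transMul_eq, LinearMap.comp_apply, Rop_natural_apply R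
    ((isComoduleHom_counitR (adR k A)).map_lft LinearMap.id)
    ((IsComoduleHom.id (coL k A)).map_rgt _), e2, n1, n2, Rop_comul_cancel_right hR]
  have e3 (y : A ⊗[k] A) : TensorProduct.map (counitR k A A) LinearMap.id
      ((TensorProduct.assoc k A A A).symm (TensorProduct.map LinearMap.id (coR k A) y)) = y := by
    induction y using TensorProduct.induction_on with
    | zero => simp
    | add x y hx hy => simp only [map_add, hx, hy]
    | tmul x b =>
      have hb := counitL_comul (k := k) b
      conv_rhs => rw [← hb]
      simp only [TensorProduct.map_tmul, LinearMap.id_apply]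
      generalize coR k A b = t
      induction t using TensorProduct.induction_on with
      | zero => simp
      | add x y hx hy => simp only [map_add, tmul_add, hx, hy]
      | tmul x b => simp [counitL, counitR, TensorProduct.smul_tmul]
  rw [e3, mul_antipodeComul]
  rfl

/-- `Rop_natural_apply` for a map that is compatible with the second coaction at one element. -/
lemma Rop_natural_at (F : A ⊗[k] A →ₗ[k] k) {ρ σ : X →ₗ[k] X ⊗[k] A} {ρ' σ' : Y →ₗ[k] Y ⊗[k] A}
    {f : X →ₗ[k] Y} (hρ : IsComoduleHom ρ ρ' f) {x : X}
    (hσ : σ' (f x) = TensorProduct.map f LinearMap.id (σ x)) :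
    Rop F ρ' σ' (f x) = f (Rop F ρ σ x) := by
  simp only [Rop, act, pair, LinearMap.comp_apply, hσ, LinearEquiv.coe_coe]
  generalize σ x = t
  induction t using TensorProduct.induction_on with
  | zero => simp
  | add x y hx hy => simp only [map_add, hx, hy]
  | tmul x a =>
    simp only [TensorProduct.map_tmul, hρ.apply, LinearMap.id_apply]
    generalize ρ x = t
    induction t using TensorProduct.induction_on with
    | zero => simp
    | add x y hx hy => simp only [map_add, add_tmul, hx, hy]
    | tmul x a => simp

lemma mulCo_comp_of_triv {ρ σ : X →ₗ[k] X ⊗[k] A} (h : Comm ρ σ) {f : Y →ₗ[k] X}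
    (hf : IsComoduleHom triv ρ f) : mulCo ρ σ ∘ₗ f = σ ∘ₗ f := by
  ext y
  rw [mulCo, h.pair_eq]
  simp only [LinearMap.comp_apply, pair, hf.apply, triv_apply, TensorProduct.map_tmul,
    LinearMap.id_apply, LinearEquiv.coe_coe]
  generalize σ (f y) = t
  induction t using TensorProduct.induction_on with
  | zero => simp
  | add x y hx hy => simp only [map_add, add_tmul, hx, hy]
  | tmul x a => simp

lemma Rop_lft_adR (hR : IsCoquasitriangular R) (τ : Y →ₗ[k] Y ⊗[k] A) [h : IsCoaction τ] :
    Rop R (lft (adR k A)) (rgt τ) = Rop R (lft (coL k A)) (rgt τ) ∘ₗ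
      Rop R (lft (coR k A)) (rgt τ) := by
  have e : (lft (adR k A) : A ⊗[k] Y →ₗ[k] _) = mulCo (lft (coL k A)) (lft (coR k A)) := by
    rw [adR_eq, lft_mulCo]
  rw [e]
  exact Rop_mulCo_left hR (comm_lft_rgt _ _) (comm_lft_rgt _ _) h.out.rgt

/-- Here the product twists with the l-leg of a value of the braided antipode. This leg is
identified with the r-leg of the last factor of a₁ ⊗ S a₂ ⊗ a₃, after which all operators pair a
coaction on the first two factors with r₃ and collapse, since a₁ ⊗ S a₂ has trivial r₁ r₂ and
multiplies to a scalar. -/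
lemma transMul_transAntipode_right (hR : IsCoquasitriangular R) :
    transMul R ∘ₗ TensorProduct.map (LinearMap.id : A →ₗ[k] A) (transAntipode R) ∘ₗ
      Coalgebra.comul = Algebra.linearMap k A ∘ₗ Coalgebra.counit := by
  let T := antipodeComul k A
  -- R(ad₁, r₂) is split as R(l₁, r₂) R(r₁, r₂): the second operator goes into `T'`, the first into
  -- `E`.
  let T' := Rop R (lft (coR k A)) (rgt (coR k A)) ∘ₗ T
  let E := counitR k A A ∘ₗ Rop R (lft (coL k A)) (rgt (coR k A))
  have hS : transAntipode R = E ∘ₗ T' := by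
    rw [transAntipode_eq', Rop_lft_adR hR, LinearMap.comp_assoc, LinearMap.comp_assoc]
  have hT' : IsComoduleHom triv (mulCo (rgt (coL k A)) (lft (coL k A))) T' :=
    (isComoduleHom_Rop R Commutes.out Commutes.out).comp isComoduleHom_antipodeComul_triv
  have hE : IsComoduleHom (mulCo (mulCo (rgt (coL k A)) (lft (coL k A))) (rgt (coR k A)))
      (coL k A) E := by
    have h1 := isComoduleHom_counitR_triv.mulCo (isComoduleHom_counitR (coL k A))
    rw [triv_mulCo] at h1
    have h2 : IsComoduleHom (rgt (coL k A)) (rgt (coL k A))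
      (Rop R (lft (coL k A)) (rgt (coR k A))) := isComoduleHom_Rop R Commutes.out Commutes.out
    have h3 := h2.mulCo (isComoduleHom_Rop_mulCo hR (comm_lft_rgt (coL k A) (coR k A))
      isRightComodule_coL.lft isRightComodule_coR.rgt)
    rw [← mulCo_assoc, ← mulCo_assoc, ← rgt_mulCo, ← adR_eq] at h3
    exact h1.comp h3
  -- `E` carries (l₂ l₁) r₂ to l, and l₂ l₁ is trivial on the image of `T'`, so only r₂ is left.
  have hET : coL k A ∘ₗ E ∘ₗ T' = TensorProduct.map E LinearMap.id ∘ₗ rgt (coR k A) ∘ₗ T' := by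
    rw [← LinearMap.comp_assoc, hE, LinearMap.comp_assoc, mulCo_comp_of_triv Commutes.out hT']
  ext a
  -- `P` is a ↦ a₁ ⊗ S a₂; r on S a₂ comes from l on a₂, so r₁ r₂ is trivial on it.
  let P := TensorProduct.map LinearMap.id (HopfAlgebra.antipode k) ∘ₗ coR k A
  have hP : IsComoduleHom triv (mulCo (lft (coR k A)) (rgt (coR k A))) P :=
    (((IsComoduleHom.id (coR k A)).map_lft _).mulCo
      (isComoduleHom_antipode.map_rgt LinearMap.id)).comp isComoduleHom_comul_triv
  have hPm : LinearMap.mul' k A ∘ₗ P = Algebra.linearMap k A ∘ₗ Coalgebra.counit :=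
    LinearMap.ext fun a => HopfAlgebra.mul_antipode_lTensor_comul_apply a
  have hY : TensorProduct.map LinearMap.id T (coR k A a) =
      TensorProduct.assoc k A A A (TensorProduct.map P LinearMap.id (coR k A a)) := by
    have h := LinearMap.congr_fun (isRightComodule_coR (k := k) (A := A)).coassoc a
    have h1 : TensorProduct.map LinearMap.id T (coR k A a) =
        TensorProduct.map LinearMap.id (TensorProduct.map (HopfAlgebra.antipode k) LinearMap.id)
          (TensorProduct.map LinearMap.id (coR k A) (coR k A a)) := by
      simp [TensorProduct.map_map, T, antipodeComul]
    simp only [LinearMap.comp_apply, LinearEquiv.coe_coe] at h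
    rw [h1, ← h]
    simp only [P]
    generalize coR k A a = t
    induction t using TensorProduct.induction_on with
    | zero => simp
    | add x y hx hy => simp only [map_add, hx, hy]
    | tmul b x =>
      simp only [TensorProduct.map_tmul, LinearMap.id_apply, LinearMap.comp_apply]
      generalize coR k A b = t
      induction t using TensorProduct.induction_on with
      | zero => simp
      | add x y hx hy => simp only [map_add, add_tmul, hx, hy]
      | tmul x b => simp
  have h1 : TensorProduct.map LinearMap.id (transAntipode R) (coR k A a) =
      TensorProduct.map LinearMap.id E (TensorProduct.map LinearMap.id T' (coR k A a)) := by
    rw [hS]; simp [TensorProduct.map_map]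
  have h2 : TensorProduct.map LinearMap.id T' (coR k A a) =
      Rop R (rgt (lft (coR k A))) (rgt (rgt (coR k A)))
        (TensorProduct.map LinearMap.id T (coR k A a)) := by
    rw [Rop_rgt]; simp [TensorProduct.map_map, T']
  have h3 (z : A ⊗[k] A) : rgt (coL k A) (TensorProduct.map LinearMap.id E
      (TensorProduct.map LinearMap.id T' z)) = TensorProduct.map (TensorProduct.map LinearMap.id E)
      LinearMap.id (rgt (rgt (coR k A)) (TensorProduct.map LinearMap.id T' z)) := by
    induction z using TensorProduct.induction_on with
    | zero => simp
    | add x y hx hy => simp only [map_add, hx, hy]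
    | tmul b x =>
      have := LinearMap.congr_fun hET x
      simp only [LinearMap.comp_apply] at this
      simp only [TensorProduct.map_tmul, LinearMap.id_apply]
      rw [rgt, rgt]
      simp only [TensorProduct.map_tmul, LinearMap.id_apply, LinearMap.comp_apply, this]
      generalize rgt (coR k A) (T' x) = t
      induction t using TensorProduct.induction_on with
      | zero => simp
      | add x y hx hy => simp only [map_add, tmul_add, hx, hy]
      | tmul x b => simp
  -- R(r₁, r₃) R(r₂, r₃) is the operator of r₁ r₂ against r₃, hence trivial on a₁ ⊗ S a₂ ⊗ a₃.
  have h4 : Rop R (lft (coR k A)) (rgt (rgt (coR k A)))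
      (Rop R (rgt (lft (coR k A))) (rgt (rgt (coR k A)))
        (TensorProduct.map LinearMap.id T (coR k A a))) =
      TensorProduct.map LinearMap.id T (coR k A a) := by
    rw [← Rop_mulCo_left_apply hR, hY]
    have i1 := hP.map_lft (LinearMap.id : A →ₗ[k] A)
    rw [lft_mulCo, lft_triv] at i1
    have := Rop_natural_apply R (((isComoduleHom_assoc₁ A A A (coR k A)).mulCo
      (isComoduleHom_assoc₂ A A A (coR k A))).comp i1)
      ((isComoduleHom_assoc₃ A A A (coR k A)).comp ((IsComoduleHom.id (coR k A)).map_rgt P))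
      (coR k A a)
    rw [Rop_triv_left_apply hR] at this
    exact this
  -- The two l-operators join to that of l₂ l₁, which is the l-coaction of the product a₁ · S a₂, a
  -- scalar.
  have h5 : Rop R (rgt (lft (coL k A))) (rgt (rgt (coR k A)))
      (Rop R (lft (coL k A)) (rgt (rgt (coR k A)))
        (TensorProduct.map LinearMap.id T (coR k A a))) =
      TensorProduct.assoc k A A A (Rop R (lft (mulCo (rgt (coL k A)) (lft (coL k A))))
        (rgt (coR k A)) (TensorProduct.map P LinearMap.id (coR k A a))) := by
    rw [← Rop_mulCo_left_apply hR, hY, lft_mulCo]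
    exact Rop_natural_apply R ((isComoduleHom_assoc₂ A A A (coL k A)).mulCo
      (isComoduleHom_assoc₁ A A A (coL k A))) (isComoduleHom_assoc₃ A A A (coR k A)) _
  have h6 : LinearMap.mul' k A ∘ₗ TensorProduct.map LinearMap.id (counitR k A A) ∘ₗ
      (TensorProduct.assoc k A A A).toLinearMap =
      counitR k A A ∘ₗ TensorProduct.map (LinearMap.mul' k A) LinearMap.id := by
    ext; simp [counitR]
  have h7 : TensorProduct.map (LinearMap.mul' k A) LinearMap.id
      (TensorProduct.map P LinearMap.id (coR k A a)) = 1 ⊗ₜ a := by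
    have ha := counitL_comul (k := k) a
    conv_rhs => rw [← ha]
    rw [TensorProduct.map_map, hPm]
    generalize coR k A a = t
    induction t using TensorProduct.induction_on with
    | zero => simp
    | add x y hx hy => simp only [map_add, tmul_add, hx, hy]
    | tmul x b => simp [counitL, Algebra.algebraMap_eq_smul_one, TensorProduct.smul_tmul]
  have h8 : Rop R (lft (coL k A)) (rgt (coR k A)) (1 ⊗ₜ[k] a) = 1 ⊗ₜ a := by
    have : IsComoduleHom triv (lft (coL k A)) (TensorProduct.mk k A A 1) := by
      rw [IsComoduleHom]
      ext b
      simp [lft, coL_one]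
    have := Rop_natural_apply R this (isComoduleHom_mk_rgt (coR k A) 1) a
    rwa [Rop_triv_left_apply hR] at this
  have h9 (z) := LinearMap.congr_fun h6 z
  simp only [LinearMap.comp_apply, LinearEquiv.coe_coe] at h9
  change transMul R (TensorProduct.map LinearMap.id (transAntipode R) (coR k A a)) = _
  have e : (lft (adR k A) : A ⊗[k] (A ⊗[k] A) →ₗ[k] _) =
      mulCo (lft (coL k A)) (lft (coR k A)) := by rw [adR_eq, lft_mulCo]
  -- `h3` is known only on the image of `T'`, so naturality is used at one element; ad₁ is then
  -- split into l₁ r₁.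
  rw [h1, transMul_eq, LinearMap.comp_apply,
    Rop_natural_at R ((IsComoduleHom.id (adR k A)).map_lft E) (h3 _), h2, e,
    Rop_mulCo_left_apply hR, h4, map_Rop_right, h5, h9,
    ← Rop_natural_apply R (isComoduleHom_mul_coL.map_lft LinearMap.id)
      ((IsComoduleHom.id (coR k A)).map_rgt _), h7, h8]
  simp [counitR, Algebra.algebraMap_eq_smul_one]

lemma isHopfAlgebraIn_trans (hR : IsCoquasitriangular R) :
    IsHopfAlgebraIn R (adR k A) (transMul R) (Algebra.linearMap k A)
      Coalgebra.comul Coalgebra.counit (transAntipode R) where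
  bialgebra := isBialgebraIn_trans hR
  antipode_hom := isComoduleHom_transAntipode hR
  antipode_left := transMul_transAntipode_left hR
  antipode_right := transMul_transAntipode_right hR

/-! ### The adjoint action and its associated braiding -/

variable (X Y Z) in
lemma isComoduleHom_rightComm₁ (ρ : X →ₗ[k] X ⊗[k] A) : IsComoduleHom (lft (lft ρ)) (lft (lft ρ))
    (TensorProduct.rightComm k X Y Z).toLinearMap := by
  rw [IsComoduleHom]
  ext x y z
  simp only [AlgebraTensorModule.curry_apply, curry_apply, LinearMap.coe_restrictScalars,
    LinearMap.comp_apply, TensorProduct.map_tmul, LinearMap.id_apply, LinearEquiv.coe_coe,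
    lft, TensorProduct.rightComm_tmul]
  generalize ρ x = t
  induction t using TensorProduct.induction_on with
  | zero => simp
  | add x y hx hy => simp only [map_add, add_tmul, hx, hy]
  | tmul y a => simp

variable (X Y Z) in
lemma isComoduleHom_rightComm₂ (ρ : Y →ₗ[k] Y ⊗[k] A) : IsComoduleHom (lft (rgt ρ)) (rgt ρ)
    (TensorProduct.rightComm k X Y Z).toLinearMap := by
  rw [IsComoduleHom]
  ext x y z
  simp only [AlgebraTensorModule.curry_apply, curry_apply, LinearMap.coe_restrictScalars,
    LinearMap.comp_apply, TensorProduct.map_tmul, LinearMap.id_apply, LinearEquiv.coe_coe,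
    lft, rgt, TensorProduct.rightComm_tmul]
  generalize ρ y = t
  induction t using TensorProduct.induction_on with
  | zero => simp
  | add x y hx hy => simp only [map_add, add_tmul, tmul_add, hx, hy]
  | tmul y a => simp

variable (X Y Z) in
lemma isComoduleHom_rightComm₃ (ρ : Z →ₗ[k] Z ⊗[k] A) : IsComoduleHom (rgt ρ) (lft (rgt ρ))
    (TensorProduct.rightComm k X Y Z).toLinearMap := by
  rw [IsComoduleHom]
  ext x y z
  simp only [AlgebraTensorModule.curry_apply, curry_apply, LinearMap.coe_restrictScalars,
    LinearMap.comp_apply, TensorProduct.map_tmul, LinearMap.id_apply, LinearEquiv.coe_coe,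
    lft, rgt, TensorProduct.rightComm_tmul]
  generalize ρ z = t
  induction t using TensorProduct.induction_on with
  | zero => simp
  | add x y hx hy => simp only [map_add, add_tmul, tmul_add, hx, hy]
  | tmul y a => simp

/-- The action `a ⊗ x ↦ x₀ Q(a ⊗ x₁)` on a comodule. -/
def adAct (R : A ⊗[k] A →ₗ[k] k) (ρ : X →ₗ[k] X ⊗[k] A) : A ⊗[k] X →ₗ[k] X :=
  counitL k A X ∘ₗ Rop R (rgt ρ) (lft (coR k A)) ∘ₗ Rop R (lft (coR k A)) (rgt ρ)

lemma adAct_adR (R : A ⊗[k] A →ₗ[k] k) : adAct R (adR k A) = bracket R := (bracket_eq R).symm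

lemma counitL_map (f : X →ₗ[k] Y) :
    counitL k A Y ∘ₗ TensorProduct.map LinearMap.id f = f ∘ₗ counitL k A X := by
  ext; simp [counitL]

/-- The action uses nothing but the coaction. Taking the bracket, the coproduct and the counit for
`f` gives the Jacobi identity and the two coalgebra axioms of the bracket. -/
lemma adAct_natural (R : A ⊗[k] A →ₗ[k] k) {ρ : X →ₗ[k] X ⊗[k] A} {σ : Y →ₗ[k] Y ⊗[k] A}
    {f : X →ₗ[k] Y} (hf : IsComoduleHom ρ σ f) :
    f ∘ₗ adAct R ρ = adAct R σ ∘ₗ TensorProduct.map LinearMap.id f := by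
  refine LinearMap.ext fun x => ?_
  have h1 := (IsComoduleHom.id (coR k A)).map_lft f
  have h2 := hf.map_rgt (LinearMap.id : A →ₗ[k] A)
  have h3 (y) := LinearMap.congr_fun (counitL_map (A := A) f) y
  simp only [LinearMap.comp_apply] at h3
  simp only [adAct, LinearMap.comp_apply]
  rw [Rop_natural_apply R h1 h2, Rop_natural_apply R h2 h1, h3]

/-- The two operators turn r₁ ρ₂ into ρ₂ r₁ and back, while l₁ commutes with them. So ad₁ ρ₂ is
preserved, and the counit makes ad₁ trivial. -/
lemma isComoduleHom_adAct (hR : IsCoquasitriangular R) (ρ : X →ₗ[k] X ⊗[k] A) [h : IsCoaction ρ] :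
    IsComoduleHom (mulCo (lft (adR k A)) (rgt ρ)) ρ (adAct R ρ) := by
  have c1 : Comm (lft (coR k A)) (rgt ρ) := comm_lft_rgt _ _
  have h1 := isComoduleHom_Rop_mulCo hR c1 isRightComodule_coR.lft h.out.rgt
  have h2 := isComoduleHom_Rop_mulCo hR c1.symm h.out.rgt isRightComodule_coR.lft
  have cl : Comm (lft (coL k A)) (lft (coR k A) : A ⊗[k] X →ₗ[k] _) := comm_coL_coR.lft
  have cr : Comm (lft (coL k A)) (rgt ρ) := comm_lft_rgt _ _
  have h3 := ((isComoduleHom_Rop R cr cl).comp (isComoduleHom_Rop R cl cr)).mulCo (h2.comp h1)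
  have e : (lft (adR k A) : A ⊗[k] X →ₗ[k] _) = mulCo (lft (coL k A)) (lft (coR k A)) := by
    rw [adR_eq, lft_mulCo]
  rw [← mulCo_assoc, ← e] at h3
  have h4 := (isComoduleHom_counitL_triv (k := k) (A := A) (X := X)).mulCo (isComoduleHom_counitL ρ)
  rw [triv_mulCo] at h4
  exact h4.comp h3

/-- On a coproduct r₁ l₂ is trivial, so R(τ, l₂) R(τ, r₁) is the identity there, and R(τ, r₁) can be
traded for an inverse on the other leg. -/
lemma Rop_comul_inv (hR : IsCoquasitriangular R) (τ : X →ₗ[k] X ⊗[k] A) [h : IsCoaction τ]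
    (x : A ⊗[k] X) :
    Rop R (rgt τ) (lft (lft (coR k A))) (TensorProduct.map (coR k A) LinearMap.id x) =
      Rop hR.inv (rgt τ) (lft (rgt (coL k A)))
        (TensorProduct.map (coR k A) LinearMap.id x) := by
  have h : Rop R (rgt τ) (lft (rgt (coL k A))) (Rop R (rgt τ) (lft (lft (coR k A)))
      (TensorProduct.map (coR k A) LinearMap.id x)) =
      TensorProduct.map (coR k A) LinearMap.id x := by
    rw [← Rop_mulCo_right_apply hR, ← lft_mulCo,
      Rop_natural_apply R ((IsComoduleHom.id τ).map_rgt (coR k A))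
        (isComoduleHom_comul_triv.map_lft LinearMap.id), lft_triv, Rop_triv_right_apply hR]
  rw [← Rop_inv_comp_apply hR (rgt τ) (lft (rgt (coL k A))) (Rop R (rgt τ) (lft (lft (coR k A))) _),
    h]

/-- In R(r₁, τ) R(ad₂, τ) = R(r₁, τ) R(l₂, τ) R(r₂, τ) the last operator comes from `A` before the
coproduct, and the first two cancel on its image. -/
lemma Rop_comul_adR (hR : IsCoquasitriangular R) (τ : X →ₗ[k] X ⊗[k] A) [h : IsCoaction τ]
    (x : A ⊗[k] X) :
    Rop R (lft (lft (coR k A))) (rgt τ) (Rop R (lft (rgt (adR k A))) (rgt τ)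
      (TensorProduct.map (coR k A) LinearMap.id x)) =
    TensorProduct.map (coR k A) LinearMap.id (Rop R (lft (coR k A)) (rgt τ) x) := by
  have e : (lft (rgt (adR k A)) : (A ⊗[k] A) ⊗[k] X →ₗ[k] _) =
      mulCo (lft (rgt (coL k A))) (lft (rgt (coR k A))) := by
    rw [adR_eq, rgt_mulCo, lft_mulCo]
  rw [e, Rop_mulCo_left_apply hR, Rop_natural_apply R (isComoduleHom_coR_rgt.map_lft LinearMap.id)
    ((IsComoduleHom.id τ).map_rgt (coR k A)), Rop_comul_cancel_left hR]

/-- Under the counit of factor 1 the coaction ad₁ is trivial, so R(τ, r₁) R(τ, l₁) disappears; apply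
this to a vector of the form R⁻¹(τ, l₁) x. -/
lemma counitL_Rop_inv (hR : IsCoquasitriangular R) (τ : X →ₗ[k] X ⊗[k] A) [h : IsCoaction τ]
    (x : A ⊗[k] X) :
    counitL k A X (Rop hR.inv (rgt τ) (lft (coL k A)) x) =
      counitL k A X (Rop R (rgt τ) (lft (coR k A)) x) := by
  have e : (lft (adR k A) : A ⊗[k] X →ₗ[k] _) = mulCo (lft (coL k A)) (lft (coR k A)) := by
    rw [adR_eq, lft_mulCo]
  have h1 := Rop_natural_apply R (isComoduleHom_counitL τ)
    (isComoduleHom_counitL_triv (k := k) (A := A)) (Rop hR.inv (rgt τ) (lft (coL k A)) x)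
  rw [Rop_triv_right_apply hR, e, Rop_mulCo_right_apply hR, Rop_comp_inv_apply hR] at h1
  exact h1

/-- The map `a ⊗ x ↦ a₁ ⊗ Ψ(a₂ ⊗ x)`. -/
def coBraid (R : A ⊗[k] A →ₗ[k] k) (ρ : X →ₗ[k] X ⊗[k] A) : A ⊗[k] X →ₗ[k] (A ⊗[k] X) ⊗[k] A :=
  (TensorProduct.rightComm k A A X).toLinearMap ∘ₗ Rop R (lft (rgt (adR k A))) (rgt ρ) ∘ₗ
    TensorProduct.map (coR k A) LinearMap.id

lemma map_counitL_comul (x : A ⊗[k] X) : TensorProduct.map (counitL k A A) LinearMap.id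
    (TensorProduct.map (coR k A) LinearMap.id x) = x := by
  have h : counitL k A A ∘ₗ coR k A = LinearMap.id := LinearMap.ext fun a => counitL_comul a
  rw [TensorProduct.map_map, h]
  simp

/-- The operator R(r₁, ·) of the action merges with the braiding into a single operator before the
coproduct (`Rop_comul_adR`). The other operator of the action becomes an inverse on the second leg,
which frees the first leg for the counit. -/
lemma map_adAct_coBraid (hR : IsCoquasitriangular R) (ρ : X →ₗ[k] X ⊗[k] A) [h : IsCoaction ρ]
    (x : A ⊗[k] X) :
    TensorProduct.map (adAct R ρ) LinearMap.id (coBraid R ρ x) =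
      Rop hR.inv (lft ρ) (rgt (coL k A)) (TensorProduct.comm k A X
        (Rop R (lft (coR k A)) (rgt ρ) x)) := by
  have n1 (y) := Rop_natural_apply R (isComoduleHom_rightComm₁ A A X (coR k A))
    (isComoduleHom_rightComm₃ A A X ρ) y
  have n2 (y) := Rop_natural_apply R (isComoduleHom_rightComm₃ A A X ρ)
    (isComoduleHom_rightComm₁ A A X (coR k A)) y
  have hf : (TensorProduct.map (counitL k A X) (LinearMap.id : A →ₗ[k] A)) ∘ₗ
      (TensorProduct.rightComm k A A X).toLinearMap = (TensorProduct.comm k A X).toLinearMap ∘ₗ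
        TensorProduct.map (counitL k A A) LinearMap.id := by
    ext; simp [counitL, TensorProduct.smul_tmul]
  have n3 (y) := Rop_natural_apply hR.inv
    (((isComoduleHom_counitL (A := A) ρ).map_lft (LinearMap.id : A →ₗ[k] A)).comp
      (isComoduleHom_rightComm₃ A A X ρ))
    (((IsComoduleHom.id (coL k A)).map_rgt (counitL k A X)).comp
      (isComoduleHom_rightComm₂ A A X (coL k A))) y
  rw [hf] at n3
  have hf' (y) := LinearMap.congr_fun hf y
  simp only [LinearMap.comp_apply, LinearEquiv.coe_coe] at n1 n2 n3 hf'
  rw [adAct, ← LinearMap.comp_assoc, map_Rop_left, map_Rop_left, coBraid]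
  simp only [LinearMap.comp_apply, LinearEquiv.coe_coe]
  rw [n1, n2, Rop_comul_adR hR, Rop_comul_inv hR, hf', ← n3, map_counitL_comul]

lemma lieBraiding_eq (R : A ⊗[k] A →ₗ[k] k) (br : A ⊗[k] A →ₗ[k] A) :
    lieBraiding R (adR k A) (coR k A) br =
      TensorProduct.map br LinearMap.id ∘ₗ coBraid R (adR k A) := by
  have h : (TensorProduct.assoc k A A A).symm.toLinearMap ∘ₗ TensorProduct.map LinearMap.id
      (TensorProduct.comm k A A).toLinearMap ∘ₗ (TensorProduct.assoc k A A A).toLinearMap =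
      (TensorProduct.rightComm k A A A).toLinearMap := by
    ext; simp
  refine LinearMap.ext fun x => ?_
  have h' (y) := LinearMap.congr_fun h y
  have n (y) := Rop_natural_apply R (isComoduleHom_assoc₂ A A A (adR k A))
    (isComoduleHom_assoc₃ A A A (adR k A)) y
  simp only [LinearMap.comp_apply, LinearEquiv.coe_coe] at h' n
  simp only [lieBraiding, LinearMap.comp_apply, LinearEquiv.coe_coe, braiding_eq, map_Rop_right,
    coBraid]
  rw [n, h']

/-- The inverse operator in this closed form is the one that undoes the twist of the transmuted
product. -/
lemma lieBraiding_bracket (hR : IsCoquasitriangular R) :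
    lieBraiding R (adR k A) (coR k A) (bracket R) =
      Rop hR.inv (lft (adR k A)) (rgt (coL k A)) ∘ₗ (TensorProduct.comm k A A).toLinearMap ∘ₗ
        Rop R (lft (coR k A)) (rgt (adR k A)) := by
  rw [lieBraiding_eq, ← adAct_adR]
  exact LinearMap.ext fun x => map_adAct_coBraid hR _ x

lemma Rop_rgt_adR_right (hR : IsCoquasitriangular R) (τ : X →ₗ[k] X ⊗[k] A) [h : IsCoaction τ]
    (x : X ⊗[k] A) :
    Rop R (lft τ) (rgt (adR k A)) x =
      Rop R (lft τ) (rgt (coR k A)) (Rop R (lft τ) (rgt (coL k A)) x) := by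
  have e : (rgt (adR k A) : X ⊗[k] A →ₗ[k] _) = mulCo (rgt (coL k A)) (rgt (coR k A)) := by
    rw [adR_eq, rgt_mulCo]
  rw [e, Rop_mulCo_right_apply hR]

/-- The twist of the product cancels R⁻¹(ad₁, l₂), leaving mul ∘ flip ∘ R(r₁, r₂) R(r₁, l₂).
Quasi-commutativity turns mul ∘ flip ∘ R(r₁, r₂) into mul ∘ R(l₁, l₂), and R(l₁, l₂) R(r₁, l₂) =
R(ad₁, l₂) restores the product. -/
lemma transMul_lieBraiding (hR : IsCoquasitriangular R) :
    transMul R ∘ₗ lieBraiding R (adR k A) (coR k A) (bracket R) = transMul R := by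
  refine LinearMap.ext fun x => ?_
  have h (y) := LinearMap.congr_fun hR.mul_comm_Rop y
  simp only [LinearMap.comp_apply, LinearEquiv.coe_coe] at h
  rw [lieBraiding_bracket hR, transMul_eq, Rop_lft_adR hR]
  simp only [LinearMap.comp_apply, LinearEquiv.coe_coe]
  have e := LinearMap.congr_fun (Rop_lft_adR hR (coL k A))
  simp only [LinearMap.comp_apply] at e
  rw [← e, Rop_comp_inv_apply hR, Rop_rgt_adR_right hR, h]

/-- The action uses the r-coaction of the second leg of Δa, which comes from r on a. The operators
therefore move in front of Δ, and the counit then undoes Δ. -/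
lemma map_adAct_comul (ρ : X →ₗ[k] X ⊗[k] A) (x : A ⊗[k] X) :
    TensorProduct.map LinearMap.id (adAct R ρ) (TensorProduct.assoc k A A X
      (TensorProduct.map (coR k A) LinearMap.id x)) =
    Rop R (rgt ρ) (lft (coR k A)) (Rop R (lft (coR k A)) (rgt ρ) x) := by
  have n1 (y) := Rop_natural_apply R (isComoduleHom_assoc₂ A A X (coR k A))
    (isComoduleHom_assoc₃ A A X ρ) y
  have n2 (y) := Rop_natural_apply R (isComoduleHom_assoc₃ A A X ρ)
    (isComoduleHom_assoc₂ A A X (coR k A)) y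
  have i1 := (isComoduleHom_coR_rgt (k := k) (A := A)).map_lft (LinearMap.id : X →ₗ[k] X)
  have i2 := (IsComoduleHom.id ρ).map_rgt (coR k A)
  have hc : TensorProduct.map LinearMap.id (counitL k A X) ∘ₗ
      (TensorProduct.assoc k A A X).toLinearMap = TensorProduct.map (counitR k A A)
        (LinearMap.id : X →ₗ[k] X) := by
    ext; simp [counitR, counitL, TensorProduct.smul_tmul]
  have hc' (y) := LinearMap.congr_fun hc y
  have h : counitR k A A ∘ₗ coR k A = LinearMap.id := LinearMap.ext fun a => counitR_comul a
  simp only [LinearMap.comp_apply, LinearEquiv.coe_coe] at n1 n2 hc'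
  rw [adAct, ← LinearMap.comp_assoc, map_Rop_right, map_Rop_right, n1, n2,
    Rop_natural_apply R i1 i2, Rop_natural_apply R i2 i1, hc', TensorProduct.map_map, h]
  simp

/-- Of the outer braiding R(ad₁, ad₂) = R(ad₁, r₂) R(ad₁, l₂) the half R(ad₁, l₂) cancels the
inverse in Ψ̃. After the two flips R(ad₂, r₁) R(r₁, ad₂) remains, which `map_adAct_comul`
recognises. -/
lemma isCocommutativeWrt_bracket (hR : IsCoquasitriangular R) :
    IsCocommutativeWrt R (adR k A) (coR k A) (bracket R) := by
  refine LinearMap.ext fun x => ?_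
  have h := map_adAct_comul (R := R) (adR k A) x
  rw [adAct_adR] at h
  simp only [lieBraiding_bracket hR, braiding_eq, LinearMap.comp_apply, LinearEquiv.coe_coe]
  rw [h, Rop_rgt_adR_right hR, Rop_comp_inv_apply hR]
  have n := Rop_natural_apply R (isComoduleHom_comm_lft A A (adR k A))
    (isComoduleHom_comm_rgt A A (coR k A))
    (TensorProduct.comm k A A (Rop R (lft (coR k A)) (rgt (adR k A)) x))
  simp only [LinearEquiv.coe_coe] at n
  rw [← n]
  congr 1
  generalize Rop R (lft (coR k A)) (rgt (adR k A)) x = t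
  induction t using TensorProduct.induction_on with
  | zero => simp
  | add x y hx hy => simp only [map_add, hx, hy]
  | tmul x b => simp

lemma counit_bracket (hR : IsCoquasitriangular R) : Coalgebra.counit ∘ₗ bracket R =
    LinearMap.mul' k k ∘ₗ TensorProduct.map (Coalgebra.counit (R := k) (A := A))
      Coalgebra.counit := by
  rw [← adAct_adR, adAct_natural R isComoduleHom_counit_adR, adAct, rgt_triv,
    Rop_triv_left hR isRightComodule_coR.lft, Rop_triv_right hR isRightComodule_coR.lft]
  ext; simp [counitL]

/-! ### The braided-Lie algebra of a coquasitriangular Hopf algebra -/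

lemma map_adAct_adAct (F : A ⊗[k] A →ₗ[k] k) (ρ : X →ₗ[k] X ⊗[k] A) (σ : Y →ₗ[k] Y ⊗[k] A)
    (y : (A ⊗[k] X) ⊗[k] (A ⊗[k] Y)) :
    TensorProduct.map (adAct F ρ) (adAct F σ) y =
      TensorProduct.map (counitL k A X) (counitL k A Y)
        (Rop F (lft (rgt ρ)) (lft (lft (coR k A))) (Rop F (lft (lft (coR k A))) (lft (rgt ρ))
          (Rop F (rgt (rgt σ)) (rgt (lft (coR k A))) (Rop F (rgt (lft (coR k A))) (rgt (rgt σ))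
            y)))) := by
  rw [adAct, adAct, ← LinearMap.comp_assoc, ← LinearMap.comp_assoc, map_Rop_left, map_Rop_left,
    map_Rop_right, map_Rop_right]
  rw [Rop_comm_apply F F (lft (lft (coR k A))) (lft (rgt ρ)) (rgt (rgt σ)) (rgt (lft (coR k A))),
    Rop_comm_apply F F (lft (rgt ρ)) (lft (lft (coR k A))) (rgt (rgt σ)) (rgt (lft (coR k A))),
    Rop_comm_apply F F (lft (lft (coR k A))) (lft (rgt ρ)) (rgt (lft (coR k A))) (rgt (rgt σ)),
    Rop_comm_apply F F (lft (rgt ρ)) (lft (lft (coR k A))) (rgt (lft (coR k A))) (rgt (rgt σ))]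

/-- Let 1, 2 be the factors of Δa and 3, 4 those acted on. R(r₁, ad₃) absorbs the middle braiding,
and R(ad₃, r₁) becomes R⁻¹(ad₃, l₂). Once factor 1 is removed by its counit, the counit of the
remaining factor turns this inverse back into R(ad₃, r). The result R(ad₃, r) R(ad₄, r) R(r, ad₄)
R(r, ad₃) is the action for the product coaction ad₃ ad₄. -/
lemma adAct_tensor (hR : IsCoquasitriangular R) (x : A ⊗[k] (A ⊗[k] A)) :
    TensorProduct.map (bracket R) (bracket R) (middle (braiding R (adR k A) (adR k A))
      (TensorProduct.map (coR k A) LinearMap.id x)) =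
    adAct R (mulCo (lft (adR k A)) (rgt (adR k A))) x := by
  have t1 := isComoduleHom_ttt₁ A A A A (coR k A)
  have t2 := isComoduleHom_ttt₂ A A A A (coR k A)
  have t3 := isComoduleHom_ttt₃ A A A A (adR k A)
  have t4 := isComoduleHom_ttt₄ A A A A (adR k A)
  have n1 (y) := Rop_natural_apply R t2 t4 y
  have n2 (y) := Rop_natural_apply R t4 t2 y
  have n3 (y) := Rop_natural_apply R t1 t3 y
  have n4 (y) := Rop_natural_apply R t3 t1 y
  have hf : TensorProduct.map (counitL k A A) (counitL k A A) ∘ₗ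
      (TensorProduct.tensorTensorTensorComm k A A A A).toLinearMap =
      counitL k A (A ⊗[k] A) ∘ₗ TensorProduct.map (counitL k A A) LinearMap.id := by
    ext; simp [counitL, TensorProduct.smul_tmul, smul_smul, mul_comm]
  have hf' (y) := LinearMap.congr_fun hf y
  simp only [LinearMap.comp_apply, LinearEquiv.coe_coe] at n1 n2 n3 n4 hf'
  have ce := (isComoduleHom_counitL (A := A) (coR k A)).map_lft
    (LinearMap.id : A ⊗[k] A →ₗ[k] A ⊗[k] A)
  have cl := (isComoduleHom_counitL (A := A) (coL k A)).map_lft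
    (LinearMap.id : A ⊗[k] A →ₗ[k] A ⊗[k] A)
  have cz := (IsComoduleHom.id (rgt (adR k A) : A ⊗[k] A →ₗ[k] _)).map_rgt (counitL k A A)
  have cq := (IsComoduleHom.id (lft (adR k A) : A ⊗[k] A →ₗ[k] _)).map_rgt (counitL k A A)
  rw [← adAct_adR, map_adAct_adAct, middle_braiding]
  simp only [LinearMap.comp_apply, LinearEquiv.coe_coe]
  rw [n1, n2, n3, n4, hf',
    Rop_comm_apply R R (lft (lft (coR k A))) (rgt (lft (adR k A))) (rgt (rgt (adR k A)))
      (lft (rgt (coR k A))),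
    Rop_comm_apply R R (rgt (lft (adR k A))) (lft (lft (coR k A))) (rgt (rgt (adR k A)))
      (lft (rgt (coR k A))),
    Rop_comm_apply R R (lft (lft (coR k A))) (rgt (lft (adR k A))) (lft (rgt (coR k A)))
      (rgt (rgt (adR k A))),
    Rop_comm_apply R R (rgt (lft (adR k A))) (lft (lft (coR k A))) (lft (rgt (coR k A)))
      (rgt (rgt (adR k A))),
    Rop_comul_adR hR, Rop_comul_inv hR, ← Rop_natural_apply R cz ce, ← Rop_natural_apply R ce cz,
    ← Rop_natural_apply hR.inv cq cl, map_counitL_comul,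
    Rop_comm_apply R hR.inv (lft (coR k A)) (rgt (rgt (adR k A))) (rgt (lft (adR k A)))
      (lft (coL k A)),
    Rop_comm_apply R hR.inv (rgt (rgt (adR k A))) (lft (coR k A)) (rgt (lft (adR k A)))
      (lft (coL k A)), counitL_Rop_inv hR, adAct, rgt_mulCo]
  simp only [LinearMap.comp_apply]
  rw [Rop_mulCo_left_apply hR, Rop_mulCo_right_apply hR]

lemma isComoduleHom_bracket (hR : IsCoquasitriangular R) :
    IsComoduleHom (mulCo (lft (adR k A)) (rgt (adR k A))) (adR k A) (bracket R) := by
  rw [← adAct_adR]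
  exact isComoduleHom_adAct hR _

/-- Jacobi is naturality of the action along the bracket, and the coproduct axiom is naturality
along Δ; in both, `adAct_tensor` evaluates the action on the tensor square. -/
lemma isBraidedLieAlgebra_bracket (hR : IsCoquasitriangular R) :
    IsBraidedLieAlgebra R (adR k A) (Coalgebra.comul (R := k)) Coalgebra.counit (bracket R) where
  coalgebra := isCoalgebraIn_trans
  bracket_hom := by rw [tensorCoaction_eq]; exact isComoduleHom_bracket hR
  jacobi := by
    have h := adAct_natural R (isComoduleHom_bracket hR)
    rw [adAct_adR] at h
    rw [← h]
    refine LinearMap.ext fun x => ?_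
    simp only [LinearMap.comp_apply]
    rw [adAct_tensor hR]
  cocomm := isCocommutativeWrt_bracket hR
  comul_bracket := by
    have h := adAct_natural R (isComoduleHom_comul_adR (k := k) (A := A))
    rw [adAct_adR] at h
    rw [h]
    refine LinearMap.ext fun x => ?_
    have e : TensorProduct.map (coR k A) (coR k A) x = TensorProduct.map (coR k A) LinearMap.id
        (TensorProduct.map LinearMap.id (coR k A) x) := by
      simp [TensorProduct.map_map]
    simp only [LinearMap.comp_apply]
    rw [e, adAct_tensor hR]
  counit_bracket := counit_bracket hR

/-! ### The braided adjoint action -/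

/-- Associativity regroups a₁ • (b • S a₂) as (a₁ • b) • S a₂, and the antipode, being a comodule
map, passes the braiding. It then stands alone on the last leg of `coBraid`. -/
lemma braidedAd_eq (hR : IsCoquasitriangular R) :
    braidedAd R (adR k A) (transMul R) (coR k A) (transAntipode R) =
      transMul R ∘ₗ TensorProduct.map (transMul R) (transAntipode R) ∘ₗ
        coBraid R (adR k A) := by
  refine LinearMap.ext fun x => ?_
  have hS := isComoduleHom_transAntipode hR
  have h1 : TensorProduct.map LinearMap.id (transMul R ∘ₗ braiding R (adR k A) (adR k A) ∘ₗ
      TensorProduct.map (transAntipode R) LinearMap.id) =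
      TensorProduct.map LinearMap.id (transMul R) ∘ₗ TensorProduct.map (LinearMap.id : A →ₗ[k] A)
        (TensorProduct.map LinearMap.id (transAntipode R)) ∘ₗ
      TensorProduct.map LinearMap.id (TensorProduct.comm k A A).toLinearMap ∘ₗ
      TensorProduct.map LinearMap.id (Rop R (lft (adR k A)) (rgt (adR k A))) := by
    have h : braiding R (adR k A) (adR k A) ∘ₗ TensorProduct.map (transAntipode R) LinearMap.id =
        TensorProduct.map LinearMap.id (transAntipode R) ∘ₗ
          (TensorProduct.comm k A A).toLinearMap ∘ₗ Rop R (lft (adR k A)) (rgt (adR k A)) := by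
      rw [braiding_eq, LinearMap.comp_assoc, Rop_natural R (hS.map_lft LinearMap.id)
        ((IsComoduleHom.id (adR k A)).map_rgt _), ← LinearMap.comp_assoc, ← LinearMap.comp_assoc]
      congr 1
      ext; simp
    rw [h]
    simp only [← TensorProduct.map_comp, LinearMap.id_comp]
  have h2 : TensorProduct.map (LinearMap.id : A →ₗ[k] A) (TensorProduct.map (LinearMap.id :
      A →ₗ[k] A) (transAntipode R)) ∘ₗ TensorProduct.map LinearMap.id
      (TensorProduct.comm k A A).toLinearMap ∘ₗ (TensorProduct.assoc k A A A).toLinearMap =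
      (TensorProduct.assoc k A A A).toLinearMap ∘ₗ
      TensorProduct.map LinearMap.id (transAntipode R) ∘ₗ
      (TensorProduct.rightComm k A A A).toLinearMap := by
    ext; simp
  have h2' (y) := LinearMap.congr_fun h2 y
  have n (y) := Rop_natural_apply R (isComoduleHom_assoc₂ A A A (adR k A))
    (isComoduleHom_assoc₃ A A A (adR k A)) y
  have ha (y) := LinearMap.congr_fun (transMul_assoc hR) y
  simp only [LinearMap.comp_apply, LinearEquiv.coe_coe] at h2' n ha
  rw [braidedAd, h1, ← Rop_rgt]
  simp only [LinearMap.comp_apply, LinearEquiv.coe_coe, coBraid]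
  rw [n, h2', ← ha, TensorProduct.map_map]
  simp

/-- With `counitR_coBraid`, this makes `coBraid` a coaction of the coalgebra `A` on `A ⊗ X`. The
point is that Δ is a map from ad to ad₁ ad₂, so the braiding with a coproduct splits into two
braidings. -/
lemma coBraid_coassoc (hR : IsCoquasitriangular R) (ρ : X →ₗ[k] X ⊗[k] A) [h : IsCoaction ρ] :
    TensorProduct.map (coBraid R ρ) LinearMap.id ∘ₗ coBraid R ρ =
      (TensorProduct.assoc k (A ⊗[k] X) A A).symm.toLinearMap ∘ₗ
        TensorProduct.map LinearMap.id (coR k A) ∘ₗ coBraid R ρ := by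
  refine LinearMap.ext fun x => ?_
  have h1 : TensorProduct.map (coBraid R ρ) (LinearMap.id : A →ₗ[k] A) =
      TensorProduct.map (TensorProduct.rightComm k A A X).toLinearMap LinearMap.id ∘ₗ
        Rop R (lft (lft (rgt (adR k A)))) (lft (rgt ρ)) ∘ₗ
        TensorProduct.map (TensorProduct.map (coR k A) LinearMap.id) LinearMap.id := by
    rw [Rop_lft]
    simp only [← TensorProduct.map_comp, LinearMap.id_comp, coBraid]
  have h2 : TensorProduct.map (TensorProduct.map (coR k A) (LinearMap.id : X →ₗ[k] X))
      (LinearMap.id : A →ₗ[k] A) ∘ₗ (TensorProduct.rightComm k A A X).toLinearMap =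
      (TensorProduct.rightComm k (A ⊗[k] A) A X).toLinearMap ∘ₗ
        TensorProduct.map (TensorProduct.map (coR k A) LinearMap.id) LinearMap.id := by
    ext; simp
  have h3 : (TensorProduct.assoc k (A ⊗[k] X) A A).symm.toLinearMap ∘ₗ
      TensorProduct.map LinearMap.id (coR k A) ∘ₗ (TensorProduct.rightComm k A A X).toLinearMap =
      ((TensorProduct.assoc k (A ⊗[k] X) A A).symm.toLinearMap ∘ₗ
      (TensorProduct.rightComm k A (A ⊗[k] A) X).toLinearMap) ∘ₗ
        TensorProduct.map (TensorProduct.map LinearMap.id (coR k A)) LinearMap.id := by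
    ext; simp
  have h4 : ((TensorProduct.assoc k (A ⊗[k] X) A A).symm.toLinearMap ∘ₗ
      (TensorProduct.rightComm k A (A ⊗[k] A) X).toLinearMap) ∘ₗ
      TensorProduct.map (TensorProduct.assoc k A A A).toLinearMap LinearMap.id =
      TensorProduct.map (TensorProduct.rightComm k A A X).toLinearMap LinearMap.id ∘ₗ
      (TensorProduct.rightComm k (A ⊗[k] A) A X).toLinearMap := by
    ext; simp
  have h5 : TensorProduct.map (TensorProduct.map LinearMap.id (coR k A)) LinearMap.id ∘ₗ
      TensorProduct.map (coR k A) LinearMap.id =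
      TensorProduct.map (TensorProduct.assoc k A A A).toLinearMap (LinearMap.id : X →ₗ[k] X) ∘ₗ
        TensorProduct.map (TensorProduct.map (coR k A) LinearMap.id) LinearMap.id ∘ₗ
        TensorProduct.map (coR k A) LinearMap.id := by
    simp only [← TensorProduct.map_comp, LinearMap.id_comp, ← isRightComodule_coR.coassoc]
  have h2' (y) := LinearMap.congr_fun h2 y
  have h3' (y) := LinearMap.congr_fun h3 y
  have h4' (y) := LinearMap.congr_fun h4 y
  have h5' (y) := LinearMap.congr_fun h5 y
  have n1 (y) := Rop_natural_apply R (isComoduleHom_rightComm₁ (A ⊗[k] A) A X (rgt (adR k A)))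
    (isComoduleHom_rightComm₃ (A ⊗[k] A) A X ρ) y
  have i1 := (isComoduleHom_assoc₂ A A A (adR k A)).map_lft (LinearMap.id : X →ₗ[k] X)
  have i2 := (isComoduleHom_assoc₃ A A A (adR k A)).map_lft (LinearMap.id : X →ₗ[k] X)
  have i3 := (IsComoduleHom.id ρ).map_rgt (TensorProduct.assoc k A A A).toLinearMap
  have j1 := (((isComoduleHom_comul_adR (k := k) (A := A)).map_rgt
    (LinearMap.id : A →ₗ[k] A))).map_lft (LinearMap.id : X →ₗ[k] X)
  have j2 := (IsComoduleHom.id ρ).map_rgt (TensorProduct.map (LinearMap.id : A →ₗ[k] A) (coR k A))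
  have j3 := ((IsComoduleHom.id (adR k A)).map_rgt (coR k A)).map_lft (LinearMap.id : X →ₗ[k] X)
  have j4 := (IsComoduleHom.id ρ).map_rgt (TensorProduct.map (coR k A) (LinearMap.id : A →ₗ[k] A))
  rw [LinearMap.comp_apply, h1]
  simp only [LinearMap.comp_apply, LinearEquiv.coe_coe] at h2' h3' h4' h5' n1
  simp only [LinearMap.comp_apply, LinearEquiv.coe_coe, coBraid]
  rw [h2', n1, h3', ← Rop_natural_apply R j1 j2, h5', rgt_mulCo, lft_mulCo,
    Rop_mulCo_left_apply hR, Rop_natural_apply R i2 i3, Rop_natural_apply R i1 i3, h4',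
    ← Rop_natural_apply R j3 j4]

lemma counitR_coBraid (hR : IsCoquasitriangular R) (ρ : X →ₗ[k] X ⊗[k] A) [h : IsCoaction ρ]
    (x : A ⊗[k] X) : counitR k A (A ⊗[k] X) (coBraid R ρ x) = x := by
  have h1 : counitR k A (A ⊗[k] X) ∘ₗ (TensorProduct.rightComm k A A X).toLinearMap =
      TensorProduct.map (counitR k A A) LinearMap.id := by
    ext; simp [counitR, TensorProduct.smul_tmul']
  have h1' (y) := LinearMap.congr_fun h1 y
  simp only [LinearMap.comp_apply, LinearEquiv.coe_coe] at h1'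
  have h2 : counitR k A A ∘ₗ coR k A = LinearMap.id := LinearMap.ext fun a => counitR_comul a
  rw [coBraid, LinearMap.comp_apply, LinearMap.comp_apply, LinearEquiv.coe_coe, h1',
    ← Rop_natural_apply R (isComoduleHom_counitR_triv.map_lft LinearMap.id)
      ((IsComoduleHom.id ρ).map_rgt _), lft_triv, Rop_triv_left_apply hR, TensorProduct.map_map, h2]
  simp

/-- By `transMul_lieBraiding`, • is • ∘ ([ , ] ⊗ id) ∘ `coBraid`. Insert this into the form (• ⊗ S)
∘ `coBraid` of the adjoint action: coassociativity of `coBraid` puts id • S on one coproduct, where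
it collapses, and only the bracket is left. -/
lemma braidedAd_eq_bracket (hR : IsCoquasitriangular R) :
    braidedAd R (adR k A) (transMul R) (coR k A) (transAntipode R) = bracket R := by
  have h1 := lieBraiding_eq R (bracket R)
  have h2 := transMul_lieBraiding hR
  rw [h1] at h2
  have h3 : TensorProduct.map (transMul R) (transAntipode R) =
      TensorProduct.map (transMul R) (transAntipode R) ∘ₗ
        TensorProduct.map (TensorProduct.map (bracket R) LinearMap.id) LinearMap.id ∘ₗ
        TensorProduct.map (coBraid R (adR k A)) LinearMap.id := by
    conv_lhs => rw [← h2]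
    simp only [← TensorProduct.map_comp, LinearMap.comp_id]
  have ha := transMul_assoc hR
  have h4 : TensorProduct.map (transMul R) (transAntipode R) ∘ₗ
        TensorProduct.map (TensorProduct.map (bracket R) LinearMap.id) LinearMap.id ∘ₗ
        (TensorProduct.assoc k (A ⊗[k] A) A A).symm.toLinearMap =
      TensorProduct.map (transMul R) LinearMap.id ∘ₗ (TensorProduct.assoc k A A A).symm.toLinearMap
        ∘ₗ TensorProduct.map (bracket R) (TensorProduct.map LinearMap.id (transAntipode R)) := by
    ext; simp
  have ha' (y) := LinearMap.congr_fun ha y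
  have h4' (y) := LinearMap.congr_fun h4 y
  have h5 (y) := LinearMap.congr_fun (coBraid_coassoc hR (adR k A)) y
  simp only [LinearMap.comp_apply, LinearEquiv.coe_coe] at ha' h4' h5
  refine LinearMap.ext fun x => ?_
  rw [braidedAd_eq hR, h3]
  simp only [LinearMap.comp_apply]
  rw [h5, h4', ha', LinearEquiv.apply_symm_apply, TensorProduct.map_map, TensorProduct.map_map,
    LinearMap.id_comp, LinearMap.comp_id, LinearMap.comp_assoc, transMul_transAntipode_right hR]
  conv_rhs => rw [← counitR_coBraid hR (adR k A) x]
  generalize coBraid R (adR k A) x = t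
  induction t using TensorProduct.induction_on with
  | zero => simp
  | add x y hx hy => simp only [map_add, hx, hy]
  | tmul x b =>
    simp [counitR, Algebra.algebraMap_eq_smul_one, transMul_one_right hR]

/-! ### The associated braiding is a map of coalgebras -/

lemma Rop_inv_mulCo_left_apply (hR : IsCoquasitriangular R) (ρ σ τ : X →ₗ[k] X ⊗[k] A)
    [h₁ : Commutes ρ τ] [h₂ : Commutes σ τ] [h₃ : IsCoaction τ] [h₄ : IsCoaction ρ]
    [h₅ : IsCoaction σ] [h₆ : Commutes ρ σ] (x : X) :
    Rop hR.inv (mulCo ρ σ) τ x = Rop hR.inv σ τ (Rop hR.inv ρ τ x) := by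
  have h : Rop R (mulCo ρ σ) τ (Rop hR.inv σ τ (Rop hR.inv ρ τ x)) = x := by
    rw [Rop_mulCo_left_apply hR, Rop_comp_inv_apply hR, Rop_comp_inv_apply hR]
  conv_lhs => rw [← h]
  exact Rop_inv_comp_apply hR _ _ _

lemma isComoduleHom_Rop_inv_mulCo (hR : IsCoquasitriangular R) (ρ σ : X →ₗ[k] X ⊗[k] A)
    [h : Commutes ρ σ] [hρ : IsCoaction ρ] [hσ : IsCoaction σ] :
    IsComoduleHom (mulCo σ ρ) (mulCo ρ σ) (Rop hR.inv ρ σ) := by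
  have h1 := isComoduleHom_Rop_mulCo hR h.out hρ.out hσ.out
  have h2 := Rop_comp_inv hR h.out hρ.out hσ.out
  have h3 := Rop_inv_comp hR h.out hρ.out hσ.out
  have h4 : TensorProduct.map (Rop hR.inv ρ σ) (LinearMap.id : A →ₗ[k] A) ∘ₗ
      TensorProduct.map (Rop R ρ σ) LinearMap.id = LinearMap.id := by
    rw [← TensorProduct.map_comp, h3]; simp
  rw [IsComoduleHom] at h1 ⊢
  calc mulCo ρ σ ∘ₗ Rop hR.inv ρ σ
      = (TensorProduct.map (Rop hR.inv ρ σ) LinearMap.id ∘ₗ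
          TensorProduct.map (Rop R ρ σ) LinearMap.id) ∘ₗ mulCo ρ σ ∘ₗ Rop hR.inv ρ σ := by
        rw [h4, LinearMap.id_comp]
    _ = TensorProduct.map (Rop hR.inv ρ σ) LinearMap.id ∘ₗ
          (TensorProduct.map (Rop R ρ σ) LinearMap.id ∘ₗ mulCo ρ σ) ∘ₗ Rop hR.inv ρ σ := by
        simp only [LinearMap.comp_assoc]
    _ = _ := by rw [← h1, LinearMap.comp_assoc, h2, LinearMap.comp_id]

/-- The legs pass through l₁ r₁ ad₂, l₁ ad₂ r₁, after the flip l₂ ad₁ r₂, and finally ad₁ l₂ r₂ =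
ad₁ ad₂. -/
lemma isComoduleHom_lieBraiding (hR : IsCoquasitriangular R) :
    IsComoduleHom (mulCo (lft (adR k A)) (rgt (adR k A))) (mulCo (lft (adR k A)) (rgt (adR k A)))
      (lieBraiding R (adR k A) (coR k A) (bracket R)) := by
  have el : (lft (adR k A) : A ⊗[k] A →ₗ[k] _) = mulCo (lft (coL k A)) (lft (coR k A)) := by
    rw [adR_eq, lft_mulCo]
  have er : (rgt (adR k A) : A ⊗[k] A →ₗ[k] _) = mulCo (rgt (coL k A)) (rgt (coR k A)) := by
    rw [adR_eq, rgt_mulCo]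
  have a1 : IsComoduleHom (lft (coL k A)) (lft (coL k A))
      (Rop R (lft (coR k A)) (rgt (adR k A))) := isComoduleHom_Rop R comm_coL_coR.lft
        (comm_lft_rgt _ _)
  have a2 := a1.mulCo (isComoduleHom_Rop_mulCo hR (comm_lft_rgt (coR k A) (adR k A))
    isRightComodule_coR.lft isRightComodule_adR.rgt)
  rw [← mulCo_assoc, ← el] at a2
  have b := (isComoduleHom_comm_lft A A (coL k A)).mulCo ((isComoduleHom_comm_rgt A A
    (adR k A)).mulCo (isComoduleHom_comm_lft A A (coR k A)))
  have c1 : IsComoduleHom (rgt (coR k A)) (rgt (coR k A))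
      (Rop hR.inv (lft (adR k A)) (rgt (coL k A))) := isComoduleHom_Rop _
        (comm_lft_rgt _ _).symm comm_coL_coR.symm.rgt
  have c2 := (isComoduleHom_Rop_inv_mulCo hR (lft (adR k A)) (rgt (coL k A))).mulCo c1
  rw [mulCo_assoc, mulCo_assoc, ← er] at c2
  rw [lieBraiding_bracket hR]
  exact c2.comp (b.comp a2)

/-- The form ε ⊗ ε is ε ∘ •, and • ∘ Ψ̃ = •. -/
lemma counit_lieBraiding (hR : IsCoquasitriangular R) :
    LinearMap.mul' k k ∘ₗ TensorProduct.map (Coalgebra.counit (R := k) (A := A))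
      Coalgebra.counit ∘ₗ lieBraiding R (adR k A) (coR k A) (bracket R) =
    LinearMap.mul' k k ∘ₗ TensorProduct.map (Coalgebra.counit (R := k) (A := A))
      Coalgebra.counit := by
  rw [← LinearMap.comp_assoc, ← counit_transMul hR, LinearMap.comp_assoc, transMul_lieBraiding hR]

/-- On the left, half of the middle braiding cancels part of the split inverse of Ψ̃; on the right,
the middle braiding merges into Δa. Both sides become operators on the same vector Δ ⊗ id of `m`,
and `Rop_comul_inv` identifies those that still differ. -/
lemma middle_comul_lieBraiding (hR : IsCoquasitriangular R) (x : A ⊗[k] A) :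
    middle (braiding R (adR k A) (adR k A)) (TensorProduct.map (coR k A) (coR k A)
      (lieBraiding R (adR k A) (coR k A) (bracket R) x)) =
    TensorProduct.map (lieBraiding R (adR k A) (coR k A) (bracket R))
      (lieBraiding R (adR k A) (coR k A) (bracket R))
      (middle (braiding R (adR k A) (adR k A)) (TensorProduct.map (coR k A) (coR k A) x)) := by
  have hN : TensorProduct.map (coR k A) (coR k A) x = TensorProduct.map (coR k A) LinearMap.id
      (TensorProduct.map LinearMap.id (coR k A) x) := by simp [TensorProduct.map_map]
  -- `m` is a ⊗ b₁ ⊗ b₂ after the operators pairing r of a with the adjoint coactions of b₁ and b₂,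
  -- with the coproduct of a not yet taken.
  let m := Rop R (lft (coR k A)) (rgt (rgt (adR k A))) (Rop R (lft (coR k A)) (rgt (lft (adR k A)))
    (TensorProduct.map LinearMap.id (coR k A) x))
  have dR := (isComoduleHom_coR_rgt (k := k) (A := A)).map_lft
    (LinearMap.id : A ⊗[k] A →ₗ[k] A ⊗[k] A)
  have hl : Rop R (lft (rgt (coR k A))) (rgt (rgt (adR k A))) (Rop R (lft (rgt (coR k A)))
      (rgt (lft (adR k A))) (TensorProduct.map (coR k A) (coR k A) x)) =
      TensorProduct.map (coR k A) LinearMap.id m := by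
    rw [hN, Rop_natural_apply R dR ((IsComoduleHom.id (lft (adR k A))).map_rgt (coR k A)),
      Rop_natural_apply R dR ((IsComoduleHom.id (rgt (adR k A))).map_rgt (coR k A))]
  have hr : Rop R (lft (lft (coR k A))) (rgt (lft (adR k A))) (Rop R (lft (rgt (coR k A)))
      (rgt (rgt (adR k A))) (Rop R (lft (rgt (adR k A))) (rgt (lft (adR k A)))
        (TensorProduct.map (coR k A) (coR k A) x))) =
      TensorProduct.map (coR k A) LinearMap.id m := by
    rw [Rop_comm_apply R R (lft (lft (coR k A))) (rgt (lft (adR k A))) (lft (rgt (coR k A)))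
      (rgt (rgt (adR k A))), hN, Rop_comul_adR hR,
      Rop_natural_apply R dR ((IsComoduleHom.id (rgt (adR k A))).map_rgt (coR k A))]
  have cc (y : A ⊗[k] A) : TensorProduct.map (coR k A) (coR k A) (TensorProduct.comm k A A y) =
      TensorProduct.comm k (A ⊗[k] A) (A ⊗[k] A) (TensorProduct.map (coR k A) (coR k A) y) := by
    induction y using TensorProduct.induction_on with
    | zero => simp
    | add x y hx hy => simp only [map_add, hx, hy]
    | tmul x b => simp
  have e1 : (rgt (lft (adR k A)) : (A ⊗[k] A) ⊗[k] (A ⊗[k] A) →ₗ[k] _) =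
      mulCo (rgt (lft (coL k A))) (rgt (lft (coR k A))) := by
    rw [adR_eq, lft_mulCo, rgt_mulCo]
  have left : middle (braiding R (adR k A) (adR k A)) (TensorProduct.map (coR k A) (coR k A)
      (lieBraiding R (adR k A) (coR k A) (bracket R) x)) =
      TensorProduct.tensorTensorTensorComm k A A A A (Rop R (lft (rgt (adR k A)))
        (rgt (lft (coR k A))) (Rop hR.inv (lft (lft (adR k A))) (rgt (lft (coL k A)))
          (TensorProduct.comm k (A ⊗[k] A) (A ⊗[k] A)
            (TensorProduct.map (coR k A) LinearMap.id m)))) := by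
    rw [middle_braiding, lieBraiding_bracket hR]
    simp only [LinearMap.comp_apply, LinearEquiv.coe_coe]
    rw [← Rop_natural_apply hR.inv (isComoduleHom_comul_adR.map_lft (coR k A))
      (isComoduleHom_coL_comul.map_rgt (coR k A)), cc,
      ← Rop_natural_apply R (isComoduleHom_coR_rgt.map_lft (coR k A))
      (isComoduleHom_comul_adR.map_rgt (coR k A)), rgt_mulCo, lft_mulCo,
      Rop_mulCo_right_apply hR, hl, Rop_inv_mulCo_left_apply hR, e1, Rop_mulCo_right_apply hR,
      Rop_comp_inv_apply hR]
  have mc : TensorProduct.map (TensorProduct.comm k A A).toLinearMap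
      (TensorProduct.comm k A A).toLinearMap ∘ₗ
      (TensorProduct.tensorTensorTensorComm k A A A A).toLinearMap =
      (TensorProduct.tensorTensorTensorComm k A A A A).toLinearMap ∘ₗ
        (TensorProduct.comm k (A ⊗[k] A) (A ⊗[k] A)).toLinearMap := by
    ext; simp
  have mc' (y) := LinearMap.congr_fun mc y
  have ml : TensorProduct.map (lieBraiding R (adR k A) (coR k A) (bracket R))
      (lieBraiding R (adR k A) (coR k A) (bracket R)) =
      Rop hR.inv (lft (lft (adR k A))) (lft (rgt (coL k A))) ∘ₗ
      Rop hR.inv (rgt (lft (adR k A))) (rgt (rgt (coL k A))) ∘ₗ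
      TensorProduct.map (TensorProduct.comm k A A).toLinearMap
        (TensorProduct.comm k A A).toLinearMap ∘ₗ
      Rop R (lft (lft (coR k A))) (lft (rgt (adR k A))) ∘ₗ
      Rop R (rgt (lft (coR k A))) (rgt (rgt (adR k A))) := by
    rw [lieBraiding_bracket hR, Rop_lft, Rop_lft, Rop_rgt, Rop_rgt]
    simp only [← TensorProduct.map_comp, LinearMap.id_comp, LinearMap.comp_id]
  have n1 (y) := Rop_natural_apply R (isComoduleHom_ttt₂ A A A A (coR k A))
    (isComoduleHom_ttt₄ A A A A (adR k A)) y
  have n2 (y) := Rop_natural_apply R (isComoduleHom_ttt₁ A A A A (coR k A))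
    (isComoduleHom_ttt₃ A A A A (adR k A)) y
  have n3 (y) := Rop_natural_apply hR.inv (isComoduleHom_ttt₂ A A A A (adR k A))
    (isComoduleHom_ttt₄ A A A A (coL k A)) y
  have n4 (y) := Rop_natural_apply hR.inv (isComoduleHom_ttt₁ A A A A (adR k A))
    (isComoduleHom_ttt₃ A A A A (coL k A)) y
  have c1 (y) := Rop_natural_apply R
    (isComoduleHom_comm_rgt (A ⊗[k] A) (A ⊗[k] A) (rgt (adR k A)))
    (isComoduleHom_comm_lft (A ⊗[k] A) (A ⊗[k] A) (lft (coR k A))) y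
  have c2 (y) := Rop_natural_apply hR.inv
    (isComoduleHom_comm_rgt (A ⊗[k] A) (A ⊗[k] A) (rgt (adR k A)))
    (isComoduleHom_comm_lft (A ⊗[k] A) (A ⊗[k] A) (rgt (coL k A))) y
  simp only [LinearMap.comp_apply, LinearEquiv.coe_coe] at mc' n1 n2 n3 n4 c1 c2
  rw [left, ml, middle_braiding]
  simp only [LinearMap.comp_apply, LinearEquiv.coe_coe]
  rw [n1, n2, hr, mc', n3, n4, Rop_comm_apply R hR.inv (lft (rgt (adR k A))) (rgt (lft (coR k A)))
    (lft (lft (adR k A))) (rgt (lft (coL k A))), c1, Rop_comul_inv hR, c2]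

/-! ### Restriction along injective maps -/

lemma braiding_natural (F : A ⊗[k] A →ₗ[k] k) {ρV : X →ₗ[k] X ⊗[k] A} {ρW : Y →ₗ[k] Y ⊗[k] A}
    {f : X →ₗ[k] Y} (hf : IsComoduleHom ρV ρW f) :
    braiding F ρW ρW ∘ₗ TensorProduct.map f f = TensorProduct.map f f ∘ₗ braiding F ρV ρV := by
  rw [braiding_eq, braiding_eq, LinearMap.comp_assoc, Rop_natural F (hf.map_lft f) (hf.map_rgt f),
    ← LinearMap.comp_assoc, ← LinearMap.comp_assoc]
  congr 1
  ext; simp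

lemma IsComoduleHom.tensor {ρV : X →ₗ[k] X ⊗[k] A} {ρW : Y →ₗ[k] Y ⊗[k] A}
    {f : X →ₗ[k] Y} (hf : IsComoduleHom ρV ρW f) :
    IsComoduleHom (tensorCoaction ρV ρV) (tensorCoaction ρW ρW) (TensorProduct.map f f) := by
  rw [tensorCoaction_eq, tensorCoaction_eq]
  exact (hf.map_lft f).mulCo (hf.map_rgt f)

lemma middle_natural {f : X →ₗ[k] Y} {g : X ⊗[k] X →ₗ[k] X ⊗[k] X} {g' : Y ⊗[k] Y →ₗ[k] Y ⊗[k] Y}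
    (h : g' ∘ₗ TensorProduct.map f f = TensorProduct.map f f ∘ₗ g) :
    middle g' ∘ₗ TensorProduct.map (TensorProduct.map f f) (TensorProduct.map f f) =
      TensorProduct.map (TensorProduct.map f f) (TensorProduct.map f f) ∘ₗ middle g := by
  ext x y z w
  have := LinearMap.congr_fun h (y ⊗ₜ z)
  simp only [LinearMap.comp_apply, TensorProduct.map_tmul] at this
  simp only [middle, AlgebraTensorModule.curry_apply, curry_apply,
    LinearMap.coe_restrictScalars, LinearMap.comp_apply, TensorProduct.map_tmul,
    LinearMap.id_apply, LinearEquiv.coe_coe, TensorProduct.assoc_tmul,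
    TensorProduct.assoc_symm_tmul, this]
  generalize g (y ⊗ₜ z) = t
  induction t using TensorProduct.induction_on with
  | zero => simp
  | add x y hx hy => simp only [map_add, tmul_add, add_tmul, hx, hy]
  | tmul x b => simp

lemma lieBraiding_natural (F : A ⊗[k] A →ₗ[k] k) {ρV : X →ₗ[k] X ⊗[k] A}
    {ρW : Y →ₗ[k] Y ⊗[k] A} {f : X →ₗ[k] Y} (hf : IsComoduleHom ρV ρW f)
    {ΔV : X →ₗ[k] X ⊗[k] X} {ΔW : Y →ₗ[k] Y ⊗[k] Y} (hΔ : ΔW ∘ₗ f = TensorProduct.map f f ∘ₗ ΔV)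
    {brV : X ⊗[k] X →ₗ[k] X} {brW : Y ⊗[k] Y →ₗ[k] Y}
    (hbr : brW ∘ₗ TensorProduct.map f f = f ∘ₗ brV) :
    lieBraiding F ρW ΔW brW ∘ₗ TensorProduct.map f f =
      TensorProduct.map f f ∘ₗ lieBraiding F ρV ΔV brV := by
  have h1 : TensorProduct.map ΔW LinearMap.id ∘ₗ TensorProduct.map f f =
      TensorProduct.map (TensorProduct.map f f) f ∘ₗ TensorProduct.map ΔV LinearMap.id := by
    rw [← TensorProduct.map_comp, ← TensorProduct.map_comp, hΔ]; simp
  have h2 : (TensorProduct.assoc k Y Y Y).toLinearMap ∘ₗ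
      TensorProduct.map (TensorProduct.map f f) f =
      TensorProduct.map f (TensorProduct.map f f) ∘ₗ
        (TensorProduct.assoc k X X X).toLinearMap := by ext; simp
  have h3 : TensorProduct.map LinearMap.id (braiding F ρW ρW) ∘ₗ
      TensorProduct.map f (TensorProduct.map f f) = TensorProduct.map f (TensorProduct.map f f) ∘ₗ
      TensorProduct.map LinearMap.id (braiding F ρV ρV) := by
    rw [← TensorProduct.map_comp, ← TensorProduct.map_comp, braiding_natural F hf]; simp
  have h4 : (TensorProduct.assoc k Y Y Y).symm.toLinearMap ∘ₗ
      TensorProduct.map f (TensorProduct.map f f) = TensorProduct.map (TensorProduct.map f f) f ∘ₗ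
        (TensorProduct.assoc k X X X).symm.toLinearMap := by ext; simp
  have h5 : TensorProduct.map brW LinearMap.id ∘ₗ TensorProduct.map (TensorProduct.map f f) f =
      TensorProduct.map f f ∘ₗ TensorProduct.map brV LinearMap.id := by
    rw [← TensorProduct.map_comp, ← TensorProduct.map_comp, hbr]; simp
  simp only [lieBraiding, LinearMap.comp_assoc]
  rw [h1, ← LinearMap.comp_assoc (TensorProduct.map ΔV _), h2, LinearMap.comp_assoc,
    ← LinearMap.comp_assoc _ _ (TensorProduct.map LinearMap.id (braiding F ρW ρW)), h3,
    LinearMap.comp_assoc,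
    ← LinearMap.comp_assoc _ _ (TensorProduct.assoc k Y Y Y).symm.toLinearMap, h4,
    LinearMap.comp_assoc, ← LinearMap.comp_assoc _ _ (TensorProduct.map brW _), h5,
    LinearMap.comp_assoc]

section Injective

variable {V W : Type*} [AddCommGroup V] [Module k V] [AddCommGroup W] [Module k W]
  {f : V →ₗ[k] W}

lemma map_injective {V' W' : Type*} [AddCommGroup V'] [Module k V'] [AddCommGroup W']
    [Module k W'] {g : V' →ₗ[k] W'} (hf : Function.Injective f) (hg : Function.Injective g) :
    Function.Injective (TensorProduct.map f g) :=
  TensorProduct.map_injective_of_flat_flat f g hf hg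

lemma comp_left_cancel {f : Y →ₗ[k] Z} (hf : Function.Injective f) {u v : X →ₗ[k] Y}
    (h : f ∘ₗ u = f ∘ₗ v) : u = v :=
  LinearMap.ext fun x => hf (LinearMap.congr_fun h x)

lemma IsRightComodule.of_injective (hf : Function.Injective f) {ρV : V →ₗ[k] V ⊗[k] A}
    {ρW : W →ₗ[k] W ⊗[k] A} (h : IsComoduleHom ρV ρW f) (hW : IsRightComodule ρW) :
    IsRightComodule ρV where
  coassoc := by
    have hi : Function.Injective (TensorProduct.map f (LinearMap.id : A ⊗[k] A →ₗ[k] A ⊗[k] A)) :=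
      map_injective hf Function.injective_id
    refine comp_left_cancel hi (LinearMap.ext fun x => ?_)
    have h1 : TensorProduct.map f (LinearMap.id : A ⊗[k] A →ₗ[k] A ⊗[k] A) ∘ₗ
        (TensorProduct.assoc k V A A).toLinearMap ∘ₗ TensorProduct.map ρV LinearMap.id =
        (TensorProduct.assoc k W A A).toLinearMap ∘ₗ TensorProduct.map ρW LinearMap.id ∘ₗ
          TensorProduct.map f LinearMap.id := by
      have e : (TensorProduct.assoc k W A A).toLinearMap ∘ₗ
          TensorProduct.map (TensorProduct.map f LinearMap.id) LinearMap.id =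
          TensorProduct.map f LinearMap.id ∘ₗ (TensorProduct.assoc k V A A).toLinearMap := by
        ext; simp
      rw [← TensorProduct.map_comp, h, LinearMap.comp_id, ← LinearMap.comp_assoc, ← e,
        LinearMap.comp_assoc, ← TensorProduct.map_comp, LinearMap.comp_id]
    have h1' (y) := LinearMap.congr_fun h1 y
    have h2 := LinearMap.congr_fun hW.coassoc (f x)
    simp only [LinearMap.comp_apply, h.apply] at h1' h2 ⊢
    rw [h1', h2, TensorProduct.map_map, TensorProduct.map_map]
    simp
  counit := by
    refine comp_left_cancel hf (LinearMap.ext fun x => ?_)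
    have h2 := LinearMap.congr_fun hW.counit (f x)
    simp only [LinearMap.comp_apply, h.apply, LinearMap.id_apply] at h2 ⊢
    conv_rhs => rw [← h2]
    generalize ρV x = t
    induction t using TensorProduct.induction_on with
    | zero => simp
    | add x y hx hy => simp only [map_add, hx, hy]
    | tmul x b => simp

lemma IsComoduleHom.of_injective (hf : Function.Injective f) {ρV : V →ₗ[k] V ⊗[k] A}
    {ρW : W →ₗ[k] W ⊗[k] A} (h : IsComoduleHom ρV ρW f) {ρ : X →ₗ[k] X ⊗[k] A} {v : X →ₗ[k] V}
    (hv : IsComoduleHom ρ ρW (f ∘ₗ v)) : IsComoduleHom ρ ρV v := by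
  refine comp_left_cancel (map_injective hf (g := (LinearMap.id : A →ₗ[k] A))
    Function.injective_id) ?_
  rw [← LinearMap.comp_assoc, ← h, LinearMap.comp_assoc, hv, ← LinearMap.comp_assoc,
    ← TensorProduct.map_comp, LinearMap.comp_id]

lemma IsCoalgebraIn.of_injective (hf : Function.Injective f) {ρV : V →ₗ[k] V ⊗[k] A}
    {ρW : W →ₗ[k] W ⊗[k] A} (h : IsComoduleHom ρV ρW f)
    {ΔV : V →ₗ[k] V ⊗[k] V} {ΔW : W →ₗ[k] W ⊗[k] W} (hΔ : ΔW ∘ₗ f = TensorProduct.map f f ∘ₗ ΔV)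
    {ε : W →ₗ[k] k} (hW : IsCoalgebraIn ρW ΔW ε) : IsCoalgebraIn ρV ΔV (ε ∘ₗ f) where
  comodule := hW.comodule.of_injective hf h
  comul_hom := by
    refine IsComoduleHom.of_injective (map_injective hf hf) h.tensor ?_
    rw [← hΔ]
    exact hW.comul_hom.comp h
  counit_hom := hW.counit_hom.comp h
  coassoc := by
    refine comp_left_cancel (map_injective hf (map_injective hf hf)) ?_
    have h1 : TensorProduct.map f (TensorProduct.map f f) ∘ₗ
        (TensorProduct.assoc k V V V).toLinearMap ∘ₗ TensorProduct.map ΔV LinearMap.id =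
        (TensorProduct.assoc k W W W).toLinearMap ∘ₗ TensorProduct.map ΔW LinearMap.id ∘ₗ
          TensorProduct.map f f := by
      have e : (TensorProduct.assoc k W W W).toLinearMap ∘ₗ
          TensorProduct.map (TensorProduct.map f f) f =
          TensorProduct.map f (TensorProduct.map f f) ∘ₗ
            (TensorProduct.assoc k V V V).toLinearMap := by
        ext; simp
      rw [← TensorProduct.map_comp, hΔ, ← LinearMap.comp_assoc, ← e,
        LinearMap.comp_assoc, ← TensorProduct.map_comp, LinearMap.comp_id, LinearMap.id_comp]
    have h2 : TensorProduct.map f (TensorProduct.map f f) ∘ₗ TensorProduct.map LinearMap.id ΔV =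
        TensorProduct.map LinearMap.id ΔW ∘ₗ TensorProduct.map f f := by
      rw [← TensorProduct.map_comp, ← TensorProduct.map_comp, hΔ]; simp
    refine LinearMap.ext fun x => ?_
    have h1' (y) := LinearMap.congr_fun h1 y
    have h2' (y) := LinearMap.congr_fun h2 y
    have h3 := LinearMap.congr_fun hW.coassoc (f x)
    have h4 := LinearMap.congr_fun hΔ x
    simp only [LinearMap.comp_apply] at h1' h2' h3 h4 ⊢
    rw [h1', h2', ← h4, h3]
  counit_left := by
    refine comp_left_cancel hf (LinearMap.ext fun x => ?_)
    have h2 := LinearMap.congr_fun hW.counit_left (f x)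
    have h4 := LinearMap.congr_fun hΔ x
    simp only [LinearMap.comp_apply, LinearMap.id_apply] at h2 h4 ⊢
    rw [h4] at h2
    conv_rhs => rw [← h2]
    generalize ΔV x = t
    induction t using TensorProduct.induction_on with
    | zero => simp
    | add x y hx hy => simp only [map_add, hx, hy]
    | tmul x b => simp
  counit_right := by
    refine comp_left_cancel hf (LinearMap.ext fun x => ?_)
    have h2 := LinearMap.congr_fun hW.counit_right (f x)
    have h4 := LinearMap.congr_fun hΔ x
    simp only [LinearMap.comp_apply, LinearMap.id_apply] at h2 h4 ⊢
    rw [h4] at h2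
    conv_rhs => rw [← h2]
    generalize ΔV x = t
    induction t using TensorProduct.induction_on with
    | zero => simp
    | add x y hx hy => simp only [map_add, hx, hy]
    | tmul x b => simp

/-- Each axiom is checked after composition with `f` or a tensor power of it, which is injective;
there the structure maps cross `f` and the axiom of `W` applies. -/
lemma IsBraidedLieAlgebra.of_injective {R : A ⊗[k] A →ₗ[k] k} (hf : Function.Injective f)
    {ρV : V →ₗ[k] V ⊗[k] A} {ρW : W →ₗ[k] W ⊗[k] A} (h : IsComoduleHom ρV ρW f)
    {ΔV : V →ₗ[k] V ⊗[k] V} {ΔW : W →ₗ[k] W ⊗[k] W} (hΔ : ΔW ∘ₗ f = TensorProduct.map f f ∘ₗ ΔV)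
    {brV : V ⊗[k] V →ₗ[k] V} {brW : W ⊗[k] W →ₗ[k] W}
    (hbr : brW ∘ₗ TensorProduct.map f f = f ∘ₗ brV)
    {ε : W →ₗ[k] k} (hW : IsBraidedLieAlgebra R ρW ΔW ε brW) :
    IsBraidedLieAlgebra R ρV ΔV (ε ∘ₗ f) brV := by
  have hbb : TensorProduct.map brW brW ∘ₗ
      TensorProduct.map (TensorProduct.map f f) (TensorProduct.map f f) =
      TensorProduct.map f f ∘ₗ TensorProduct.map brV brV := by
    rw [← TensorProduct.map_comp, ← TensorProduct.map_comp, hbr]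
  have hbb' (y) := LinearMap.congr_fun hbb y
  have hbr' (y) := LinearMap.congr_fun hbr y
  have hΔ' (y) := LinearMap.congr_fun hΔ y
  have hm (y) := LinearMap.congr_fun (middle_natural (braiding_natural R h)) y
  have hl (y) := LinearMap.congr_fun (lieBraiding_natural R h hΔ hbr) y
  have hb (y) := LinearMap.congr_fun (braiding_natural R h) y
  simp only [LinearMap.comp_apply] at hbb' hbr' hΔ' hm hl hb
  refine ⟨hW.coalgebra.of_injective hf h hΔ, ?_, ?_, ?_, ?_, ?_⟩
  · refine IsComoduleHom.of_injective hf h ?_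
    rw [← hbr]
    exact hW.bracket_hom.comp h.tensor
  · refine comp_left_cancel hf (LinearMap.ext fun x => ?_)
    have hj := LinearMap.congr_fun hW.jacobi
      (TensorProduct.map f (TensorProduct.map f f) x)
    have h1 : TensorProduct.map LinearMap.id brW (TensorProduct.map f (TensorProduct.map f f) x) =
        TensorProduct.map f f (TensorProduct.map LinearMap.id brV x) := by
      rw [TensorProduct.map_map, TensorProduct.map_map, hbr]; simp
    have h2 : TensorProduct.map ΔW LinearMap.id
        (TensorProduct.map f (TensorProduct.map f f) x) =
        TensorProduct.map (TensorProduct.map f f) (TensorProduct.map f f)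
          (TensorProduct.map ΔV LinearMap.id x) := by
      rw [TensorProduct.map_map, TensorProduct.map_map, hΔ]; simp
    simp only [LinearMap.comp_apply] at hj ⊢
    rw [h1, hbr', h2, hm, hbb', hbr'] at hj
    exact hj
  · refine comp_left_cancel (map_injective hf hf) (LinearMap.ext fun x => ?_)
    have hj := LinearMap.congr_fun hW.cocomm (TensorProduct.map f f x)
    have h1 : TensorProduct.map LinearMap.id brW ∘ₗ (TensorProduct.assoc k W W W).toLinearMap ∘ₗ
        TensorProduct.map (TensorProduct.map f f) f = TensorProduct.map f f ∘ₗ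
        TensorProduct.map LinearMap.id brV ∘ₗ (TensorProduct.assoc k V V V).toLinearMap := by
      ext x y z
      simp [← hbr']
    have h1' (y) := LinearMap.congr_fun h1 y
    have h2 : TensorProduct.map ΔW LinearMap.id (TensorProduct.map f f x) =
        TensorProduct.map (TensorProduct.map f f) f
          (TensorProduct.map ΔV LinearMap.id x) := by
      rw [TensorProduct.map_map, TensorProduct.map_map, hΔ]; simp
    simp only [LinearMap.comp_apply] at hj h1' ⊢
    rw [h2, h1', hl, hb] at hj
    exact hj
  · refine comp_left_cancel (map_injective hf hf) (LinearMap.ext fun x => ?_)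
    have hj := LinearMap.congr_fun hW.comul_bracket (TensorProduct.map f f x)
    have h2 : TensorProduct.map ΔW ΔW (TensorProduct.map f f x) =
        TensorProduct.map (TensorProduct.map f f) (TensorProduct.map f f)
          (TensorProduct.map ΔV ΔV x) := by
      rw [TensorProduct.map_map, TensorProduct.map_map, hΔ]
    simp only [LinearMap.comp_apply] at hj ⊢
    rw [hbr', hΔ', h2, hm, hbb'] at hj
    exact hj
  · rw [LinearMap.comp_assoc, ← hbr, ← LinearMap.comp_assoc, hW.counit_bracket,
      LinearMap.comp_assoc, ← TensorProduct.map_comp]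

end Injective

/-! ### Braided tensor products of algebras -/

/-- `f` respects the products `mX` and `mY`. -/
def IsMulHom (mX : X ⊗[k] X →ₗ[k] X) (mY : Y ⊗[k] Y →ₗ[k] Y) (f : X →ₗ[k] Y) : Prop :=
  f ∘ₗ mX = mY ∘ₗ TensorProduct.map f f

lemma IsMulHom.apply {mX : X ⊗[k] X →ₗ[k] X} {mY : Y ⊗[k] Y →ₗ[k] Y} {f : X →ₗ[k] Y}
    (h : IsMulHom mX mY f) (x : X ⊗[k] X) : f (mX x) = mY (TensorProduct.map f f x) :=
  LinearMap.congr_fun h x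

lemma IsMulHom.comp {mX : X ⊗[k] X →ₗ[k] X} {mY : Y ⊗[k] Y →ₗ[k] Y} {mZ : Z ⊗[k] Z →ₗ[k] Z}
    {g : Y →ₗ[k] Z} {f : X →ₗ[k] Y} (hg : IsMulHom mY mZ g) (hf : IsMulHom mX mY f) :
    IsMulHom mX mZ (g ∘ₗ f) := by
  rw [IsMulHom, LinearMap.comp_assoc, hf, ← LinearMap.comp_assoc, hg, TensorProduct.map_comp,
    LinearMap.comp_assoc]

lemma IsMulHom.id (mX : X ⊗[k] X →ₗ[k] X) : IsMulHom mX mX LinearMap.id := by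
  rw [IsMulHom]; simp

/-- The componentwise product on `X ⊗ Y`. -/
def tensorMul (mX : X ⊗[k] X →ₗ[k] X) (mY : Y ⊗[k] Y →ₗ[k] Y) :
    (X ⊗[k] Y) ⊗[k] (X ⊗[k] Y) →ₗ[k] X ⊗[k] Y :=
  TensorProduct.map mX mY ∘ₗ (TensorProduct.tensorTensorTensorComm k X Y X Y).toLinearMap

lemma IsMulHom.tensorMul {mX : X ⊗[k] X →ₗ[k] X} {mY : Y ⊗[k] Y →ₗ[k] Y}
    {mZ : Z ⊗[k] Z →ₗ[k] Z} {mW : W ⊗[k] W →ₗ[k] W} {f : X →ₗ[k] Z} {g : Y →ₗ[k] W}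
    (hf : IsMulHom mX mZ f) (hg : IsMulHom mY mW g) :
    IsMulHom (tensorMul mX mY) (tensorMul mZ mW) (TensorProduct.map f g) := by
  rw [IsMulHom]
  ext x y x' y'
  have h1 := hf.apply (x ⊗ₜ x')
  have h2 := hg.apply (y ⊗ₜ y')
  simp only [TensorProduct.map_tmul] at h1 h2
  simp [BraidedLie.tensorMul, h1, h2]

lemma isComoduleHom_tensorMul_lft {mX : X ⊗[k] X →ₗ[k] X} {ρ : X →ₗ[k] X ⊗[k] A}
    (h : IsComoduleHom (mulCo (lft ρ) (rgt ρ)) ρ mX) (mY : Y ⊗[k] Y →ₗ[k] Y) :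
    IsComoduleHom (mulCo (lft (lft ρ)) (rgt (lft ρ))) (lft ρ) (tensorMul mX mY) := by
  have h1 := h.map_lft mY
  rw [lft_mulCo] at h1
  exact h1.comp ((isComoduleHom_ttt₁ X Y X Y ρ).mulCo (isComoduleHom_ttt₃ X Y X Y ρ))

lemma isComoduleHom_tensorMul_rgt {mY : Y ⊗[k] Y →ₗ[k] Y} {ρ : Y →ₗ[k] Y ⊗[k] A}
    (h : IsComoduleHom (mulCo (lft ρ) (rgt ρ)) ρ mY) (mX : X ⊗[k] X →ₗ[k] X) :
    IsComoduleHom (mulCo (lft (rgt ρ)) (rgt (rgt ρ))) (rgt ρ) (tensorMul mX mY) := by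
  have h1 := h.map_rgt mX
  rw [rgt_mulCo] at h1
  exact h1.comp ((isComoduleHom_ttt₂ X Y X Y ρ).mulCo (isComoduleHom_ttt₄ X Y X Y ρ))

/-- The braided product on `X ⊗ Y`. -/
def braidedMul (R : A ⊗[k] A →ₗ[k] k) (ρX : X →ₗ[k] X ⊗[k] A) (ρY : Y →ₗ[k] Y ⊗[k] A)
    (mX : X ⊗[k] X →ₗ[k] X) (mY : Y ⊗[k] Y →ₗ[k] Y) :
    (X ⊗[k] Y) ⊗[k] (X ⊗[k] Y) →ₗ[k] X ⊗[k] Y :=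
  tensorMul mX mY ∘ₗ Rop R (lft (rgt ρY)) (rgt (lft ρX))

variable {ρX : X →ₗ[k] X ⊗[k] A} {ρY : Y →ₗ[k] Y ⊗[k] A} {ρZ : Z →ₗ[k] Z ⊗[k] A}
variable {mX : X ⊗[k] X →ₗ[k] X} {mY : Y ⊗[k] Y →ₗ[k] Y} {mZ : Z ⊗[k] Z →ₗ[k] Z}

lemma braidedMul_apply (x : (X ⊗[k] Y) ⊗[k] (X ⊗[k] Y)) : braidedMul R ρX ρY mX mY x =
    tensorMul mX mY (Rop R (lft (rgt ρY)) (rgt (lft ρX)) x) := rfl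

lemma braidedMul_self : braidedMul R ρX ρX mX mX =
    TensorProduct.map mX mX ∘ₗ middle (braiding R ρX ρX) := by
  rw [middle_braiding, braidedMul, tensorMul, LinearMap.comp_assoc]

lemma IsMulHom.braidedMul {ρW : W →ₗ[k] W ⊗[k] A} {mW : W ⊗[k] W →ₗ[k] W} {f : X →ₗ[k] Z}
    {g : Y →ₗ[k] W} (hf : IsMulHom mX mZ f) (hg : IsMulHom mY mW g)
    (hf' : IsComoduleHom ρX ρZ f) (hg' : IsComoduleHom ρY ρW g) :
    IsMulHom (braidedMul R ρX ρY mX mY) (braidedMul R ρZ ρW mZ mW) (TensorProduct.map f g) := by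
  rw [IsMulHom, BraidedLie.braidedMul, ← LinearMap.comp_assoc, hf.tensorMul hg,
    LinearMap.comp_assoc, BraidedLie.braidedMul, LinearMap.comp_assoc,
    Rop_natural R ((hg'.map_rgt f).map_lft (TensorProduct.map f g))
      ((hf'.map_lft g).map_rgt (TensorProduct.map f g))]

/-- For three copies of X ⊗ Y both sides move y₁ past x₂ and x₃, and y₂ past x₃, before multiplying
componentwise. The orders differ only in operators on disjoint factors, so Yang–Baxter is not
needed. -/
lemma braidedMul_assoc (hR : IsCoquasitriangular R) [IsCoaction ρX] [IsCoaction ρY]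
    (hX : IsComoduleHom (mulCo (lft ρX) (rgt ρX)) ρX mX)
    (hY : IsComoduleHom (mulCo (lft ρY) (rgt ρY)) ρY mY)
    (aX : mX ∘ₗ TensorProduct.map mX LinearMap.id = mX ∘ₗ TensorProduct.map LinearMap.id mX ∘ₗ
      (TensorProduct.assoc k X X X).toLinearMap)
    (aY : mY ∘ₗ TensorProduct.map mY LinearMap.id = mY ∘ₗ TensorProduct.map LinearMap.id mY ∘ₗ
      (TensorProduct.assoc k Y Y Y).toLinearMap) :
    braidedMul R ρX ρY mX mY ∘ₗ TensorProduct.map (braidedMul R ρX ρY mX mY) LinearMap.id =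
      braidedMul R ρX ρY mX mY ∘ₗ TensorProduct.map LinearMap.id (braidedMul R ρX ρY mX mY) ∘ₗ
        (TensorProduct.assoc k (X ⊗[k] Y) (X ⊗[k] Y) (X ⊗[k] Y)).toLinearMap := by
  have hP : tensorMul mX mY ∘ₗ TensorProduct.map (tensorMul mX mY) LinearMap.id =
      tensorMul mX mY ∘ₗ TensorProduct.map LinearMap.id (tensorMul mX mY) ∘ₗ
        (TensorProduct.assoc k (X ⊗[k] Y) (X ⊗[k] Y) (X ⊗[k] Y)).toLinearMap := by
    ext x y x' y' x'' y''
    have h1 := LinearMap.congr_fun aX ((x ⊗ₜ x') ⊗ₜ x'')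
    have h2 := LinearMap.congr_fun aY ((y ⊗ₜ y') ⊗ₜ y'')
    simp only [LinearMap.comp_apply, TensorProduct.map_tmul, LinearMap.id_apply,
      LinearEquiv.coe_coe, TensorProduct.assoc_tmul] at h1 h2
    simp [tensorMul, h1, h2]
  have hP' (y) := LinearMap.congr_fun hP y
  refine LinearMap.ext fun w => ?_
  have pY := isComoduleHom_tensorMul_rgt hY mX
  have pX := isComoduleHom_tensorMul_lft hX mY
  have i1 := pY.map_lft (LinearMap.id : X ⊗[k] Y →ₗ[k] X ⊗[k] Y)
  have i2 := (IsComoduleHom.id (lft ρX : X ⊗[k] Y →ₗ[k] _)).map_rgt (tensorMul mX mY)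
  have i3 := (IsComoduleHom.id (rgt ρY : X ⊗[k] Y →ₗ[k] _)).map_lft (tensorMul mX mY)
  have i4 := pX.map_rgt (LinearMap.id : X ⊗[k] Y →ₗ[k] X ⊗[k] Y)
  have n1 (y) := Rop_natural_apply R
    (isComoduleHom_assoc₁ (X ⊗[k] Y) (X ⊗[k] Y) (X ⊗[k] Y) (rgt ρY))
    (isComoduleHom_assoc₂ (X ⊗[k] Y) (X ⊗[k] Y) (X ⊗[k] Y) (lft ρX)) y
  have n2 (y) := Rop_natural_apply R
    (isComoduleHom_assoc₁ (X ⊗[k] Y) (X ⊗[k] Y) (X ⊗[k] Y) (rgt ρY))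
    (isComoduleHom_assoc₃ (X ⊗[k] Y) (X ⊗[k] Y) (X ⊗[k] Y) (lft ρX)) y
  have n3 (y) := Rop_natural_apply R
    (isComoduleHom_assoc₂ (X ⊗[k] Y) (X ⊗[k] Y) (X ⊗[k] Y) (rgt ρY))
    (isComoduleHom_assoc₃ (X ⊗[k] Y) (X ⊗[k] Y) (X ⊗[k] Y) (lft ρX)) y
  simp only [LinearMap.comp_apply, LinearEquiv.coe_coe] at hP' n1 n2 n3
  rw [braidedMul]
  simp only [LinearMap.comp_apply, LinearEquiv.coe_coe]
  rw [map_Rop_left, map_Rop_right, Rop_natural_apply R i1 i2, Rop_natural_apply R i3 i4,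
    lft_mulCo, rgt_mulCo, Rop_mulCo_left_apply hR, Rop_mulCo_right_apply hR, n3, n1, n2, hP',
    Rop_comm_apply R R (lft (rgt (rgt ρY))) (rgt (lft ρX)) (lft (lft (rgt ρY)))
      (lft (rgt (lft ρX)))]

/-- The operator turns the legs x₁ y₁ x₂ y₂ into x₁ x₂ y₁ y₂, the order of the componentwise
product. -/
lemma isComoduleHom_braidedMul (hR : IsCoquasitriangular R) [h₁ : IsCoaction ρX]
    [h₂ : IsCoaction ρY]
    (hX : IsComoduleHom (mulCo (lft ρX) (rgt ρX)) ρX mX)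
    (hY : IsComoduleHom (mulCo (lft ρY) (rgt ρY)) ρY mY) :
    IsComoduleHom (mulCo (lft (mulCo (lft ρX) (rgt ρY))) (rgt (mulCo (lft ρX) (rgt ρY))))
      (mulCo (lft ρX) (rgt ρY)) (braidedMul R ρX ρY mX mY) := by
  have h1 := (isComoduleHom_tensorMul_lft hX mY).mulCo (isComoduleHom_tensorMul_rgt hY mX)
  have c1 : IsComoduleHom (lft (lft ρX)) (lft (lft ρX))
      (Rop R (lft (rgt ρY)) (rgt (lft ρX)) : (X ⊗[k] Y) ⊗[k] (X ⊗[k] Y) →ₗ[k] _) :=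
    isComoduleHom_Rop R Commutes.out Commutes.out
  have c2 : IsComoduleHom (rgt (rgt ρY)) (rgt (rgt ρY))
      (Rop R (lft (rgt ρY)) (rgt (lft ρX)) : (X ⊗[k] Y) ⊗[k] (X ⊗[k] Y) →ₗ[k] _) :=
    isComoduleHom_Rop R Commutes.out Commutes.out
  have h2 := (c1.mulCo (isComoduleHom_Rop_mulCo hR
    (comm_lft_rgt (rgt ρY : X ⊗[k] Y →ₗ[k] _) (lft ρX : X ⊗[k] Y →ₗ[k] _))
    h₂.out.rgt.lft h₁.out.lft.rgt)).mulCo c2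
  rw [← mulCo_assoc (lft (lft ρX)), mulCo_assoc _ (rgt (lft ρX)), ← lft_mulCo, ← rgt_mulCo,
    ← mulCo_assoc (lft (lft ρX)), mulCo_assoc _ (lft (rgt ρY))] at h2
  exact h1.comp h2

/-- Needed to compare the two iterated coproducts of U(L). Each side moves z₁ past x₂ and y₂, and y₁
past x₂; the two operators that occur in different orders commute. -/
lemma isMulHom_assoc (hR : IsCoquasitriangular R) [IsCoaction ρX] [IsCoaction ρZ] :
    IsMulHom (braidedMul R (mulCo (lft ρX) (rgt ρY)) ρZ (braidedMul R ρX ρY mX mY) mZ)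
      (braidedMul R ρX (mulCo (lft ρY) (rgt ρZ)) mX (braidedMul R ρY ρZ mY mZ))
      (TensorProduct.assoc k X Y Z).toLinearMap := by
  refine LinearMap.ext fun w => ?_
  have hP : (TensorProduct.assoc k X Y Z).toLinearMap ∘ₗ tensorMul (tensorMul mX mY) mZ =
      tensorMul mX (tensorMul mY mZ) ∘ₗ TensorProduct.map
        (TensorProduct.assoc k X Y Z).toLinearMap (TensorProduct.assoc k X Y Z).toLinearMap := by
    ext; simp [tensorMul]
  have hP' (y) := LinearMap.congr_fun hP y
  have e1 (y : ((X ⊗[k] Y) ⊗[k] Z) ⊗[k] ((X ⊗[k] Y) ⊗[k] Z)) :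
      tensorMul (braidedMul R ρX ρY mX mY) mZ y = tensorMul (tensorMul mX mY) mZ
        (Rop R (lft (lft (rgt ρY))) (rgt (lft (lft ρX))) y) := by
    have n := Rop_natural_apply R (isComoduleHom_ttt₁ (X ⊗[k] Y) Z (X ⊗[k] Y) Z (rgt ρY))
      (isComoduleHom_ttt₃ (X ⊗[k] Y) Z (X ⊗[k] Y) Z (lft ρX)) y
    simp only [LinearEquiv.coe_coe] at n
    rw [braidedMul]
    simp only [tensorMul, LinearMap.comp_apply, LinearEquiv.coe_coe]
    rw [← n, ← map_Rop_left]
  have e2 (y : (X ⊗[k] (Y ⊗[k] Z)) ⊗[k] (X ⊗[k] (Y ⊗[k] Z))) :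
      tensorMul mX (braidedMul R ρY ρZ mY mZ) y = tensorMul mX (tensorMul mY mZ)
        (Rop R (lft (rgt (rgt ρZ))) (rgt (rgt (lft ρY))) y) := by
    have n := Rop_natural_apply R (isComoduleHom_ttt₂ X (Y ⊗[k] Z) X (Y ⊗[k] Z) (rgt ρZ))
      (isComoduleHom_ttt₄ X (Y ⊗[k] Z) X (Y ⊗[k] Z) (lft ρY)) y
    simp only [LinearEquiv.coe_coe] at n
    rw [braidedMul]
    simp only [tensorMul, LinearMap.comp_apply, LinearEquiv.coe_coe]
    rw [← n, ← map_Rop_right]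
  let a := (TensorProduct.assoc k X Y Z).toLinearMap
  have l1 := (isComoduleHom_assoc₂ X Y Z ρY).map_lft a
  have l2 := (isComoduleHom_assoc₃ X Y Z ρZ).map_lft a
  have r0 := (isComoduleHom_assoc₁ X Y Z ρX).map_rgt a
  have r1 := (isComoduleHom_assoc₂ X Y Z ρY).map_rgt a
  simp only [LinearMap.comp_apply] at hP'
  rw [LinearMap.comp_apply, LinearMap.comp_apply, braidedMul_apply, braidedMul_apply, e1, e2, hP', lft_mulCo, rgt_mulCo, rgt_mulCo, lft_mulCo, Rop_mulCo_right_apply hR,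
    Rop_mulCo_left_apply hR]
  rw [Rop_natural_apply R l2 r0, Rop_natural_apply R l1 r0, Rop_natural_apply R l2 r1,
    Rop_comm_apply R R (lft (lft (rgt ρY))) (rgt (lft (lft ρX))) (lft (rgt ρZ))
      (rgt (lft (rgt ρY)))]

lemma isMulHom_counit_left (hR : IsCoquasitriangular R) [h : IsCoaction ρY] {ε : X →ₗ[k] k}
    (hε : IsComoduleHom ρX (triv : k →ₗ[k] k ⊗[k] A) ε)
    (hε' : IsMulHom mX (LinearMap.mul' k k) ε) :
    IsMulHom (braidedMul R ρX ρY mX mY) mY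
      ((TensorProduct.lid k Y).toLinearMap ∘ₗ TensorProduct.map ε LinearMap.id) := by
  refine IsMulHom.comp ?_ (hε'.braidedMul (IsMulHom.id mY) hε (IsComoduleHom.id ρY))
  rw [IsMulHom, braidedMul, lft_triv, rgt_triv, Rop_triv_right hR h.out.rgt.lft,
    LinearMap.comp_id]
  ext; simp [tensorMul]

lemma isMulHom_counit_right (hR : IsCoquasitriangular R) [h : IsCoaction ρX] {ε : Y →ₗ[k] k}
    (hε : IsComoduleHom ρY (triv : k →ₗ[k] k ⊗[k] A) ε)
    (hε' : IsMulHom mY (LinearMap.mul' k k) ε) :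
    IsMulHom (braidedMul R ρX ρY mX mY) mX
      ((TensorProduct.rid k X).toLinearMap ∘ₗ TensorProduct.map LinearMap.id ε) := by
  refine IsMulHom.comp ?_ ((IsMulHom.id mX).braidedMul hε' (IsComoduleHom.id ρX) hε)
  rw [IsMulHom, braidedMul, rgt_triv, lft_triv, Rop_triv_left hR h.out.lft.rgt,
    LinearMap.comp_id]
  ext; simp [tensorMul]

lemma isMulHom_coaction (h : IsComoduleHom (tensorCoaction ρX ρX) ρX mX) :
    IsMulHom mX (tensorMul mX (LinearMap.mul' k A)) ρX := by
  rw [IsMulHom, h, tensorCoaction, tensorMul, ← LinearMap.comp_assoc, ← TensorProduct.map_comp]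
  simp [LinearMap.comp_assoc]

/-! ### The universal property of the enveloping algebra -/

section Universal

variable {Ψt : X ⊗[k] X →ₗ[k] X ⊗[k] X}

lemma Enveloping.induction {P : Enveloping Ψt → Prop}
    (algebraMap : ∀ c, P (algebraMap k _ c)) (ι : ∀ v, P (Enveloping.ι Ψt v))
    (mul : ∀ x y, P x → P y → P (x * y)) (add : ∀ x y, P x → P y → P (x + y))
    (x : Enveloping Ψt) : P x := by
  obtain ⟨x, rfl⟩ := RingQuot.mkAlgHom_surjective k (EnvelopingRel Ψt) x
  induction x using TensorAlgebra.induction with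
  | algebraMap c => simpa using algebraMap c
  | ι v => exact ι v
  | mul x y hx hy => simpa using mul _ _ hx hy
  | add x y hx hy => simpa using add _ _ hx hy

lemma Enveloping.mul_ι : LinearMap.mul' k (Enveloping Ψt) ∘ₗ
      TensorProduct.map (Enveloping.ι Ψt) (Enveloping.ι Ψt) ∘ₗ Ψt =
    LinearMap.mul' k (Enveloping Ψt) ∘ₗ
      TensorProduct.map (Enveloping.ι Ψt) (Enveloping.ι Ψt) := by
  have h : LinearMap.mul' k (Enveloping Ψt) ∘ₗ
      TensorProduct.map (Enveloping.ι Ψt) (Enveloping.ι Ψt) =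
      (RingQuot.mkAlgHom k (EnvelopingRel Ψt)).toLinearMap ∘ₗ
      LinearMap.mul' k (TensorAlgebra k X) ∘ₗ
        TensorProduct.map (TensorAlgebra.ι k) (TensorAlgebra.ι k) := by
    ext; simp [Enveloping.ι]
  rw [← LinearMap.comp_assoc, h]
  ext1
  ext x y
  exact (RingQuot.mkAlgHom_rel k (EnvelopingRel.rel (x ⊗ₜ y))).symm

lemma Enveloping.hom_ext {M : Y ⊗[k] Y →ₗ[k] Y} {f g : Enveloping Ψt →ₗ[k] Y}
    (hf : IsMulHom (LinearMap.mul' k _) M f) (hg : IsMulHom (LinearMap.mul' k _) M g)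
    (h1 : f 1 = g 1) (h : f ∘ₗ Enveloping.ι Ψt = g ∘ₗ Enveloping.ι Ψt) : f = g := by
  refine LinearMap.ext fun x => ?_
  induction x using Enveloping.induction with
  | algebraMap c => rw [Algebra.algebraMap_eq_smul_one, map_smul, map_smul, h1]
  | ι v => exact LinearMap.congr_fun h v
  | mul x y hx hy =>
    have e1 := hf.apply (x ⊗ₜ y)
    have e2 := hg.apply (x ⊗ₜ y)
    simp only [LinearMap.mul'_apply, TensorProduct.map_tmul] at e1 e2
    rw [e1, e2, hx, hy]
  | add x y hx hy => rw [map_add, map_add, hx, hy]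

/-- The product `M` is only a linear map, so the lift goes through left multiplications into
`Module.End k Y`, an honest algebra, and is then evaluated at `e`. This serves for the coaction, the
coproduct, the counit and the final morphism alike. -/
lemma Enveloping.exists_lift {M : Y ⊗[k] Y →ₗ[k] Y} {e : Y}
    (assoc : M ∘ₗ TensorProduct.map M LinearMap.id = M ∘ₗ TensorProduct.map LinearMap.id M ∘ₗ
      (TensorProduct.assoc k Y Y Y).toLinearMap)
    (one_mul : ∀ y, M (e ⊗ₜ y) = y) (mul_one : ∀ y, M (y ⊗ₜ e) = y) {f : X →ₗ[k] Y}
    (hf : M ∘ₗ TensorProduct.map f f ∘ₗ Ψt = M ∘ₗ TensorProduct.map f f) :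
    ∃ g : Enveloping Ψt →ₗ[k] Y, g ∘ₗ Enveloping.ι Ψt = f ∧ g 1 = e ∧
      IsMulHom (LinearMap.mul' k _) M g := by
  have assoc' (a b c : Y) : M (M (a ⊗ₜ b) ⊗ₜ c) = M (a ⊗ₜ M (b ⊗ₜ c)) := by
    have := LinearMap.congr_fun assoc ((a ⊗ₜ b) ⊗ₜ c)
    simpa using this
  let l : Y →ₗ[k] Module.End k Y := TensorProduct.curry M
  have hl (a b : Y) : l a b = M (a ⊗ₜ b) := rfl
  let φ : TensorAlgebra k X →ₐ[k] Module.End k Y := TensorAlgebra.lift k (l ∘ₗ f)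
  have hφ (x : X ⊗[k] X) : φ (LinearMap.mul' k (TensorAlgebra k X)
      (TensorProduct.map (TensorAlgebra.ι k) (TensorAlgebra.ι k) x)) =
      l (M (TensorProduct.map f f x)) := by
    induction x using TensorProduct.induction_on with
    | zero => simp
    | add x y hx hy => simp only [map_add, hx, hy]
    | tmul x y =>
      ext z
      simp [φ, hl, assoc']
  let ψ : Enveloping Ψt →ₐ[k] Module.End k Y := RingQuot.liftAlgHom k ⟨φ, by
    rintro _ _ ⟨x⟩
    rw [hφ, hφ]
    exact congrArg l (LinearMap.congr_fun hf x).symm⟩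
  have hψ (v : X) : ψ (Enveloping.ι Ψt v) = l (f v) := by
    simp [ψ, Enveloping.ι, φ]
  -- Every operator in the image is left multiplication by its value at `e`, which makes evaluation
  -- at `e` multiplicative.
  have key (x : Enveloping Ψt) : ∀ y, ψ x y = M (ψ x e ⊗ₜ y) := by
    induction x using Enveloping.induction with
    | algebraMap c => intro y; simp [one_mul, Algebra.algebraMap_eq_smul_one, ← TensorProduct.smul_tmul']
    | ι v => intro y; rw [hψ, hl, hl, mul_one]
    | mul x z hx hz =>
      intro y
      rw [map_mul, Module.End.mul_apply, Module.End.mul_apply, hx, hz, hx (ψ z e), assoc']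
    | add x z hx hz =>
      intro y
      rw [map_add, LinearMap.add_apply, LinearMap.add_apply, hx, hz, add_tmul, map_add]
  refine ⟨(LinearMap.applyₗ e) ∘ₗ ψ.toLinearMap, ?_, ?_, ?_⟩
  · ext v
    simp [hψ, hl, mul_one]
  · simp
  · rw [IsMulHom]
    ext x y
    simp [← key]

end Universal

/-! ### The bialgebra structure of the enveloping algebra -/

lemma coassoc_natural {C D : Type*} [AddCommMonoid C] [Module k C] [AddCommMonoid D] [Module k D]
    {f : X →ₗ[k] Y} {g : C →ₗ[k] D} {δX : X →ₗ[k] X ⊗[k] C} {δY : Y →ₗ[k] Y ⊗[k] D}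
    (h : δY ∘ₗ f = TensorProduct.map f g ∘ₗ δX) :
    ((TensorProduct.assoc k Y D D).toLinearMap ∘ₗ TensorProduct.map δY LinearMap.id ∘ₗ δY) ∘ₗ f =
      TensorProduct.map f (TensorProduct.map g g) ∘ₗ
        (TensorProduct.assoc k X C C).toLinearMap ∘ₗ TensorProduct.map δX LinearMap.id ∘ₗ δX := by
  have e : (TensorProduct.assoc k Y D D).toLinearMap ∘ₗ
      TensorProduct.map (TensorProduct.map f g) g =
      TensorProduct.map f (TensorProduct.map g g) ∘ₗ
        (TensorProduct.assoc k X C C).toLinearMap := by ext; simp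
  have e' (y) := LinearMap.congr_fun e y
  refine LinearMap.ext fun x => ?_
  have hx := LinearMap.congr_fun h x
  simp only [LinearMap.comp_apply] at hx e' ⊢
  rw [hx, ← e', TensorProduct.map_map, TensorProduct.map_map, h]
  simp

lemma tensorMul_mul' (B C : Type*) [Semiring B] [Algebra k B] [Semiring C] [Algebra k C] :
    tensorMul (LinearMap.mul' k B) (LinearMap.mul' k C) = LinearMap.mul' k (B ⊗[k] C) := by
  ext; simp [tensorMul]

lemma isMulHom_algHom {B C : Type*} [Semiring B] [Algebra k B] [Semiring C] [Algebra k C]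
    (f : B →ₐ[k] C) : IsMulHom (LinearMap.mul' k B) (LinearMap.mul' k C) f.toLinearMap := by
  rw [IsMulHom]
  ext; simp

lemma mul'_assoc (B : Type*) [Semiring B] [Algebra k B] :
    LinearMap.mul' k B ∘ₗ TensorProduct.map (LinearMap.mul' k B) LinearMap.id =
      LinearMap.mul' k B ∘ₗ TensorProduct.map LinearMap.id (LinearMap.mul' k B) ∘ₗ
        (TensorProduct.assoc k B B B).toLinearMap := by
  ext; simp [mul_assoc]

lemma isMulHom_comul : IsMulHom (LinearMap.mul' k A)
    (tensorMul (LinearMap.mul' k A) (LinearMap.mul' k A)) (coR k A) := by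
  rw [tensorMul_mul']
  exact isMulHom_algHom (Bialgebra.comulAlgHom k A)

lemma isMulHom_assoc_tensorMul (mX : X ⊗[k] X →ₗ[k] X) (mY : Y ⊗[k] Y →ₗ[k] Y)
    (mZ : Z ⊗[k] Z →ₗ[k] Z) : IsMulHom (tensorMul (tensorMul mX mY) mZ)
      (tensorMul mX (tensorMul mY mZ)) (TensorProduct.assoc k X Y Z).toLinearMap := by
  rw [IsMulHom]
  ext; simp [tensorMul]

lemma isComoduleHom_mk_triv_left {ρ : X →ₗ[k] X ⊗[k] A} {x : X} (hx : ρ x = x ⊗ₜ 1) :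
    IsComoduleHom triv (lft ρ) (TensorProduct.mk k X Y x) := by
  rw [IsComoduleHom]
  ext; simp [lft, hx]

lemma isComoduleHom_mk_triv_right {ρ : Y →ₗ[k] Y ⊗[k] A} {y : Y} (hy : ρ y = y ⊗ₜ 1) :
    IsComoduleHom triv (rgt ρ) ((TensorProduct.mk k X Y).flip y) := by
  rw [IsComoduleHom]
  ext; simp [rgt, hy]

section Unit

variable {B C : Type*} [Semiring B] [Algebra k B] [Semiring C] [Algebra k C]
variable {ρB : B →ₗ[k] B ⊗[k] A} {ρC : C →ₗ[k] C ⊗[k] A}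

lemma one_braidedMul (hR : IsCoquasitriangular R) [IsCoaction ρB] (h : ρC 1 = 1 ⊗ₜ 1)
    (y : B ⊗[k] C) :
    braidedMul R ρB ρC (LinearMap.mul' k B) (LinearMap.mul' k C) ((1 ⊗ₜ 1) ⊗ₜ y) = y := by
  have h1 : rgt ρC ((1 : B) ⊗ₜ[k] (1 : C)) = (1 ⊗ₜ 1) ⊗ₜ 1 := by simp [rgt, h]
  have n := Rop_natural_apply R (isComoduleHom_mk_triv_left h1)
    (isComoduleHom_mk_rgt (lft ρB) ((1 : B) ⊗ₜ[k] (1 : C))) y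
  rw [Rop_triv_left_apply hR, TensorProduct.mk_apply] at n
  rw [braidedMul_apply, n, tensorMul_mul', LinearMap.mul'_apply,
    ← Algebra.TensorProduct.one_def, one_mul]

lemma braidedMul_one (hR : IsCoquasitriangular R) [IsCoaction ρC] (h : ρB 1 = 1 ⊗ₜ 1)
    (y : B ⊗[k] C) :
    braidedMul R ρB ρC (LinearMap.mul' k B) (LinearMap.mul' k C) (y ⊗ₜ (1 ⊗ₜ 1)) = y := by
  have h1 : lft ρB ((1 : B) ⊗ₜ[k] (1 : C)) = (1 ⊗ₜ 1) ⊗ₜ 1 := by simp [lft, h]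
  have n := Rop_natural_apply R
    (isComoduleHom_mk_lft (rgt ρC) ((1 : B) ⊗ₜ[k] (1 : C))) (isComoduleHom_mk_triv_right h1) y
  rw [Rop_triv_right_apply hR, LinearMap.flip_apply, TensorProduct.mk_apply] at n
  rw [braidedMul_apply, n, tensorMul_mul', LinearMap.mul'_apply,
    ← Algebra.TensorProduct.one_def, mul_one]

end Unit

section Enveloping

variable {ρ : X →ₗ[k] X ⊗[k] A} {Δ : X →ₗ[k] X ⊗[k] X} {ε : X →ₗ[k] k}
  {Ψt : X ⊗[k] X →ₗ[k] X ⊗[k] X}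

/-- The relations survive because `Ψt` is a comodule map. The coaction axioms compare multiplicative
maps that agree on generators. -/
lemma Enveloping.exists_coaction (hρ : IsRightComodule ρ)
    (h : IsComoduleHom (tensorCoaction ρ ρ) (tensorCoaction ρ ρ) Ψt) :
    ∃ ρU : Enveloping Ψt →ₗ[k] Enveloping Ψt ⊗[k] A,
      ρU ∘ₗ Enveloping.ι Ψt = TensorProduct.map (Enveloping.ι Ψt) LinearMap.id ∘ₗ ρ ∧
      ρU 1 = 1 ⊗ₜ 1 ∧
      IsMulHom (LinearMap.mul' k _) (tensorMul (LinearMap.mul' k _) (LinearMap.mul' k A)) ρU ∧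
      IsRightComodule ρU := by
  have hf : tensorMul (LinearMap.mul' k (Enveloping Ψt)) (LinearMap.mul' k A) ∘ₗ
      TensorProduct.map (TensorProduct.map (Enveloping.ι Ψt) LinearMap.id ∘ₗ ρ)
        (TensorProduct.map (Enveloping.ι Ψt) LinearMap.id ∘ₗ ρ) =
      TensorProduct.map (LinearMap.mul' k (Enveloping Ψt) ∘ₗ TensorProduct.map (Enveloping.ι Ψt)
        (Enveloping.ι Ψt)) LinearMap.id ∘ₗ tensorCoaction ρ ρ := by
    have e : tensorMul (LinearMap.mul' k (Enveloping Ψt)) (LinearMap.mul' k A) ∘ₗ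
        TensorProduct.map (TensorProduct.map (Enveloping.ι Ψt) LinearMap.id)
        (TensorProduct.map (Enveloping.ι Ψt) LinearMap.id) =
        TensorProduct.map (LinearMap.mul' k (Enveloping Ψt) ∘ₗ TensorProduct.map (Enveloping.ι Ψt)
          (Enveloping.ι Ψt)) LinearMap.id ∘ₗ TensorProduct.map LinearMap.id (LinearMap.mul' k A) ∘ₗ
        (TensorProduct.tensorTensorTensorComm k X A X A).toLinearMap := by
      ext; simp [tensorMul]
    rw [TensorProduct.map_comp, ← LinearMap.comp_assoc, e, tensorCoaction]
    simp only [LinearMap.comp_assoc]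
  obtain ⟨ρU, h1, h2, h3⟩ := Enveloping.exists_lift (Ψt := Ψt) (e := 1)
    (M := tensorMul (LinearMap.mul' k (Enveloping Ψt)) (LinearMap.mul' k A))
    (f := TensorProduct.map (Enveloping.ι Ψt) LinearMap.id ∘ₗ ρ)
    (by rw [tensorMul_mul']; exact mul'_assoc _) (by simp [tensorMul_mul'])
    (by simp [tensorMul_mul']) (by
      rw [← LinearMap.comp_assoc, hf, LinearMap.comp_assoc, h, ← LinearMap.comp_assoc,
        ← TensorProduct.map_comp, LinearMap.comp_assoc, Enveloping.mul_ι, LinearMap.id_comp])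
  refine ⟨ρU, h1, h2, h3, ?_, ?_⟩
  · refine Enveloping.hom_ext
      (((isMulHom_assoc_tensorMul _ _ _).comp (h3.tensorMul (IsMulHom.id _))).comp h3)
      (((IsMulHom.id _).tensorMul isMulHom_comul).comp h3) ?_ ?_
    · simp [h2, Algebra.TensorProduct.one_def]
    · have := coassoc_natural h1
      simp only [TensorProduct.map_id] at this
      rw [this, hρ.coassoc, LinearMap.comp_assoc,
        h1, ← LinearMap.comp_assoc, ← LinearMap.comp_assoc, ← TensorProduct.map_comp,
        ← TensorProduct.map_comp]
      simp
  · rw [← LinearMap.comp_assoc]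
    refine Enveloping.hom_ext (M := LinearMap.mul' k _) (IsMulHom.comp ?_ h3) (IsMulHom.id _) ?_ ?_
    · rw [IsMulHom]
      ext
      simp only [tensorMul, AlgebraTensorModule.curry_apply, curry_apply,
        LinearMap.coe_restrictScalars, LinearMap.comp_apply, LinearEquiv.coe_coe,
        TensorProduct.tensorTensorTensorComm_tmul, TensorProduct.map_tmul, LinearMap.id_apply,
        LinearMap.mul'_apply, Bialgebra.counit_mul, TensorProduct.rid_tmul, smul_mul_smul_comm]
    · simp [h2, Algebra.TensorProduct.one_def]
    · refine LinearMap.ext fun x => ?_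
      have e := LinearMap.congr_fun h1 x
      have e' := LinearMap.congr_fun hρ.counit x
      simp only [LinearMap.comp_apply, LinearMap.id_apply] at e e' ⊢
      conv_rhs => rw [← e']
      rw [e]
      generalize ρ x = t
      induction t using TensorProduct.induction_on with
      | zero => simp
      | add x y hx hy => simp only [map_add, hx, hy]
      | tmul x b => simp

theorem Enveloping.exists_bialgebra (hR : IsCoquasitriangular R) (hC : IsCoalgebraIn ρ Δ ε)
    (hΨ : IsComoduleHom (tensorCoaction ρ ρ) (tensorCoaction ρ ρ) Ψt)
    (hΨΔ : middle (braiding R ρ ρ) ∘ₗ TensorProduct.map Δ Δ ∘ₗ Ψt =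
      TensorProduct.map Ψt Ψt ∘ₗ middle (braiding R ρ ρ) ∘ₗ TensorProduct.map Δ Δ)
    (hΨε : LinearMap.mul' k k ∘ₗ TensorProduct.map ε ε ∘ₗ Ψt =
      LinearMap.mul' k k ∘ₗ TensorProduct.map ε ε) :
    ∃ (ρU : Enveloping Ψt →ₗ[k] Enveloping Ψt ⊗[k] A)
      (ΔU : Enveloping Ψt →ₗ[k] Enveloping Ψt ⊗[k] Enveloping Ψt) (εU : Enveloping Ψt →ₗ[k] k),
      IsBialgebraIn R ρU (LinearMap.mul' k _) (Algebra.linearMap k _) ΔU εU ∧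
      ρU ∘ₗ Enveloping.ι Ψt = TensorProduct.map (Enveloping.ι Ψt) LinearMap.id ∘ₗ ρ ∧
      ΔU ∘ₗ Enveloping.ι Ψt = TensorProduct.map (Enveloping.ι Ψt) (Enveloping.ι Ψt) ∘ₗ Δ ∧
      εU ∘ₗ Enveloping.ι Ψt = ε := by
  obtain ⟨ρU, hρι, hρ1, hρm, hρ⟩ := Enveloping.exists_coaction (Ψt := Ψt) hC.comodule hΨ
  have hι : IsComoduleHom ρ ρU (Enveloping.ι Ψt) := hρι
  have : IsCoaction ρU := ⟨hρ⟩
  have hm : IsComoduleHom (tensorCoaction ρU ρU) ρU (LinearMap.mul' k (Enveloping Ψt)) := by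
    rw [IsComoduleHom, hρm, tensorCoaction, tensorMul, ← LinearMap.comp_assoc,
      ← TensorProduct.map_comp]
    simp [LinearMap.comp_assoc]
  have hm' := hm
  rw [tensorCoaction_eq] at hm'
  obtain ⟨εU, hει, hε1, hεm⟩ := Enveloping.exists_lift (Ψt := Ψt) (e := (1 : k))
    (M := LinearMap.mul' k k) (f := ε) (mul'_assoc k) (by simp) (by simp) hΨε
  -- The products land on the generators only after the middle braiding. Hence `hΨΔ` moves `Ψt` next
  -- to these products, where the relations of the enveloping algebra absorb it.
  have hfΔ : braidedMul R ρU ρU (LinearMap.mul' k _) (LinearMap.mul' k _) ∘ₗ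
      TensorProduct.map (TensorProduct.map (Enveloping.ι Ψt) (Enveloping.ι Ψt) ∘ₗ Δ)
        (TensorProduct.map (Enveloping.ι Ψt) (Enveloping.ι Ψt) ∘ₗ Δ) =
      TensorProduct.map
        (LinearMap.mul' k _ ∘ₗ TensorProduct.map (Enveloping.ι Ψt) (Enveloping.ι Ψt))
        (LinearMap.mul' k _ ∘ₗ TensorProduct.map (Enveloping.ι Ψt) (Enveloping.ι Ψt)) ∘ₗ
        middle (braiding R ρ ρ) ∘ₗ TensorProduct.map Δ Δ := by
    rw [braidedMul_self, TensorProduct.map_comp, LinearMap.comp_assoc,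
      ← LinearMap.comp_assoc (TensorProduct.map Δ Δ), middle_natural (braiding_natural R hι),
      TensorProduct.map_comp]
    simp only [LinearMap.comp_assoc]
  obtain ⟨ΔU, hΔι, hΔ1, hΔm⟩ := Enveloping.exists_lift (Ψt := Ψt) (e := 1 ⊗ₜ 1)
    (M := braidedMul R ρU ρU (LinearMap.mul' k _) (LinearMap.mul' k _))
    (f := TensorProduct.map (Enveloping.ι Ψt) (Enveloping.ι Ψt) ∘ₗ Δ)
    (braidedMul_assoc hR hm' hm' (mul'_assoc _) (mul'_assoc _)) (one_braidedMul hR hρ1)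
    (braidedMul_one hR hρ1) (by
      rw [← LinearMap.comp_assoc, hfΔ, LinearMap.comp_assoc, LinearMap.comp_assoc, hΨΔ,
        ← LinearMap.comp_assoc, ← TensorProduct.map_comp, LinearMap.comp_assoc,
        Enveloping.mul_ι])
  have hΔc : IsComoduleHom ρU (tensorCoaction ρU ρU) ΔU := by
    have hb := isComoduleHom_braidedMul hR hm' hm'
    rw [← tensorCoaction_eq, ← tensorCoaction_eq] at hb
    refine Enveloping.hom_ext ((isMulHom_coaction hb).comp hΔm)
      ((hΔm.tensorMul (IsMulHom.id _)).comp hρm) ?_ ?_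
    · simp [hΔ1, hρ1, tensorCoaction]
    · rw [LinearMap.comp_assoc, hΔι, ← LinearMap.comp_assoc, hι.tensor, LinearMap.comp_assoc,
        hC.comul_hom, LinearMap.comp_assoc, hρι, ← LinearMap.comp_assoc, ← LinearMap.comp_assoc,
        ← TensorProduct.map_comp, ← TensorProduct.map_comp, hΔι]
  have hεc : IsComoduleHom ρU (unitCoaction k A) εU := by
    have hu : IsMulHom (LinearMap.mul' k k) (tensorMul (LinearMap.mul' k k) (LinearMap.mul' k A))
        (unitCoaction k A) := by
      rw [IsMulHom]; ext; simp [tensorMul, unitCoaction]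
    refine Enveloping.hom_ext (hu.comp hεm) ((hεm.tensorMul (IsMulHom.id _)).comp hρm) ?_ ?_
    · simp [hε1, hρ1, unitCoaction]
    · rw [LinearMap.comp_assoc, hει, hC.counit_hom, LinearMap.comp_assoc, hρι,
        ← LinearMap.comp_assoc, ← TensorProduct.map_comp, hει, LinearMap.comp_id]
  have hΔc' := hΔc
  rw [tensorCoaction_eq] at hΔc'
  refine ⟨ρU, ΔU, εU, ⟨⟨hρ, hm, ?_, mul'_assoc _, ?_, ?_⟩,
    ⟨hρ, hΔc, hεc, ?_, ?_, ?_⟩, ?_, ?_, hεm, ?_⟩, hρι, hΔι, hει⟩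
  · rw [IsComoduleHom]
    ext; simp [hρ1, unitCoaction]
  · ext; simp
  · ext; simp
  -- Both iterated coproducts are multiplicative into the braided triple product; `isMulHom_assoc`
  -- identifies its two bracketings, so generators suffice.
  · refine Enveloping.hom_ext (((isMulHom_assoc hR).comp (hΔm.braidedMul (IsMulHom.id _) hΔc'
      (IsComoduleHom.id _))).comp hΔm) (((IsMulHom.id _).braidedMul hΔm (IsComoduleHom.id _)
      hΔc').comp hΔm) ?_ ?_
    · simp [hΔ1]
    · have := coassoc_natural hΔι
      rw [this, hC.coassoc, LinearMap.comp_assoc,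
        hΔι, ← LinearMap.comp_assoc, ← LinearMap.comp_assoc, ← TensorProduct.map_comp,
        ← TensorProduct.map_comp, hΔι]
      simp
  · rw [← LinearMap.comp_assoc]
    refine Enveloping.hom_ext ((isMulHom_counit_left hR hεc hεm).comp hΔm) (IsMulHom.id _) ?_ ?_
    · simp [hΔ1, hε1]
    · refine LinearMap.ext fun x => ?_
      have e := LinearMap.congr_fun hΔι x
      have e' := LinearMap.congr_fun hC.counit_left x
      simp only [LinearMap.comp_apply, LinearMap.id_apply] at e e' ⊢
      conv_rhs => rw [← e']
      rw [e, ← hει]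
      generalize Δ x = t
      induction t using TensorProduct.induction_on with
      | zero => simp
      | add x y hx hy => simp only [map_add, hx, hy]
      | tmul x b => simp
  · rw [← LinearMap.comp_assoc]
    refine Enveloping.hom_ext ((isMulHom_counit_right hR hεc hεm).comp hΔm) (IsMulHom.id _) ?_ ?_
    · simp [hΔ1, hε1]
    · refine LinearMap.ext fun x => ?_
      have e := LinearMap.congr_fun hΔι x
      have e' := LinearMap.congr_fun hC.counit_right x
      simp only [LinearMap.comp_apply, LinearMap.id_apply] at e e' ⊢
      conv_rhs => rw [← e']
      rw [e, ← hει]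
      generalize Δ x = t
      induction t using TensorProduct.induction_on with
      | zero => simp
      | add x y hx hy => simp only [map_add, hx, hy]
      | tmul x b => simp
  · rw [hΔm, braidedMul_self, LinearMap.comp_assoc]
  · simp [hΔ1]
  · simp [hε1]

theorem Enveloping.exists_bialgebraHom {ρU : Enveloping Ψt →ₗ[k] Enveloping Ψt ⊗[k] A}
    {ΔU : Enveloping Ψt →ₗ[k] Enveloping Ψt ⊗[k] Enveloping Ψt} {εU : Enveloping Ψt →ₗ[k] k}
    (hU : IsBialgebraIn R ρU (LinearMap.mul' k _) (Algebra.linearMap k _) ΔU εU)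
    (hρι : ρU ∘ₗ Enveloping.ι Ψt = TensorProduct.map (Enveloping.ι Ψt) LinearMap.id ∘ₗ ρ)
    (hΔι : ΔU ∘ₗ Enveloping.ι Ψt = TensorProduct.map (Enveloping.ι Ψt) (Enveloping.ι Ψt) ∘ₗ Δ)
    (hει : εU ∘ₗ Enveloping.ι Ψt = ε)
    {ρY : Y →ₗ[k] Y ⊗[k] A} {mY : Y ⊗[k] Y →ₗ[k] Y} {ηY : k →ₗ[k] Y} {ΔY : Y →ₗ[k] Y ⊗[k] Y}
    {εY : Y →ₗ[k] k} (hY : IsBialgebraIn R ρY mY ηY ΔY εY) {f : X →ₗ[k] Y}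
    (hρ : IsComoduleHom ρ ρY f) (hΔ : ΔY ∘ₗ f = TensorProduct.map f f ∘ₗ Δ) (hε : εY ∘ₗ f = ε)
    (hf : mY ∘ₗ TensorProduct.map f f ∘ₗ Ψt = mY ∘ₗ TensorProduct.map f f) :
    ∃ π : Enveloping Ψt →ₗ[k] Y, π ∘ₗ Enveloping.ι Ψt = f ∧
      IsBialgebraHomIn ρU (LinearMap.mul' k _) (Algebra.linearMap k _) ΔU εU ρY mY ηY ΔY εY π := by
  have hUm := isMulHom_coaction hU.algebra.mul_hom
  have hYm := isMulHom_coaction hY.algebra.mul_hom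
  have hρ1 : ρU 1 = 1 ⊗ₜ 1 := by
    have := hU.algebra.unit_hom.apply 1
    simpa [unitCoaction] using this
  have hρY1 : ρY (ηY 1) = ηY 1 ⊗ₜ 1 := by
    have := hY.algebra.unit_hom.apply 1
    simpa [unitCoaction] using this
  have hΔ1 : ΔU 1 = 1 ⊗ₜ 1 := by simpa using hU.comul_unit
  have hε1 : εU 1 = 1 := by simpa using hU.counit_unit
  have hΔm : IsMulHom (LinearMap.mul' k _)
      (braidedMul R ρU ρU (LinearMap.mul' k _) (LinearMap.mul' k _)) ΔU := by
    rw [IsMulHom, braidedMul_self, LinearMap.comp_assoc]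
    exact hU.comul_mul
  have hΔYm : IsMulHom mY (braidedMul R ρY ρY mY mY) ΔY := by
    rw [IsMulHom, braidedMul_self, LinearMap.comp_assoc]
    exact hY.comul_mul
  obtain ⟨π, hπ, hπ1, hπm⟩ := Enveloping.exists_lift (Ψt := Ψt) (e := ηY 1) hY.algebra.assoc
    (fun y => by simpa using LinearMap.congr_fun hY.algebra.unit_left (1 ⊗ₜ y))
    (fun y => by simpa using LinearMap.congr_fun hY.algebra.unit_right (y ⊗ₜ 1)) hf
  have hπc : IsComoduleHom ρU ρY π := by
    refine Enveloping.hom_ext (hYm.comp hπm) ((hπm.tensorMul (IsMulHom.id _)).comp hUm) ?_ ?_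
    · simp [hπ1, hρ1, hρY1]
    · rw [LinearMap.comp_assoc, hπ, hρ, LinearMap.comp_assoc, hρι, ← LinearMap.comp_assoc,
        ← TensorProduct.map_comp, hπ, LinearMap.comp_id]
  refine ⟨π, hπ, hπc, hπm, ?_, ?_, ?_⟩
  · ext; simp [hπ1]
  · refine Enveloping.hom_ext (hΔYm.comp hπm) ((hπm.braidedMul hπm hπc hπc).comp hΔm) ?_ ?_
    · simp [hπ1, hΔ1, hY.comul_unit]
    · rw [LinearMap.comp_assoc, hπ, hΔ, LinearMap.comp_assoc, hΔι, ← LinearMap.comp_assoc,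
        ← TensorProduct.map_comp, hπ]
  · have h1 : IsMulHom mY (LinearMap.mul' k k) εY := hY.counit_mul
    have h2 : IsMulHom (LinearMap.mul' k _) (LinearMap.mul' k k) εU := hU.counit_mul
    refine Enveloping.hom_ext (h1.comp hπm) h2 ?_ ?_
    · simp [hπ1, hε1, hY.counit_unit]
    · rw [LinearMap.comp_assoc, hπ, hε, hει]

end Enveloping

/-! ### Subcoalgebras -/

variable {L : Submodule k A}

lemma exists_comp_eq {f : Y →ₗ[k] Z} (hf : Function.Injective f) {g : X →ₗ[k] Z}
    (h : ∀ x, g x ∈ LinearMap.range f) : ∃ g' : X →ₗ[k] Y, f ∘ₗ g' = g :=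
  ⟨(LinearEquiv.ofInjective f hf).symm.toLinearMap ∘ₗ g.codRestrict _ h, LinearMap.ext fun x => by
    have := congrArg Subtype.val ((LinearEquiv.ofInjective f hf).apply_symm_apply ⟨g x, h x⟩)
    exact this⟩

lemma IsSubcoalgebra.exists_comul (hL : IsSubcoalgebra L) :
    ∃ ΔL : L →ₗ[k] L ⊗[k] L,
      coR k A ∘ₗ L.subtype = TensorProduct.map L.subtype L.subtype ∘ₗ ΔL := by
  obtain ⟨g, hg⟩ := exists_comp_eq (map_injective L.subtype_injective L.subtype_injective)
    (g := coR k A ∘ₗ L.subtype) fun x => hL ⟨x, x.2, rfl⟩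
  exact ⟨g, hg.symm⟩

lemma IsSubcoalgebra.exists_adR (hL : IsSubcoalgebra L) :
    ∃ ρL : L →ₗ[k] L ⊗[k] A, IsComoduleHom ρL (adR k A) L.subtype := by
  obtain ⟨ΔL, hΔ⟩ := hL.exists_comul
  let i := L.subtype
  have h1 : TensorProduct.map LinearMap.id (coR k A) ∘ₗ TensorProduct.map i i =
      TensorProduct.map i (TensorProduct.map i i) ∘ₗ TensorProduct.map LinearMap.id ΔL := by
    rw [← TensorProduct.map_comp, ← TensorProduct.map_comp, hΔ]; rfl
  have h2 : (TensorProduct.leftComm k A A A).toLinearMap ∘ₗ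
      TensorProduct.map i (TensorProduct.map i i) = TensorProduct.map i (TensorProduct.map i i) ∘ₗ
      (TensorProduct.leftComm k L L L).toLinearMap := by ext; simp
  refine ⟨TensorProduct.map LinearMap.id (LinearMap.mul' k A ∘ₗ TensorProduct.map
    (HopfAlgebra.antipode k) LinearMap.id ∘ₗ TensorProduct.map i i) ∘ₗ
    (TensorProduct.leftComm k L L L).toLinearMap ∘ₗ TensorProduct.map LinearMap.id ΔL ∘ₗ ΔL, ?_⟩
  refine LinearMap.ext fun x => ?_
  have h1' (y) := LinearMap.congr_fun h1 y
  have h2' (y) := LinearMap.congr_fun h2 y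
  have hx := LinearMap.congr_fun hΔ x
  simp only [LinearMap.comp_apply] at h1' h2' hx
  simp only [adR, LinearMap.comp_apply]
  rw [hx, h1', h2', TensorProduct.map_map, TensorProduct.map_map]
  simp [i, LinearMap.comp_assoc]

lemma IsSubcoalgebra.exists_coL (hL : IsSubcoalgebra L) :
    ∃ σL : L →ₗ[k] L ⊗[k] A, IsComoduleHom σL (coL k A) L.subtype := by
  obtain ⟨ΔL, hΔ⟩ := hL.exists_comul
  refine ⟨TensorProduct.map LinearMap.id (HopfAlgebra.antipode k ∘ₗ L.subtype) ∘ₗ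
    (TensorProduct.comm k L L).toLinearMap ∘ₗ ΔL, LinearMap.ext fun x => ?_⟩
  have hx := LinearMap.congr_fun hΔ x
  simp only [coL, LinearMap.comp_apply] at hx ⊢
  rw [hx]
  generalize ΔL x = t
  induction t using TensorProduct.induction_on with
  | zero => simp
  | add x y hx hy => simp only [map_add, hx, hy]
  | tmul x b => simp

/-- Both coactions restrict to maps L → L ⊗ A. Since `F` is arbitrary, the operator of the inverse
form is covered too. -/
lemma IsSubcoalgebra.Rop_mem_range (hL : IsSubcoalgebra L) (F : A ⊗[k] A →ₗ[k] k)
    {x : A ⊗[k] A} (hx : x ∈ LinearMap.range (TensorProduct.map L.subtype L.subtype)) :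
    Rop F (lft (adR k A)) (rgt (coL k A)) x ∈
      LinearMap.range (TensorProduct.map L.subtype L.subtype) := by
  obtain ⟨ρL, hρ⟩ := hL.exists_adR
  obtain ⟨σL, hσ⟩ := hL.exists_coL
  obtain ⟨y, rfl⟩ := hx
  rw [Rop_natural_apply F (hρ.map_lft _) (hσ.map_rgt _)]
  exact ⟨_, rfl⟩

lemma map_mem_of_forall {f : A ⊗[k] A →ₗ[k] A} (h : ∀ a ∈ L, ∀ b ∈ L, f (a ⊗ₜ b) ∈ L)
    {x : A ⊗[k] A} (hx : x ∈ LinearMap.range (TensorProduct.map L.subtype L.subtype)) :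
    f x ∈ L := by
  obtain ⟨y, rfl⟩ := hx
  induction y using TensorProduct.induction_on with
  | zero => simp
  | add x y hx hy => simpa only [map_add] using L.add_mem hx hy
  | tmul x y => exact h x x.2 y y.2

lemma tmul_mem_range {a b : A} (ha : a ∈ L) (hb : b ∈ L) :
    a ⊗ₜ[k] b ∈ LinearMap.range (TensorProduct.map L.subtype L.subtype) :=
  ⟨⟨a, ha⟩ ⊗ₜ ⟨b, hb⟩, rfl⟩

lemma IsSubcoalgebra.transMul_mem (hL : IsSubcoalgebra L) (h : ∀ a ∈ L, ∀ b ∈ L, a * b ∈ L)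
    {a b : A} (ha : a ∈ L) (hb : b ∈ L) : transMul R (a ⊗ₜ b) ∈ L := by
  rw [transMul_eq]
  exact map_mem_of_forall (f := LinearMap.mul' k A) (by simpa using h)
    (hL.Rop_mem_range R (tmul_mem_range ha hb))

/-- The ordinary product is • after R⁻¹(ad₁, l₂), and this inverse also preserves L ⊗ L. -/
lemma IsSubcoalgebra.mul_mem (hR : IsCoquasitriangular R) (hL : IsSubcoalgebra L)
    (h : ∀ a ∈ L, ∀ b ∈ L, transMul R (a ⊗ₜ b) ∈ L) {a b : A} (ha : a ∈ L) (hb : b ∈ L) :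
    a * b ∈ L := by
  have e : a * b = transMul R (Rop hR.inv (lft (adR k A)) (rgt (coL k A)) (a ⊗ₜ b)) := by
    rw [transMul_eq, LinearMap.comp_apply, Rop_comp_inv_apply hR, LinearMap.mul'_apply]
  rw [e]
  exact map_mem_of_forall h (hL.Rop_mem_range hR.inv (tmul_mem_range ha hb))

lemma range_map_mono {L' : Submodule k A} (h : L ≤ L') :
    LinearMap.range (TensorProduct.map L.subtype L.subtype) ≤
      LinearMap.range (TensorProduct.map L'.subtype L'.subtype) := by
  rintro _ ⟨y, rfl⟩
  refine ⟨TensorProduct.map (Submodule.inclusion h) (Submodule.inclusion h) y, ?_⟩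
  rw [TensorProduct.map_map]
  rfl

lemma IsSubcoalgebra.adjoin (hL : IsSubcoalgebra L) :
    IsSubcoalgebra (Subalgebra.toSubmodule (Algebra.adjoin k (L : Set A))) := by
  rintro _ ⟨a, ha, rfl⟩
  induction ha using Algebra.adjoin_induction with
  | mem x hx =>
    exact range_map_mono (L := L) (L' := Subalgebra.toSubmodule (Algebra.adjoin k (L : Set A)))
      (fun y hy => Algebra.subset_adjoin hy) (hL ⟨x, hx, rfl⟩)
  | algebraMap r =>
    rw [Bialgebra.comul_algebraMap, Algebra.TensorProduct.algebraMap_apply]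
    exact tmul_mem_range (Subalgebra.algebraMap_mem _ r) (Subalgebra.one_mem _)
  | add x y _ _ hx hy => rw [map_add]; exact add_mem hx hy
  | mul x y _ _ hx hy =>
    rw [Bialgebra.comul_mul]
    -- The tensors supported on the generated subalgebra form the range of an algebra map, hence are
    -- closed under products.
    exact (Algebra.TensorProduct.map (Algebra.adjoin k (L : Set A)).val
      (Algebra.adjoin k (L : Set A)).val).range.mul_mem hx hy

/-- The range is closed under • by construction, the generated subalgebra under the ordinary
product. Both are subcoalgebras, so each is closed under the other product as well, and each
contains the other. -/
lemma range_eq_adjoin (hR : IsCoquasitriangular R) (hL : IsSubcoalgebra L)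
    {Ψt : L ⊗[k] L →ₗ[k] L ⊗[k] L} {ΔU : Enveloping Ψt →ₗ[k] Enveloping Ψt ⊗[k] Enveloping Ψt}
    {π : Enveloping Ψt →ₗ[k] A} (hι : π ∘ₗ Enveloping.ι Ψt = L.subtype) (h1 : π 1 = 1)
    (hm : π ∘ₗ LinearMap.mul' k _ = transMul R ∘ₗ TensorProduct.map π π)
    (hΔ : Coalgebra.comul ∘ₗ π = TensorProduct.map π π ∘ₗ ΔU) :
    LinearMap.range π = Subalgebra.toSubmodule (Algebra.adjoin k (L : Set A)) := by
  have hm' (x y : Enveloping Ψt) : π (x * y) = transMul R (π x ⊗ₜ π y) := by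
    simpa using LinearMap.congr_fun hm (x ⊗ₜ y)
  have hι' (v : L) : π (Enveloping.ι Ψt v) = v := LinearMap.congr_fun hι v
  apply le_antisymm
  · rintro _ ⟨x, rfl⟩
    induction x using Enveloping.induction with
    | algebraMap c =>
      rw [Algebra.algebraMap_eq_smul_one, map_smul, h1]
      exact Submodule.smul_mem _ _ (Subalgebra.one_mem _)
    | ι v => rw [hι']; exact Algebra.subset_adjoin v.2
    | mul x y hx hy =>
      rw [hm']
      exact hL.adjoin.transMul_mem (fun a ha b hb => Subalgebra.mul_mem _ ha hb) hx hy
    | add x y hx hy => rw [map_add]; exact add_mem hx hy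
  -- The range inherits a coproduct from `ΔU`; this permits passing from • to the ordinary product.
  · have hC : IsSubcoalgebra (LinearMap.range π) := by
      rintro _ ⟨_, ⟨x, rfl⟩, rfl⟩
      have e := LinearMap.congr_fun hΔ x
      simp only [LinearMap.comp_apply] at e
      rw [e]
      refine ⟨TensorProduct.map π.rangeRestrict π.rangeRestrict (ΔU x), ?_⟩
      rw [TensorProduct.map_map]
      rfl
    intro a ha
    have ha' : a ∈ Algebra.adjoin k (L : Set A) := ha
    induction ha' using Algebra.adjoin_induction with
    | mem x hx => exact ⟨Enveloping.ι Ψt ⟨x, hx⟩, hι' _⟩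
    | algebraMap r =>
      exact ⟨algebraMap k _ r, by
        rw [Algebra.algebraMap_eq_smul_one, map_smul, h1, Algebra.algebraMap_eq_smul_one]⟩
    | add x y hx' hy' hx hy => exact add_mem (hx hx') (hy hy')
    | mul x y hx' hy' hx hy =>
      refine hC.mul_mem hR ?_ (hx hx') (hy hy')
      rintro _ ⟨u, rfl⟩ _ ⟨v, rfl⟩
      exact ⟨u * v, hm' u v⟩

lemma exists_bracket {ρL : L →ₗ[k] L ⊗[k] A} (hρ : IsComoduleHom ρL (adR k A) L.subtype) :
    ∃ brL : L ⊗[k] L →ₗ[k] L,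
      bracket R ∘ₗ TensorProduct.map L.subtype L.subtype = L.subtype ∘ₗ brL := by
  refine ⟨(TensorProduct.rid k L).toLinearMap ∘ₗ TensorProduct.map LinearMap.id
    (quantumKilling R ∘ₗ TensorProduct.map L.subtype LinearMap.id) ∘ₗ
    (TensorProduct.leftComm k L L A).toLinearMap ∘ₗ TensorProduct.map LinearMap.id ρL, ?_⟩
  ext x y
  have h := hρ.apply y
  simp only [bracket, AlgebraTensorModule.curry_apply, curry_apply,
    LinearMap.coe_restrictScalars, LinearMap.comp_apply, TensorProduct.map_tmul,
    LinearMap.id_apply, LinearEquiv.coe_coe, h]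
  generalize ρL y = t
  induction t using TensorProduct.induction_on with
  | zero => simp
  | add x y hx hy => simp only [map_add, tmul_add, hx, hy]
  | tmul x b => simp

section Restriction

variable {ρL : L →ₗ[k] L ⊗[k] A} {ΔL : L →ₗ[k] L ⊗[k] L} {brL : L ⊗[k] L →ₗ[k] L}

lemma isComoduleHom_lieBraiding_restrict (hR : IsCoquasitriangular R)
    (hρ : IsComoduleHom ρL (adR k A) L.subtype)
    (hΨ : lieBraiding R (adR k A) (coR k A) (bracket R) ∘ₗ
      TensorProduct.map L.subtype L.subtype =
      TensorProduct.map L.subtype L.subtype ∘ₗ lieBraiding R ρL ΔL brL) :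
    IsComoduleHom (tensorCoaction ρL ρL) (tensorCoaction ρL ρL) (lieBraiding R ρL ΔL brL) := by
  refine IsComoduleHom.of_injective
    (map_injective L.subtype_injective L.subtype_injective) hρ.tensor ?_
  rw [← hΨ]
  refine IsComoduleHom.comp ?_ hρ.tensor
  rw [tensorCoaction_eq]
  exact isComoduleHom_lieBraiding hR

lemma middle_comul_lieBraiding_restrict (hR : IsCoquasitriangular R)
    (hρ : IsComoduleHom ρL (adR k A) L.subtype)
    (hΔ : coR k A ∘ₗ L.subtype = TensorProduct.map L.subtype L.subtype ∘ₗ ΔL)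
    (hΨ : lieBraiding R (adR k A) (coR k A) (bracket R) ∘ₗ
      TensorProduct.map L.subtype L.subtype =
      TensorProduct.map L.subtype L.subtype ∘ₗ lieBraiding R ρL ΔL brL) :
    middle (braiding R ρL ρL) ∘ₗ TensorProduct.map ΔL ΔL ∘ₗ lieBraiding R ρL ΔL brL =
      TensorProduct.map (lieBraiding R ρL ΔL brL) (lieBraiding R ρL ΔL brL) ∘ₗ
        middle (braiding R ρL ρL) ∘ₗ TensorProduct.map ΔL ΔL := by
  have hi := L.subtype_injective
  refine comp_left_cancel (map_injective (map_injective hi hi) (map_injective hi hi)) (LinearMap.ext fun x => ?_)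
  have hm (y) := LinearMap.congr_fun (middle_natural (braiding_natural R hρ)) y
  have hΨ' (y) := LinearMap.congr_fun hΨ y
  have h1 (y : L ⊗[k] L) : TensorProduct.map (coR k A) (coR k A)
      (TensorProduct.map L.subtype L.subtype y) =
      TensorProduct.map (TensorProduct.map L.subtype L.subtype)
        (TensorProduct.map L.subtype L.subtype) (TensorProduct.map ΔL ΔL y) := by
    rw [TensorProduct.map_map, TensorProduct.map_map, hΔ]
  have h2 (y : (L ⊗[k] L) ⊗[k] (L ⊗[k] L)) :
      TensorProduct.map (lieBraiding R (adR k A) (coR k A) (bracket R))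
        (lieBraiding R (adR k A) (coR k A) (bracket R))
      (TensorProduct.map (TensorProduct.map L.subtype L.subtype)
        (TensorProduct.map L.subtype L.subtype) y) =
      TensorProduct.map (TensorProduct.map L.subtype L.subtype)
        (TensorProduct.map L.subtype L.subtype)
        (TensorProduct.map (lieBraiding R ρL ΔL brL) (lieBraiding R ρL ΔL brL) y) := by
    rw [TensorProduct.map_map, TensorProduct.map_map, hΨ]
  have h := middle_comul_lieBraiding hR (TensorProduct.map L.subtype L.subtype x)
  simp only [LinearMap.comp_apply] at hm hΨ' ⊢
  rw [hΨ', h1, h1, hm, hm, h2] at h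
  exact h

end Restriction

end Calculus
end BraidedLie

end

/-! ### Assembly of the theorem. -/

open BraidedLie in
theorem theorem4p3 {k : Type*} [Field k] {A : Type*} [Ring A] [HopfAlgebra k A]
    (R : A ⊗[k] A →ₗ[k] k) (hR : IsCoquasitriangular R) :
    -- the transmutation `B(A)` is a Hopf algebra in the category and is Ad-cocommutative
    IsHopfAlgebraIn R (adR k A) (transMul R) (Algebra.linearMap k A)
      Coalgebra.comul Coalgebra.counit (transAntipode R) ∧
    IsAdCocommutative R (adR k A) (transMul R) Coalgebra.comul (transAntipode R) ∧
    -- its braided adjoint action is the bracket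
    braidedAd R (adR k A) (transMul R) Coalgebra.comul (transAntipode R) = bracket R ∧
    -- `A` is a braided-Lie algebra
    IsBraidedLieAlgebra R (adR k A) Coalgebra.comul Coalgebra.counit (bracket R) ∧
    -- every subcoalgebra `L` is a braided-Lie algebra by restriction
    ∀ L : Submodule k A, IsSubcoalgebra L →
      ∃ (ρL : L →ₗ[k] L ⊗[k] A) (ΔL : L →ₗ[k] L ⊗[k] L) (brL : L ⊗[k] L →ₗ[k] L),
        TensorProduct.map L.subtype LinearMap.id ∘ₗ ρL = adR k A ∘ₗ L.subtype ∧
        TensorProduct.map L.subtype L.subtype ∘ₗ ΔL = Coalgebra.comul ∘ₗ L.subtype ∧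
        L.subtype ∘ₗ brL = bracket R ∘ₗ TensorProduct.map L.subtype L.subtype ∧
        IsBraidedLieAlgebra R ρL ΔL (Coalgebra.counit ∘ₗ L.subtype) brL ∧
        -- `U(L)` is a bialgebra in the category, with the structure that extends the one of `L`
        ∃ (ρU : Enveloping (lieBraiding R ρL ΔL brL) →ₗ[k]
              Enveloping (lieBraiding R ρL ΔL brL) ⊗[k] A)
          (ΔU : Enveloping (lieBraiding R ρL ΔL brL) →ₗ[k]
              Enveloping (lieBraiding R ρL ΔL brL) ⊗[k] Enveloping (lieBraiding R ρL ΔL brL))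
          (εU : Enveloping (lieBraiding R ρL ΔL brL) →ₗ[k] k),
          IsBialgebraIn R ρU (LinearMap.mul' k _) (Algebra.linearMap k _) ΔU εU ∧
          ρU ∘ₗ Enveloping.ι _ = TensorProduct.map (Enveloping.ι _) LinearMap.id ∘ₗ ρL ∧
          ΔU ∘ₗ Enveloping.ι _ = TensorProduct.map (Enveloping.ι _) (Enveloping.ι _) ∘ₗ ΔL ∧
          εU ∘ₗ Enveloping.ι _ = Coalgebra.counit ∘ₗ L.subtype ∧
          -- and the inclusion of `L` extends to a morphism of bialgebras `U(L) → B(A)`, whose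
          -- image is the subalgebra generated by `L`; it is onto exactly if `L` generates `A`
          ∃ π : Enveloping (lieBraiding R ρL ΔL brL) →ₗ[k] A,
            π ∘ₗ Enveloping.ι _ = L.subtype ∧
            IsBialgebraHomIn ρU (LinearMap.mul' k _) (Algebra.linearMap k _) ΔU εU
              (adR k A) (transMul R) (Algebra.linearMap k A)
              Coalgebra.comul Coalgebra.counit π ∧
            LinearMap.range π = Subalgebra.toSubmodule (Algebra.adjoin k (L : Set A)) ∧
            (Function.Surjective π ↔ Algebra.adjoin k (L : Set A) = ⊤) := by
  refine ⟨isHopfAlgebraIn_trans hR, ?_, braidedAd_eq_bracket hR, isBraidedLieAlgebra_bracket hR,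
    fun L hL => ?_⟩
  · rw [IsAdCocommutative, braidedAd_eq_bracket hR]
    exact isCocommutativeWrt_bracket hR
  obtain ⟨ΔL, hΔ⟩ := hL.exists_comul
  obtain ⟨ρL, hρ⟩ := hL.exists_adR
  obtain ⟨brL, hbr⟩ := exists_bracket (R := R) hρ
  have hΨ := lieBraiding_natural R hρ hΔ hbr
  have hLie := (isBraidedLieAlgebra_bracket hR).of_injective L.subtype_injective hρ hΔ hbr
  refine ⟨ρL, ΔL, brL, Eq.symm hρ, hΔ.symm, hbr.symm, hLie, ?_⟩
  obtain ⟨ρU, ΔU, εU, hU, hρU, hΔU, hεU⟩ := Enveloping.exists_bialgebra hR hLie.coalgebra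
    (isComoduleHom_lieBraiding_restrict hR hρ hΨ)
    (middle_comul_lieBraiding_restrict hR hρ hΔ hΨ) (by
      rw [TensorProduct.map_comp, LinearMap.comp_assoc, ← hΨ, ← LinearMap.comp_assoc,
        ← LinearMap.comp_assoc, LinearMap.comp_assoc _ _ (LinearMap.mul' k k),
        counit_lieBraiding hR, LinearMap.comp_assoc])
  refine ⟨ρU, ΔU, εU, hU, hρU, hΔU, hεU, ?_⟩
  -- The inclusion respects the enveloping relations because • ∘ Ψ̃ = •, restricted to `L`.
  obtain ⟨π, hπ, hom⟩ := Enveloping.exists_bialgebraHom hU hρU hΔU hεU (isBialgebraIn_trans hR)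
    hρ hΔ rfl (by rw [← hΨ, ← LinearMap.comp_assoc, transMul_lieBraiding hR])
  have hrange := range_eq_adjoin hR hL hπ
    (by simpa using LinearMap.congr_fun hom.map_unit 1) hom.map_mul hom.map_comul
  refine ⟨π, hπ, hom, hrange, ?_⟩
  rw [← LinearMap.range_eq_top, hrange, ← Algebra.top_toSubmodule,
    Subalgebra.toSubmodule.injective.eq_iff]
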